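/- **Model.** There are $n\ge 1$ agents with mutually independent values; the value of agent $i$ has distribution $D_i$, and all $D_i$ are supported on a finite set of non-negative reals $v_1<\dots<v_m$, with $d_{ij}=\Pr[D_i=v_j]$. An *independent signaling scheme* consists of (i) a mapping rule: for each agent $i$ a finite signal set $\Gamma_i$ and, for each value $v_j$, a probability distribution on $\Gamma_i$ from which the signal $\sigma_i$ is drawn when agent $i$ has value $v_j$ (independently across agents); and (ii) a selection rule: for each joint signal $\sigma=(\sigma_1,\dots,\sigma_n)$ probabilities $w_i(\sigma)$, summing to $1$, with which the agents are selected, such that for every $\sigma$ of positive probability only agents whose posterior mean $\mu_i(\sigma)=\mathbb{E}[D_i\mid\sigma_i]$ is largest are selected with positive probability. A *signaling policy* $\Omega$ is a probability distribution over independent signaling schemes. The expected utility of agent $i$ is $U_i(\Omega)=\mathbb{E}_{\omega\sim\Omega}\big[\sum_{\sigma} q_\omega(\sigma)\,w_i(\sigma)\,\mu_i(\sigma)\big]$, where $q_\omega(\sigma)$ is the probability that the joint signal is $\sigma$ under $\omega$. A scheme is *Full Revelation* if the signal of each agent is its value (up to renaming signals); a Full Revelation policy is a distribution over Full Revelation schemes.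 For $\alpha\ge 1$, a Full Revelation policy $\Omega$ is *$\alpha$-majorized within the class of Full Revelation policies* if for all $k\in\{1,\dots,n\}$ and all Full Revelation policies $\Omega'$, the sum of the $k$ smallest numbers among $U_1(\Omega),\dots,U_n(\Omega)$ is at least $1/\alpha$ times the sum of the $k$ smallest numbers among $U_1(\Omega'),\dots,U_n(\Omega')$. **Theorem.** For all such value distributions there is a selection rule (choosing, possibly at random, among the agents with the largest revealed value) such that Full Revelation paired with this selection rule is $2$-majorized within the class of Full Revelation policies. Moreover, when all $v_j$ and $d_{ij}$ are rational, the selection rule can be chosen computable in polynomial time: there is a single randomized algorithm which, given the $v_j$ and $d_{ij}$ and the revealed values of the agents, halts within a number of bit operations polynomial in the binary length of the $v_j$ and $d_{ij}$, using polynomially many fair coin tosses, and outputs agent $i$ with exactly the probability that the rule prescribes, and the rule that it realizes makes Full Revelation $2$-majorized within the class of Full Revelation policies for every rational input. -/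

import Mathlib

open scoped BigOperators

namespace Persuasion

/-! ### Value distributions -/

/-- `n ≥ 1` agents with independent values. The possible values are `val 0 < val 1 < ⋯`
(`m` of them, all non-negative), and agent `i` has value `val j` with probability `prob i j`.
The data lie in the ordered field `K` (`ℝ` for the model, `ℚ` for inputs of algorithms). -/
structure Market (K : Type) [Field K] [LinearOrder K] (n m : ℕ) where
  n_pos : 0 < n
  val : Fin m → K
  val_strictMono : StrictMono val
  val_nonneg : ∀ j, 0 ≤ val j
  prob : Fin n → Fin m → K
  prob_nonneg : ∀ i j, 0 ≤ prob i j
  prob_sum : ∀ i, ∑ j, prob i j = 1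

/-- A market with rational data, seen as a market with real data. -/
noncomputable def Market.toReal {n m : ℕ} (I : Market ℚ n m) : Market ℝ n m where
  n_pos := I.n_pos
  val j := (I.val j : ℝ)
  val_strictMono _ _ h := Rat.cast_lt.mpr (I.val_strictMono h)
  val_nonneg j := Rat.cast_nonneg.mpr (I.val_nonneg j)
  prob i j := (I.prob i j : ℝ)
  prob_nonneg i j := Rat.cast_nonneg.mpr (I.prob_nonneg i j)
  prob_sum i := by exact_mod_cast congrArg (fun q : ℚ => (q : ℝ)) (I.prob_sum i)

/-! ### Independent signaling schemes and signaling policies -/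

/-- An (independent) mapping rule: a finite set `Γ i` of signals for each agent `i`, and for
each possible value `val j` of agent `i` a probability distribution `map i j` on `Γ i`. -/
structure MappingRule (n m : ℕ) where
  Γ : Fin n → Type
  [fin : ∀ i, Fintype (Γ i)]
  map : ∀ i, Fin m → Γ i → ℝ
  map_mem : ∀ i j, map i j ∈ stdSimplex ℝ (Γ i)

attribute [instance] MappingRule.fin

namespace MappingRule

variable {n m : ℕ}

/-- The probability that the signal of agent `i` is `s`. -/
noncomputable def agentSignalProb (I : Market ℝ n m) (g : MappingRule n m)
    (i : Fin n) (s : g.Γ i) : ℝ :=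
  ∑ j, I.prob i j * g.map i j s

/-- The probability that the receiver observes the joint signal `σ`
(values, and signals given values, are independent across agents). -/
noncomputable def signalProb (I : Market ℝ n m) (g : MappingRule n m) (σ : ∀ i, g.Γ i) : ℝ :=
  ∏ i, g.agentSignalProb I i (σ i)

/-- The posterior mean of the value of agent `i` given its signal `s`, by Bayes' rule
(only meaningful, and only used, when `s` has positive probability). -/
noncomputable def posteriorMean (I : Market ℝ n m) (g : MappingRule n m)
    (i : Fin n) (s : g.Γ i) : ℝ :=
  (∑ j, I.val j * (I.prob i j * g.map i j s)) / g.agentSignalProb I i s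

/-- Full Revelation: the signal of each agent is, up to the name of the signal, its value. -/
def IsFullRevelation (g : MappingRule n m) : Prop :=
  ∃ f : ∀ i, Fin m → g.Γ i, (∀ i, Function.Injective (f i)) ∧ ∀ i j, g.map i j (f i j) = 1

end MappingRule

/-- An independent signaling scheme: a mapping rule and a selection rule. Given a joint signal
`σ` (that occurs), agent `i` is selected with probability `select σ i`, which can be non-zero
only if `i` has the largest posterior mean. -/
structure Scheme {n m : ℕ} (I : Market ℝ n m) extends MappingRule n m where
  select : (∀ i, Γ i) → Fin n → ℝ
  select_mem : ∀ σ, select σ ∈ stdSimplex ℝ (Fin n)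
  select_max : ∀ σ, 0 < toMappingRule.signalProb I σ → ∀ i, select σ i ≠ 0 →
    ∀ k, toMappingRule.posteriorMean I k (σ k) ≤ toMappingRule.posteriorMean I i (σ i)

/-- The expected utility of agent `i` in a scheme. -/
noncomputable def Scheme.utility {n m : ℕ} {I : Market ℝ n m} (ω : Scheme I) (i : Fin n) : ℝ :=
  ∑ σ : ∀ i, ω.Γ i, ω.toMappingRule.signalProb I σ * ω.select σ i *
    ω.toMappingRule.posteriorMean I i (σ i)

/-- A signaling policy: a random independent signaling scheme, given as a family of schemes over
an arbitrary probability space. Measurability is required only of the utilities. -/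
structure Policy {n m : ℕ} (I : Market ℝ n m) where
  Ω : Type
  [meas : MeasurableSpace Ω]
  law : MeasureTheory.Measure Ω
  [isProb : MeasureTheory.IsProbabilityMeasure law]
  scheme : Ω → Scheme I
  measurable_utility : ∀ i, Measurable fun ω => (scheme ω).utility i

attribute [instance] Policy.meas Policy.isProb

/-- The expected utility of agent `i` in a policy. -/
noncomputable def Policy.utility {n m : ℕ} {I : Market ℝ n m} (Q : Policy I) (i : Fin n) : ℝ :=
  ∫ ω, (Q.scheme ω).utility i ∂Q.law

/-- The policy that always uses the scheme `ω`. -/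
noncomputable def Policy.ofScheme {n m : ℕ} {I : Market ℝ n m} (ω : Scheme I) : Policy I where
  Ω := Unit
  law := MeasureTheory.Measure.dirac ()
  scheme _ := ω
  measurable_utility _ := measurable_const

/-- The class of Full Revelation policies: random Full Revelation schemes. -/
def fullRevelationPolicies {n m : ℕ} (I : Market ℝ n m) : Set (Policy I) :=
  {Q | ∀ᵐ ω ∂Q.law, (Q.scheme ω).IsFullRevelation}

/-! ### Approximate majorization -/

/-- The sum of the `k` smallest entries of `u`. -/
noncomputable def sumSmallest {n : ℕ} (k : ℕ) (u : Fin n → ℝ) : ℝ :=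
  ∑ r : Fin n with r.val < k, u (Tuple.sort u r)

/-- The policy `Q` belongs to the class `C` and is `α`-majorized within it. -/
def IsMajorizedWithin {n m : ℕ} {I : Market ℝ n m} (α : ℝ) (C : Set (Policy I))
    (Q : Policy I) : Prop :=
  Q ∈ C ∧ ∀ k : ℕ, 1 ≤ k → k ≤ n → ∀ Q' ∈ C,
    1 / α * sumSmallest k Q'.utility ≤ sumSmallest k Q.utility

/-! ### Full Revelation with a selection rule -/

/-- A selection rule for Full Revelation: when the revealed values are `val (a i)`, agent `i` is
selected with probability `select a i`, and only agents with the top value can be selected. -/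
structure SelectionRule {n m : ℕ} (I : Market ℝ n m) where
  select : (Fin n → Fin m) → Fin n → ℝ
  select_mem : ∀ a, select a ∈ stdSimplex ℝ (Fin n)
  select_max : ∀ a i, select a i ≠ 0 → ∀ k, I.val (a k) ≤ I.val (a i)

/-- The mapping rule that reveals the values. -/
noncomputable def reveal (n m : ℕ) : MappingRule n m where
  Γ _ := Fin m
  map _ j := Pi.single j 1
  map_mem _ j := single_mem_stdSimplex ℝ j

theorem reveal_agentSignalProb {n m : ℕ} (I : Market ℝ n m) (i : Fin n) (s : Fin m) :
    (reveal n m).agentSignalProb I i s = I.prob i s := by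
  simp [MappingRule.agentSignalProb, reveal, Pi.single_apply]

theorem reveal_posteriorMean {n m : ℕ} (I : Market ℝ n m) (i : Fin n) (s : Fin m)
    (h : I.prob i s ≠ 0) : (reveal n m).posteriorMean I i s = I.val s := by
  have h₁ : (reveal n m).agentSignalProb I i s = I.prob i s := reveal_agentSignalProb I i s
  have h₂ : ∑ j, I.val j * (I.prob i j * (reveal n m).map i j s) = I.val s * I.prob i s := by
    simp [reveal, Pi.single_apply]
  unfold MappingRule.posteriorMean
  rw [h₁, h₂, mul_div_cancel_right₀ _ h]

/-- Full Revelation paired with a selection rule, as an independent signaling scheme. -/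
noncomputable def SelectionRule.scheme {n m : ℕ} {I : Market ℝ n m} (w : SelectionRule I) :
    Scheme I where
  toMappingRule := reveal n m
  select := w.select
  select_mem := w.select_mem
  select_max := by
    intro σ hσ i hi k
    have hp : ∀ l : Fin n, I.prob l (σ l) ≠ 0 := by
      intro l hl
      refine hσ.ne' (Finset.prod_eq_zero (Finset.mem_univ l) ?_)
      exact (reveal_agentSignalProb I l (σ l)).trans hl
    have h := w.select_max σ i hi k
    rw [← reveal_posteriorMean I k (σ k) (hp k), ← reveal_posteriorMean I i (σ i) (hp i)] at h
    exact h

/-- Full Revelation paired with a selection rule, as a signaling policy. -/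
noncomputable def SelectionRule.policy {n m : ℕ} {I : Market ℝ n m} (w : SelectionRule I) :
    Policy I :=
  Policy.ofScheme w.scheme

/-! ### Programs and their running time

A structured random access machine with logarithmic (bit) cost: the memory consists of arrays of
rational numbers, named by natural numbers, and every number that is produced or used in an
evaluation is charged its length in binary. Polynomial time in this model is polynomial time on
Turing machines. -/

/-- The number of bits of a rational number in lowest terms (at least `1`). -/
def bits (q : ℚ) : ℕ := q.num.natAbs.size + q.den.size

/-- Memory: `M a k` is the entry of array `a` at position `k`. -/
abbrev Memory : Type := ℕ → ℕ → ℚ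

/-- Arithmetic expressions; `get a e` is the entry of array `a` at position `e`. -/
inductive AExp where
  | const (q : ℚ)
  | get (a : ℕ) (e : AExp)
  | add (e₁ e₂ : AExp)
  | sub (e₁ e₂ : AExp)
  | mul (e₁ e₂ : AExp)
  | div (e₁ e₂ : AExp)
  | floor (e : AExp)

/-- The value of an expression; a quotient by zero evaluates to zero, and a rational number `q`
used as a position means position `⌊q⌋₊`. -/
def AExp.eval (M : Memory) : AExp → ℚ
  | const q => q
  | get a e => M a ⌊e.eval M⌋₊
  | add e₁ e₂ => e₁.eval M + e₂.eval M
  | sub e₁ e₂ => e₁.eval M - e₂.eval M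
  | mul e₁ e₂ => e₁.eval M * e₂.eval M
  | div e₁ e₂ => e₁.eval M / e₂.eval M
  | floor e => (⌊e.eval M⌋ : ℤ)

/-- The cost of evaluating an expression: the total number of bits of the values of all its
subexpressions. -/
def AExp.cost (M : Memory) : AExp → ℕ
  | const q => bits q
  | get a e => e.cost M + bits ((get a e).eval M)
  | add e₁ e₂ => e₁.cost M + e₂.cost M + bits ((add e₁ e₂).eval M)
  | sub e₁ e₂ => e₁.cost M + e₂.cost M + bits ((sub e₁ e₂).eval M)
  | mul e₁ e₂ => e₁.cost M + e₂.cost M + bits ((mul e₁ e₂).eval M)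
  | div e₁ e₂ => e₁.cost M + e₂.cost M + bits ((div e₁ e₂).eval M)
  | floor e => e.cost M + bits ((floor e).eval M)

/-- Programs. -/
inductive Program where
  | skip
  /-- array `a` at position `e` gets the value of `e'` -/
  | assign (a : ℕ) (e e' : AExp)
  | seq (p q : Program)
  /-- if `e ≤ e'` then `p` else `q` -/
  | ite (e e' : AExp) (p q : Program)
  /-- while `e < e'` do `p` -/
  | loop (e e' : AExp) (p : Program)

/-- `Exec p M M' t`: started with memory `M`, the program `p` halts with memory `M'`, at total
cost `t`. -/
inductive Exec : Program → Memory → Memory → ℕ → Prop where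
  | skip (M) : Exec .skip M M 1
  | assign (M a e e') :
      Exec (.assign a e e') M
        (Function.update M a (Function.update (M a) ⌊e.eval M⌋₊ (e'.eval M)))
        (e.cost M + e'.cost M + 1)
  | seq {p q M M₁ M₂ t₁ t₂} : Exec p M M₁ t₁ → Exec q M₁ M₂ t₂ →
      Exec (.seq p q) M M₂ (t₁ + t₂ + 1)
  | ite_true {e e' p q M M' t} : e.eval M ≤ e'.eval M → Exec p M M' t →
      Exec (.ite e e' p q) M M' (e.cost M + e'.cost M + t + 1)
  | ite_false {e e' p q M M' t} : ¬ e.eval M ≤ e'.eval M → Exec q M M' t →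
      Exec (.ite e e' p q) M M' (e.cost M + e'.cost M + t + 1)
  | loop_done {e e' p M} : ¬ e.eval M < e'.eval M →
      Exec (.loop e e' p) M M (e.cost M + e'.cost M + 1)
  | loop_step {e e' p M M₁ M₂ t₁ t₂} : e.eval M < e'.eval M → Exec p M M₁ t₁ →
      Exec (.loop e e' p) M₁ M₂ t₂ →
      Exec (.loop e e' p) M M₂ (e.cost M + e'.cost M + t₁ + t₂ + 1)

/-! ### Polynomial-time selection -/

/-- The length in binary of the description of the value distributions. -/
def Market.size {n m : ℕ} (I : Market ℚ n m) : ℕ :=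
  n + m + ∑ j, bits (I.val j) + ∑ i, ∑ j, bits (I.prob i j)

/-- The initial memory: array 0 holds `n, m`; array 1 the possible values; array 2 the
probabilities (`prob i j` at position `i * m + j`); array 3 the revealed values of the agents;
array 4 the results (0 or 1) of `ℓ` coin tosses. Everything else is zero. -/
def inputMemory {n m : ℕ} (I : Market ℚ n m) (a : Fin n → Fin m) {ℓ : ℕ} (c : Fin ℓ → Bool) :
    Memory
  | 0, 0 => n
  | 0, 1 => m
  | 1, j => if h : j < m then I.val ⟨j, h⟩ else 0
  | 2, k => if h : k < n * m then
      I.prob (finProdFinEquiv.symm ⟨k, h⟩).1 (finProdFinEquiv.symm ⟨k, h⟩).2 else 0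
  | 3, i => if h : i < n then I.val (a ⟨i, h⟩) else 0
  | 4, k => if h : k < ℓ then (if c ⟨k, h⟩ then 1 else 0) else 0
  | _, _ => 0

/-- Started on the value distributions `I`, the revealed values given by `a` and the coin tosses
`c`, the program halts at cost at most `T` and outputs agent `i` (in array 5, position 0). -/
def Selects (p : Program) {n m : ℕ} (I : Market ℚ n m) (a : Fin n → Fin m) {ℓ : ℕ}
    (c : Fin ℓ → Bool) (T : ℕ) (i : Fin n) : Prop :=
  ∃ (M : Memory) (t : ℕ), Exec p (inputMemory I a c) M t ∧ t ≤ T ∧ M 5 0 = (i.val : ℚ)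

/-- A family of selection rules, one for each market with rational data, is computable in
(randomized) polynomial time: a single program, given the value distributions, the revealed
values and polynomially many independent fair coin tosses, halts within polynomially many steps
for all outcomes of the tosses, and selects each agent with exactly the probability that the
selection rule prescribes. -/
def PolyTimeSelection (W : ∀ (n m : ℕ) (I : Market ℚ n m), SelectionRule I.toReal) : Prop :=
  ∃ (p : Program) (P : Polynomial ℕ), ∀ (n m : ℕ) (I : Market ℚ n m) (a : Fin n → Fin m),
    ∃ out : (Fin (P.eval I.size) → Bool) → Fin n,
      (∀ c, Selects p I a c (P.eval I.size) (out c)) ∧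
      ∀ i, (W n m I).select a i =
        (Nat.card {c : Fin (P.eval I.size) → Bool // out c = i} : ℝ) / 2 ^ P.eval I.size

end Persuasion

namespace Persuasion

/-! ### Monotone sequences with dominated partial sums -/

/-! Rank the agents by a vector `u`, poorest first, and always select the poorest among the agents
with the top value; let `b = bid I u` be the resulting utilities. A prefix of the ranking misses a
profile of values only if none of its members has the top value, so every prefix receives under `b`
at least as much as under any Full Revelation policy (`IsRevealed.sum_le_sum_bid`,
`policy_sum_sort_le`). If `b = u`, then `u` dominates every other vector in all sums of smallest
entries, without any loss.

An approximate fixed point suffices for the factor 2. The gap `∑ (b i - u i) / u i` is the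
Frank–Wolfe gap of the Nash welfare `∑ log (u i)`, as `b` maximizes the linearization at `u`. If the
gap is at most `1/2`, then `partial_sums_le_two_mul` applies: between the partial sums of a
competitor `y` and those of `b` lies a convex sequence, with increments `c`, that has kinks only
where it touches the latter. Two Abel summations give `∑ (c i - u i)^2 / (u i * c i) ≤ 1/2`, hence
`c i ≤ 2 * u i` for each `i`.

Such a `u` is reached by the iteration `track`: move `u` towards `bid I u` with a fixed dyadic step
size. The first `n` steps each reset one agent to zero, which puts it at the head of the ranking and
secures it a fixed share of its largest utility. From then on every step with gap above `1/2`
multiplies the product of the shares by at least `1 + rate / 4` (`potential_succ`); as this product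
is at most 1, the gap is small after polynomially many steps (`exists_frozen`). The same convex
combinations, applied to the selection rules instead of the utilities, give `selectProb`, whose
utilities are at least `track` (`track_le_sum`).

For the algorithm, a step size `2 ^ (-g)` means that the current ranking is adopted exactly when `g`
fair coins all show zero, so the rule is sampled exactly (`card_selAgent`). The numbers stay short
because the utilities after `t` steps have the common denominator `trackDen I t`, whose length grows
linearly in `t`, and `bid` factorizes over the agents, so no enumeration of value profiles is
needed. -/

theorem sum_mul_nonpos_of_partial_sums (d g : ℕ → ℝ) (n : ℕ)
    (h : ∀ k, k + 1 < n → (∑ i ∈ Finset.range (k + 1), d i) * (g k - g (k + 1)) ≤ 0)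
    (hn : ∀ k, k + 1 = n → (∑ i ∈ Finset.range n, d i) * g k ≤ 0) :
    ∑ i ∈ Finset.range n, d i * g i ≤ 0 := by
  -- Abel summation: `h` allows the weight of the partial sum collected so far to be changed from `g
  -- k` to `g (k + 1)` without decreasing the bound.
  have key : ∀ k, k + 1 ≤ n → ∑ i ∈ Finset.range (k + 1), d i * g i ≤
      (∑ i ∈ Finset.range (k + 1), d i) * g k := by
    intro k
    induction k with
    | zero => intro _; simp
    | succ k ih =>
      intro hk
      have h1 := ih (by omega)
      have h2 := h k (by omega)
      rw [Finset.sum_range_succ, Finset.sum_range_succ d]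
      nlinarith
  rcases n with _ | n
  · simp
  · exact (key n le_rfl).trans (hn n rfl)

/-- Below the partial sums of `b` there is a convex sequence of partial sums, above a given one,
that has a kink only where it touches those of `b`. -/
theorem exists_tight_minorant (n : ℕ) (b y : ℕ → ℝ) (hy0 : ∀ i < n, 0 ≤ y i)
    (hy : ∀ i, i + 1 < n → y i ≤ y (i + 1))
    (hyb : ∀ k ≤ n, ∑ i ∈ Finset.range k, y i ≤ ∑ i ∈ Finset.range k, b i) :
    ∃ c : ℕ → ℝ, (∀ i < n, 0 ≤ c i) ∧ (∀ i, i + 1 < n → c i ≤ c (i + 1)) ∧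
      (∀ k ≤ n, ∑ i ∈ Finset.range k, y i ≤ ∑ i ∈ Finset.range k, c i) ∧
      (∀ k ≤ n, ∑ i ∈ Finset.range k, c i ≤ ∑ i ∈ Finset.range k, b i) ∧
      (∑ i ∈ Finset.range n, c i = ∑ i ∈ Finset.range n, b i) ∧
      (∀ k, k + 1 < n →
        ∑ i ∈ Finset.range (k + 1), c i < ∑ i ∈ Finset.range (k + 1), b i → c k = c (k + 1)) := by
  -- The entries from `n` on are forced to vanish so that `S` lies in a product of bounded intervals
  -- and is compact.
  set S : Set (ℕ → ℝ) := {c | (∀ i, 0 ≤ c i) ∧ (∀ i, n ≤ i → c i ≤ 0) ∧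
    (∀ i, i + 1 < n → c i ≤ c (i + 1)) ∧
    (∀ k, k ≤ n → ∑ i ∈ Finset.range k, y i ≤ ∑ i ∈ Finset.range k, c i) ∧
    (∀ k, k ≤ n → ∑ i ∈ Finset.range k, c i ≤ ∑ i ∈ Finset.range k, b i)} with hS
  have hclosed : IsClosed S := by
    simp only [hS, Set.ofPred_and, Set.ofPred_forall]
    refine IsClosed.inter ?_ (IsClosed.inter ?_ (IsClosed.inter ?_ (IsClosed.inter ?_ ?_)))
    · exact isClosed_iInter fun i => isClosed_le continuous_const (continuous_apply i)
    · exact isClosed_iInter fun i => isClosed_iInter fun _ =>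
        isClosed_le (continuous_apply i) continuous_const
    · exact isClosed_iInter fun i => isClosed_iInter fun _ =>
        isClosed_le (continuous_apply i) (continuous_apply _)
    · exact isClosed_iInter fun i => isClosed_iInter fun _ =>
        isClosed_le continuous_const (by fun_prop)
    · exact isClosed_iInter fun i => isClosed_iInter fun _ =>
        isClosed_le (by fun_prop) continuous_const
  have hB : 0 ≤ ∑ i ∈ Finset.range n, b i :=
    le_trans (Finset.sum_nonneg fun i hi => hy0 i (Finset.mem_range.1 hi)) (hyb n le_rfl)
  have hsub : S ⊆ Set.Icc 0 (fun _ => ∑ i ∈ Finset.range n, b i) := by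
    rintro c ⟨h0, h1, -, -, h4⟩
    refine ⟨h0, fun i => ?_⟩
    rcases lt_or_ge i n with hi | hi
    · exact le_trans (Finset.single_le_sum (f := c) (fun j _ => h0 j) (Finset.mem_range.2 hi))
        (h4 n le_rfl)
    · exact (h1 i hi).trans hB
  have hcomp : IsCompact S := isCompact_Icc.of_isClosed_subset hclosed hsub
  have hne : S.Nonempty := by
    have hs : ∀ k ≤ n, ∑ i ∈ Finset.range k, (if i < n then y i else 0) =
        ∑ i ∈ Finset.range k, y i := fun k hk => Finset.sum_congr rfl fun i hi =>
      if_pos (lt_of_lt_of_le (Finset.mem_range.1 hi) hk)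
    refine ⟨fun i => if i < n then y i else 0, fun i => ?_, fun i hi => ?_, fun i hi => ?_,
      fun k hk => (hs k hk).ge, fun k hk => (hs k hk).trans_le (hyb k hk)⟩
    · dsimp only; split_ifs with h
      exacts [hy0 i h, le_rfl]
    · simp [not_lt.2 hi]
    · simp [hi, (Nat.lt_succ_self i).trans hi, hy i hi]
  -- A maximizer of the total of all partial sums works: a violation of either remaining property
  -- leaves room for a perturbation inside `S` that raises one partial sum and changes no other.
  obtain ⟨c, ⟨h0, h1, h2, h3, h4⟩, hmax⟩ := hcomp.exists_isMaxOn hne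
    (f := fun c => ∑ k ∈ Finset.range (n + 1), ∑ i ∈ Finset.range k, c i) (by fun_prop)
  refine ⟨c, fun i _ => h0 i, h2, h3, h4, ?_, ?_⟩
  · by_contra hne
    have hlt := lt_of_le_of_ne (h4 n le_rfl) hne
    obtain _ | n' := n
    · simp at hlt
    set ε := ∑ i ∈ Finset.range (n' + 1), b i - ∑ i ∈ Finset.range (n' + 1), c i with hε
    have hεp : 0 < ε := by linarith
    have hsum : ∀ k, k ≤ n' + 1 → ∑ i ∈ Finset.range k, (c + Pi.single n' ε : ℕ → ℝ) i =
        ∑ i ∈ Finset.range k, c i + if k = n' + 1 then ε else 0 := by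
      intro k hk
      simp only [Pi.add_apply, Finset.sum_add_distrib, Pi.single_apply, Finset.sum_ite_eq', Finset.mem_range]
      congr 1
      exact if_congr (by omega) rfl rfl
    have hmem : c + Pi.single n' ε ∈ S := by
      refine ⟨fun i => ?_, fun i hi => ?_, fun i hi => ?_, fun k hk => ?_, fun k hk => ?_⟩
      · have : (0 : ℝ) ≤ (Pi.single n' ε : ℕ → ℝ) i := by
          rw [Pi.single_apply]; split_ifs <;> linarith
        exact add_nonneg (h0 i) this
      · simpa [Pi.single_apply, show i ≠ n' by omega] using h1 i hi
      · simp only [Pi.add_apply, Pi.single_apply, show i ≠ n' by omega, if_false]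
        have := h2 i hi
        split_ifs <;> linarith
      · rw [hsum k hk]
        have := h3 k hk
        split_ifs <;> linarith
      · rw [hsum k hk]
        split_ifs with h
        · subst h; linarith
        · simpa using h4 k hk
    have := hmax hmem
    simp only [Set.mem_ofPred_eq] at this
    rw [Finset.sum_congr rfl fun k hk => hsum k (by have := Finset.mem_range.1 hk; omega),
      Finset.sum_add_distrib] at this
    simp at this
    linarith
  · intro k hk hlt
    by_contra hne
    have hlt' := lt_of_le_of_ne (h2 k hk) hne
    -- Moving `ε` from entry `k + 1` to entry `k` affects only the partial sum of length `k + 1`.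
    -- The first bound keeps it below that of `b`; half of the jump is the most that preserves the
    -- order of the two entries.
    set ε := min (∑ i ∈ Finset.range (k + 1), b i - ∑ i ∈ Finset.range (k + 1), c i)
      ((c (k + 1) - c k) / 2) with hε
    have hεp : 0 < ε := lt_min (by linarith) (by linarith)
    have hε1 : ε ≤ ∑ i ∈ Finset.range (k + 1), b i - ∑ i ∈ Finset.range (k + 1), c i :=
      min_le_left _ _
    have hε2 : ε ≤ (c (k + 1) - c k) / 2 := min_le_right _ _
    have hsum : ∀ j, ∑ i ∈ Finset.range j, (c + Pi.single k ε - Pi.single (k + 1) ε : ℕ → ℝ) i =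
        ∑ i ∈ Finset.range j, c i + if j = k + 1 then ε else 0 := by
      intro j
      simp only [Pi.add_apply, Pi.sub_apply, Finset.sum_add_distrib, Finset.sum_sub_distrib,
        Pi.single_apply, Finset.sum_ite_eq', Finset.mem_range]
      rcases lt_trichotomy j (k + 1) with h | h | h
      · simp [h.ne, show ¬ k < j by omega, show ¬ k + 1 < j by omega]
      · simp [h]
      · simp [h.ne', show k < j by omega, show k + 1 < j by omega]
    have hmem : c + Pi.single k ε - Pi.single (k + 1) ε ∈ S := by
      refine ⟨fun i => ?_, fun i hi => ?_, fun i hi => ?_, fun j hj => ?_, fun j hj => ?_⟩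
      · simp only [Pi.add_apply, Pi.sub_apply, Pi.single_apply]
        have := h0 i
        have := h0 k
        split_ifs with ha hb hb
        · omega
        · linarith
        · subst hb; linarith
        · linarith
      · simpa [Pi.single_apply, show i ≠ k by omega, show i ≠ k + 1 by omega] using h1 i hi
      · simp only [Pi.add_apply, Pi.sub_apply, Pi.single_apply]
        have := h2 i hi
        by_cases e1 : i = k
        · subst e1; simp; linarith
        by_cases e2 : i = k + 1
        · subst e2; simp [show k + 1 + 1 ≠ k by omega]; linarith
        by_cases e3 : i + 1 = k
        · subst e3; simp [show i ≠ i + 1 + 1 by omega]; linarith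
        · simp [e1, e2, e3]; linarith
      · rw [hsum j]
        have := h3 j hj
        split_ifs <;> linarith
      · rw [hsum j]
        split_ifs with h
        · subst h; linarith
        · simpa using h4 j hj
    have := hmax hmem
    simp only [Set.mem_ofPred_eq] at this
    rw [Finset.sum_congr rfl fun j _ => hsum j, Finset.sum_add_distrib] at this
    have h5 : k < n := by omega
    simp [h5] at this
    linarith

/-- The convention `0⁻¹ = 0` would make the weight `1 / u` smallest exactly where it should be
largest. The sum of all inverses dominates each of them and serves as the weight at the zeros of
`u`. -/
theorem antitone_extended_inv {n : ℕ} {u : ℕ → ℝ} (hu0 : ∀ i < n, 0 ≤ u i)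
    (hu : ∀ i, i + 1 < n → u i ≤ u (i + 1)) (k : ℕ) (hk : k + 1 < n) :
    (if u (k + 1) = 0 then ∑ j ∈ Finset.range n, (u j)⁻¹ else (u (k + 1))⁻¹) ≤
      if u k = 0 then ∑ j ∈ Finset.range n, (u j)⁻¹ else (u k)⁻¹ := by
  have h1 := hu0 k (by omega)
  have h2 := hu k hk
  by_cases hk0 : u k = 0
  · rw [if_pos hk0]
    split_ifs with h
    · exact le_rfl
    · exact Finset.single_le_sum (f := fun j => (u j)⁻¹)
        (fun j hj => inv_nonneg.2 (hu0 j (Finset.mem_range.1 hj))) (Finset.mem_range.2 hk)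
  · have hpos : 0 < u k := lt_of_le_of_ne h1 (Ne.symm hk0)
    rw [if_neg hk0, if_neg (by linarith)]
    exact inv_anti₀ hpos h2

/-- If the total relative excess of `b` over the non-decreasing sequence `u` is at most `1/2`, and
the partial sums of `u` and of the non-decreasing `y` are at most those of `b`, then the partial
sums of `y` are at most twice those of `u`. -/
theorem partial_sums_le_two_mul (n : ℕ) (u b y : ℕ → ℝ) (hu0 : ∀ i < n, 0 ≤ u i)
    (hu : ∀ i, i + 1 < n → u i ≤ u (i + 1)) (hy0 : ∀ i < n, 0 ≤ y i)
    (hy : ∀ i, i + 1 < n → y i ≤ y (i + 1))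
    (hyb : ∀ k ≤ n, ∑ i ∈ Finset.range k, y i ≤ ∑ i ∈ Finset.range k, b i)
    (hub : ∀ k ≤ n, ∑ i ∈ Finset.range k, u i ≤ ∑ i ∈ Finset.range k, b i)
    (hz : ∀ i < n, u i = 0 → b i = 0)
    (hgap : ∑ i ∈ Finset.range n, (b i - u i) / u i ≤ 1 / 2) (k : ℕ) (hk : k ≤ n) :
    ∑ i ∈ Finset.range k, y i ≤ 2 * ∑ i ∈ Finset.range k, u i := by
  obtain ⟨c, hc0, hc, hyc, hcb, hcn, hkink⟩ := exists_tight_minorant n b y hy0 hy hyb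
  have hmono : ∀ i j, i ≤ j → j < n → u i ≤ u j := by
    intro i j hij
    induction j, hij using Nat.le_induction with
    | base => exact fun _ => le_rfl
    | succ j _ ih => exact fun hj => (ih (by omega)).trans (hu j hj)
  have hcmono : ∀ i j, i ≤ j → j < n → c i ≤ c j := by
    intro i j hij
    induction j, hij using Nat.le_induction with
    | base => exact fun _ => le_rfl
    | succ j _ ih => exact fun hj => (ih (by omega)).trans (hc j hj)
  -- A zero of `u` forces all earlier entries of `u`, hence of `b`, to vanish; the partial sum of
  -- `b` up to there then bounds `c i` by zero.
  have hcz : ∀ i < n, u i = 0 → c i = 0 := by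
    intro i hi hui
    have h1 : ∑ j ∈ Finset.range (i + 1), b j = 0 := by
      refine Finset.sum_eq_zero fun j hj => ?_
      have hj' : j ≤ i := Nat.lt_succ_iff.1 (Finset.mem_range.1 hj)
      exact hz j (by omega) (le_antisymm (hui ▸ hmono j i hj' hi) (hu0 j (by omega)))
    have h2 := hcb (i + 1) hi
    have h3 : c i ≤ ∑ j ∈ Finset.range (i + 1), c j :=
      Finset.single_le_sum (f := c) (fun j hj => hc0 j (by have := Finset.mem_range.1 hj; omega))
        (Finset.self_mem_range_succ i)
    exact le_antisymm (by linarith) (hc0 i hi)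
  have huz : ∀ i < n, c i = 0 → u i = 0 := by
    intro i hi hci
    -- Follow the zeros of `c` to the right. Where they end there is a kink, so the partial sums of
    -- `b` and `c` agree and are zero, and those of `u` lie below. If they never end, the same
    -- happens at `n`.
    have key : ∀ j, i ≤ j → j < n → c j = 0 ∨ ∑ l ∈ Finset.range (i + 1), u l ≤ 0 := by
      intro j hij
      induction j, hij using Nat.le_induction with
      | base => exact fun _ => Or.inl hci
      | succ j hij' ih =>
        intro hj
        rcases ih (by omega) with h | h
        · have hzero : ∑ l ∈ Finset.range (j + 1), c l = 0 := by
            refine Finset.sum_eq_zero fun l hl => ?_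
            have hl' : l ≤ j := Nat.lt_succ_iff.1 (Finset.mem_range.1 hl)
            exact le_antisymm (h ▸ hcmono l j hl' (by omega)) (hc0 l (by omega))
          rcases lt_or_ge (∑ i ∈ Finset.range (j + 1), c i) (∑ i ∈ Finset.range (j + 1), b i)
            with h' | h'
          · exact Or.inl (by rw [← hkink j hj h', h])
          · right
            refine le_trans (Finset.sum_le_sum_of_subset_of_nonneg
              (Finset.range_mono (by omega : i + 1 ≤ j + 1)) fun l hl _ => hu0 l ?_)
              ((hub (j + 1) hj.le).trans (h'.trans hzero.le))
            have := Finset.mem_range.1 hl; omega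
        · exact Or.inr h
    have hle : ∑ l ∈ Finset.range (i + 1), u l ≤ 0 := by
      rcases key (n - 1) (by omega) (by omega) with h | h
      · have hzero : ∑ l ∈ Finset.range n, c l = 0 := by
          refine Finset.sum_eq_zero fun l hl => ?_
          have hl' := Finset.mem_range.1 hl
          exact le_antisymm (h ▸ hcmono l (n - 1) (by omega) (by omega)) (hc0 l hl')
        refine le_trans (Finset.sum_le_sum_of_subset_of_nonneg
          (Finset.range_mono (by omega : i + 1 ≤ n)) fun l hl _ => hu0 l (Finset.mem_range.1 hl))
          ((hub n le_rfl).trans (hcn.symm.trans hzero).le)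
      · exact h
    have h3 : u i ≤ ∑ j ∈ Finset.range (i + 1), u j :=
      Finset.single_le_sum (f := u) (fun j hj => hu0 j (by have := Finset.mem_range.1 hj; omega))
        (Finset.self_mem_range_succ i)
    exact le_antisymm (h3.trans hle) (hu0 i hi)
  have hginv : ∀ (x : ℕ → ℝ) (i : ℕ), x i ≠ 0 →
      (if x i = 0 then ∑ j ∈ Finset.range n, (x j)⁻¹ else (x i)⁻¹) = (x i)⁻¹ :=
    fun x i h => if_neg h
  have hge : ∀ (x : ℕ → ℝ), (∀ i < n, 0 ≤ x i) → ∀ i < n,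
      0 ≤ if x i = 0 then ∑ j ∈ Finset.range n, (x j)⁻¹ else (x i)⁻¹ := by
    intro x hx i hi
    split_ifs
    · exact Finset.sum_nonneg fun j hj => inv_nonneg.2 (hx j (Finset.mem_range.1 hj))
    · exact inv_nonneg.2 (hx i hi)
  -- Abel summation with the antitone weights `1 / u`.
  have h1 : ∑ i ∈ Finset.range n, (c i - b i) *
      (if u i = 0 then ∑ j ∈ Finset.range n, (u j)⁻¹ else (u i)⁻¹) ≤ 0 := by
    refine sum_mul_nonpos_of_partial_sums _ _ n (fun k hk => ?_) fun k hk => ?_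
    · rw [Finset.sum_sub_distrib]
      exact mul_nonpos_of_nonpos_of_nonneg (sub_nonpos.2 (hcb (k + 1) hk.le))
        (sub_nonneg.2 (antitone_extended_inv hu0 hu k hk))
    · rw [Finset.sum_sub_distrib]
      exact mul_nonpos_of_nonpos_of_nonneg (sub_nonpos.2 (hcb n le_rfl))
        (hge u hu0 k (by omega))
  -- Abel summation with the weights `1 / c`. They change only at kinks, and there the partial sum
  -- of `c` equals that of `b`, hence is at least that of `u`; elsewhere the comparison of partial
  -- sums is not needed.
  have h2 : ∑ i ∈ Finset.range n, (u i - c i) *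
      (if c i = 0 then ∑ j ∈ Finset.range n, (c j)⁻¹ else (c i)⁻¹) ≤ 0 := by
    refine sum_mul_nonpos_of_partial_sums _ _ n (fun k hk => ?_) fun k hk => ?_
    · rw [Finset.sum_sub_distrib]
      rcases lt_or_ge (∑ i ∈ Finset.range (k + 1), c i) (∑ i ∈ Finset.range (k + 1), b i)
        with h' | h'
      · rw [hkink k hk h']; simp
      · exact mul_nonpos_of_nonpos_of_nonneg (sub_nonpos.2 ((hub (k + 1) hk.le).trans h'))
          (sub_nonneg.2 (antitone_extended_inv hc0 hc k hk))
    · rw [Finset.sum_sub_distrib, hcn]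
      exact mul_nonpos_of_nonpos_of_nonneg (sub_nonpos.2 (hub n le_rfl))
        (hge c hc0 k (by omega))
  -- Split `c - u` as `(c - b) + (b - u)`: the first part is controlled by `h1`, the second by the
  -- gap.
  have hsum : ∑ i ∈ Finset.range n, ((c i - u i) / u i + (u i - c i) / c i) ≤ 1 / 2 := by
    have e1 : ∀ i ∈ Finset.range n, (c i - u i) / u i = (c i - b i) *
      (if u i = 0 then ∑ j ∈ Finset.range n, (u j)⁻¹ else (u i)⁻¹) + (b i - u i) / u i := by
      intro i hi
      have hi' := Finset.mem_range.1 hi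
      by_cases h : u i = 0
      · simp [h, hcz i hi' h, hz i hi' h]
      · rw [if_neg h]; field_simp; ring
    have e2 : ∀ i ∈ Finset.range n, (u i - c i) / c i = (u i - c i) *
      (if c i = 0 then ∑ j ∈ Finset.range n, (c j)⁻¹ else (c i)⁻¹) := by
      intro i hi
      have hi' := Finset.mem_range.1 hi
      by_cases h : c i = 0
      · simp [h, huz i hi' h]
      · rw [if_neg h, div_eq_mul_inv]
    rw [Finset.sum_add_distrib, Finset.sum_congr rfl e1, Finset.sum_congr rfl e2,
      Finset.sum_add_distrib]
    linarith
  have hterm : ∀ i < n, 0 ≤ (c i - u i) / u i + (u i - c i) / c i := by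
    intro i hi
    by_cases h : u i = 0
    · simp [h, hcz i hi h]
    have hup := lt_of_le_of_ne (hu0 i hi) (Ne.symm h)
    have hcp := lt_of_le_of_ne (hc0 i hi) (fun e => h (huz i hi e.symm))
    have : (c i - u i) / u i + (u i - c i) / c i = (c i - u i) ^ 2 / (u i * c i) := by
      field_simp; ring
    rw [this]; positivity
  -- All terms are nonnegative, so each is at most `1/2`, that is `(c - u)^2 ≤ u * c / 2`. This
  -- reads `(c - 2 * u) * (c - u / 2) ≤ 0`, whose larger root gives the factor 2.
  have hhalf : ∀ i < n, c i ≤ 2 * u i := by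
    intro i hi
    by_cases h : u i = 0
    · simp [h, hcz i hi h]
    have hup := lt_of_le_of_ne (hu0 i hi) (Ne.symm h)
    have hcp := lt_of_le_of_ne (hc0 i hi) (fun e => h (huz i hi e.symm))
    have hi1 := (Finset.single_le_sum (f := fun i => (c i - u i) / u i + (u i - c i) / c i)
      (fun j hj => hterm j (Finset.mem_range.1 hj)) (Finset.mem_range.2 hi)).trans hsum
    have e : (c i - u i) / u i + (u i - c i) / c i = (c i - u i) ^ 2 / (u i * c i) := by
      field_simp; ring
    simp only [e] at hi1
    rw [div_le_iff₀ (by positivity)] at hi1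
    by_contra hcon
    push Not at hcon
    nlinarith
  calc ∑ i ∈ Finset.range k, y i ≤ ∑ i ∈ Finset.range k, c i := hyc k hk
    _ ≤ ∑ i ∈ Finset.range k, 2 * u i := Finset.sum_le_sum fun i hi =>
        hhalf i (lt_of_lt_of_le (Finset.mem_range.1 hi) hk)
    _ = 2 * ∑ i ∈ Finset.range k, u i := by rw [Finset.mul_sum]

/-! ### Sums of the smallest entries -/

/-- The rearrangement inequality against the indicator of the first `k` positions, which is
antitone. -/
theorem sumSmallest_le_sum_perm {n : ℕ} (k : ℕ) (u : Fin n → ℝ) (τ : Equiv.Perm (Fin n)) :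
    sumSmallest k u ≤ ∑ r : Fin n with r.val < k, u (τ r) := by
  have hanti : Antivary (fun r : Fin n => if r.val < k then (1 : ℝ) else 0)
      (u ∘ Tuple.sort u) := by
    refine Antitone.antivary ?_ (Tuple.monotone_sort u)
    intro r s hrs
    dsimp only
    have : r.val ≤ s.val := hrs
    split_ifs
    all_goals first | omega | norm_num
  have h := hanti.sum_mul_le_sum_mul_comp_perm (σ := (Tuple.sort u)⁻¹ * τ)
  simp only [Function.comp_apply, Equiv.Perm.mul_apply, ite_mul,
    one_mul, zero_mul] at h
  unfold sumSmallest
  rw [Finset.sum_filter, Finset.sum_filter]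
  simpa using h

theorem sumSmallest_mono {n : ℕ} (k : ℕ) {u y : Fin n → ℝ} (h : ∀ i, u i ≤ y i) :
    sumSmallest k u ≤ sumSmallest k y :=
  (sumSmallest_le_sum_perm k u (Tuple.sort y)).trans (Finset.sum_le_sum fun _ _ => h _)

theorem sum_filter_lt_eq_sum_range {n k : ℕ} (hk : k ≤ n) (f : Fin n → ℝ) :
    ∑ r : Fin n with r.val < k, f r =
      ∑ i ∈ Finset.range k, if h : i < n then f ⟨i, h⟩ else 0 := by
  rw [Finset.sum_filter]
  have h1 : ∑ r : Fin n, (if r.val < k then f r else 0) =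
      ∑ r : Fin n, (fun i => if i < k then (if h : i < n then f ⟨i, h⟩ else 0) else 0) r.val :=
    Finset.sum_congr rfl fun r _ => by simp
  rw [h1, Fin.sum_univ_eq_sum_range
    (fun i => if i < k then (if h : i < n then f ⟨i, h⟩ else 0) else 0), ← Finset.sum_filter]
  refine Finset.sum_congr ?_ fun _ _ => rfl
  ext i
  simp only [Finset.mem_filter, Finset.mem_range]
  omega

/-- Here `u` and `b` are both listed in the order of `u`, while `y` is listed in its own order. This
is harmless, since the `k` smallest entries of `y` sum to at most its entries on any `k` agents. -/
theorem sumSmallest_le_two_mul {n : ℕ} (u b y : Fin n → ℝ) (hu0 : ∀ i, 0 ≤ u i)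
    (hy0 : ∀ i, 0 ≤ y i)
    (hyb : ∀ k ≤ n, ∑ r : Fin n with r.val < k, y (Tuple.sort u r) ≤
      ∑ r : Fin n with r.val < k, b (Tuple.sort u r))
    (hub : ∀ k ≤ n, ∑ r : Fin n with r.val < k, u (Tuple.sort u r) ≤
      ∑ r : Fin n with r.val < k, b (Tuple.sort u r))
    (hz : ∀ i, u i = 0 → b i = 0) (hgap : ∑ i, (b i - u i) / u i ≤ 1 / 2)
    (k : ℕ) (hk : k ≤ n) : sumSmallest k y ≤ 2 * sumSmallest k u := by
  set E : (Fin n → ℝ) → ℕ → ℝ := fun f i => if h : i < n then f ⟨i, h⟩ else 0 with hE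
  have hEi : ∀ f : Fin n → ℝ, ∀ i (h : i < n), E f i = f ⟨i, h⟩ := fun f i h => dif_pos h
  have hsum : ∀ f : Fin n → ℝ, ∀ k ≤ n, ∑ r : Fin n with r.val < k, f r =
      ∑ i ∈ Finset.range k, E f i := fun f k hk => sum_filter_lt_eq_sum_range hk f
  have hmono : ∀ f : Fin n → ℝ, ∀ i, i + 1 < n →
      E (f ∘ Tuple.sort f) i ≤ E (f ∘ Tuple.sort f) (i + 1) := by
    intro f i hi
    rw [hEi _ i (by omega), hEi _ _ hi]
    exact Tuple.monotone_sort f (Fin.mk_le_mk.2 (Nat.le_succ i))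
  have key := partial_sums_le_two_mul n (E (u ∘ Tuple.sort u)) (E (b ∘ Tuple.sort u))
    (E (y ∘ Tuple.sort y)) (fun i hi => by rw [hEi _ i hi]; exact hu0 _) (hmono u)
    (fun i hi => by rw [hEi _ i hi]; exact hy0 _) (hmono y)
    (fun k hk => by
      rw [← hsum _ k hk, ← hsum _ k hk]
      exact (sumSmallest_le_sum_perm k y (Tuple.sort u)).trans (hyb k hk))
    (fun k hk => by
      rw [← hsum _ k hk, ← hsum _ k hk]
      exact hub k hk)
    (fun i hi h => by
      rw [hEi _ i hi] at h ⊢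
      exact hz _ h)
    (by
      rw [← Fin.sum_univ_eq_sum_range (fun i => (E (b ∘ Tuple.sort u) i -
        E (u ∘ Tuple.sort u) i) / E (u ∘ Tuple.sort u) i)]
      refine le_trans (le_of_eq ?_) hgap
      rw [← Equiv.sum_comp (Tuple.sort u) fun i => (b i - u i) / u i]
      exact Finset.sum_congr rfl fun r _ => by
        rw [hEi _ _ r.2, hEi _ _ r.2]; rfl) k hk
  rw [← hsum _ k hk, ← hsum _ k hk] at key
  exact key

/-! ### Priority orders -/

section Order

variable {K : Type} [LinearOrder K] {n m : ℕ}

/-- Agent `k` has priority over agent `i`: it has less utility so far (ties by the index). -/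
def Ahead (u : Fin n → K) (k i : Fin n) : Prop := u k < u i ∨ u k = u i ∧ k < i

/-- Agent `i` is, among the agents with the largest value, the one with the highest priority. -/
def IsTop (u : Fin n → K) (a : Fin n → Fin m) (i : Fin n) : Prop :=
  ∀ k, k ≠ i → a k < a i ∨ a k = a i ∧ Ahead u i k

/-- If agent `i` is selected with value index `j`, agent `k` may have value index `l`. -/
def Allowed (u : Fin n → K) (i : Fin n) (j : Fin m) (k : Fin n) (l : Fin m) : Prop :=
  (k = i ∧ l = j) ∨ (Ahead u k i ∧ l < j) ∨ (Ahead u i k ∧ l ≤ j)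

theorem ahead_trichotomy (u : Fin n → K) (k i : Fin n) : Ahead u k i ∨ k = i ∨ Ahead u i k := by
  unfold Ahead
  rcases lt_trichotomy (u k) (u i) with h | h | h
  · exact Or.inl (Or.inl h)
  · rcases lt_trichotomy k i with h' | h' | h'
    · exact Or.inl (Or.inr ⟨h, h'⟩)
    · exact Or.inr (Or.inl h')
    · exact Or.inr (Or.inr (Or.inr ⟨h.symm, h'⟩))
  · exact Or.inr (Or.inr (Or.inl h))

theorem Ahead.not_symm {u : Fin n → K} {k i : Fin n} (h : Ahead u k i) : ¬ Ahead u i k := by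
  rintro (h' | ⟨h', h''⟩) <;> rcases h with h | ⟨h, h3⟩
  · exact lt_asymm h h'
  · exact h'.ne h.symm
  · exact h.ne h'.symm
  · exact lt_asymm h3 h''

theorem Ahead.ne {u : Fin n → K} {k i : Fin n} (h : Ahead u k i) : k ≠ i := by
  rintro rfl; exact h.not_symm h

/-- Winning becomes a conjunction of separate conditions on the value of each agent. By independence
its probability is a product, which is why `bid` can be computed without enumerating profiles. -/
theorem isTop_iff_allowed (u : Fin n → K) (a : Fin n → Fin m) (i : Fin n) :
    IsTop u a i ↔ ∀ k, Allowed u i (a i) k (a k) := by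
  refine forall_congr' fun k => ?_
  unfold Allowed
  rcases ahead_trichotomy u k i with h | h | h
  · have := h.ne; have := h.not_symm
    simp [*]
  · simp [h]
  · have := h.ne.symm; have := h.not_symm
    simp [*, le_iff_lt_or_eq]

theorem IsTop.le {u : Fin n → K} {a : Fin n → Fin m} {i : Fin n} (h : IsTop u a i) (k : Fin n) :
    a k ≤ a i := by
  by_cases hk : k = i
  · rw [hk]
  · rcases h k hk with h' | h'
    exacts [h'.le, h'.1.le]

theorem IsTop.eq {u : Fin n → K} {a : Fin n → Fin m} {i k : Fin n} (h : IsTop u a i)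
    (h' : IsTop u a k) : i = k := by
  by_contra hne
  rcases h k (Ne.symm hne) with h1 | ⟨h1, h2⟩
  · exact absurd (h'.le i) (not_le.2 h1)
  · rcases h' i hne with h3 | ⟨-, h3⟩
    · exact h3.ne h1.symm
    · exact h2.not_symm h3

theorem exists_isTop (hn : 0 < n) (u : Fin n → K) (a : Fin n → Fin m) : ∃ i, IsTop u a i := by
  have : Nonempty (Fin n) := ⟨⟨0, hn⟩⟩
  obtain ⟨i, -, hi⟩ := Finset.exists_min_image (Finset.univ : Finset (Fin n))
    (fun i => toLex (OrderDual.toDual (a i), toLex (u i, i))) ⟨⟨0, hn⟩, Finset.mem_univ _⟩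
  refine ⟨i, fun k hk => ?_⟩
  have h := hi k (Finset.mem_univ k)
  rw [Prod.Lex.toLex_le_toLex, Prod.Lex.toLex_le_toLex] at h
  rcases h with h | ⟨h1, h2⟩
  · exact Or.inl h
  · refine Or.inr ⟨congrArg OrderDual.ofDual h1.symm, ?_⟩
    rcases h2 with h2 | ⟨h2, h3⟩
    · exact Or.inl h2
    · exact Or.inr ⟨h2, lt_of_le_of_ne h3 (Ne.symm hk)⟩

/-- The agent with the highest priority among those with the largest value. -/
noncomputable def prio (hn : 0 < n) (u : Fin n → K) (a : Fin n → Fin m) : Fin n :=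
  (exists_isTop hn u a).choose

theorem isTop_prio (hn : 0 < n) (u : Fin n → K) (a : Fin n → Fin m) : IsTop u a (prio hn u a) :=
  (exists_isTop hn u a).choose_spec

theorem prio_eq_iff (hn : 0 < n) (u : Fin n → K) (a : Fin n → Fin m) (i : Fin n) :
    prio hn u a = i ↔ IsTop u a i :=
  ⟨fun h => h ▸ isTop_prio hn u a, fun h => (isTop_prio hn u a).eq h⟩

end Order

/-! ### The iteration -/

section Iteration

variable {K : Type} [Field K] [LinearOrder K] {n m : ℕ}

open Classical in
/-- The expected utility of agent `i` under Full Revelation with priorities given by `u`. -/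
noncomputable def bid (I : Market K n m) (u : Fin n → K) (i : Fin n) : K :=
  ∑ j, I.val j * ∏ k, ∑ l, if Allowed u i j k l then I.prob k l else 0

/-- The number of coins that decide about one step. -/
def coinsPerStep (n : ℕ) : ℕ := Nat.clog 2 (4 * (n + 1) ^ 2)

/-- The number of steps. -/
def numSteps (n : ℕ) : ℕ := n + 32 * n * (4 * (n + 1) ^ 2) ^ 2

/-- The step size. -/
noncomputable def rate (K : Type) [Field K] (n : ℕ) : K := (1 / 2) ^ coinsPerStep n

/-- The utilities with the one of agent `t` set to zero. -/
def reset (t : ℕ) (u : Fin n → K) : Fin n → K := fun i => if i.val = t then 0 else u i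

/-- The priorities `u` are nearly optimal, and are not changed in step `t`. -/
def Frozen (I : Market K n m) (t : ℕ) (u : Fin n → K) : Prop :=
  n ≤ t ∧ ∑ i, (bid I u i - u i) / u i ≤ 1 / 2

open Classical in
/-- The utilities that are guaranteed after `t` steps. -/
noncomputable def track (I : Market K n m) : ℕ → Fin n → K
  | 0 => 0
  | t + 1 =>
    let v := reset t (track I t)
    if Frozen I t v then v else fun i => v i + rate K n * (bid I v i - v i)

end Iteration

open Classical in
/-- The probabilities with which the agents are selected after `t` steps, for values given by
`a`. -/
noncomputable def selectProb {n m : ℕ} (I : Market ℝ n m) (a : Fin n → Fin m) : ℕ → Fin n → ℝ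
  | 0 => Pi.single (prio I.n_pos (0 : Fin n → ℝ) a) 1
  | t + 1 =>
    let v := reset t (track I t)
    if Frozen I t v then selectProb I a t else fun i =>
      (1 - rate ℝ n) * selectProb I a t i + rate ℝ n * (Pi.single (prio I.n_pos v a) 1 : Fin n → ℝ) i

/-! ### Rational data -/

section Cast

variable {n m : ℕ}

theorem ahead_cast (u : Fin n → ℚ) (k i : Fin n) :
    Ahead (fun i => (u i : ℝ)) k i ↔ Ahead u k i := by
  simp [Ahead]

theorem isTop_cast (u : Fin n → ℚ) (a : Fin n → Fin m) (i : Fin n) :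
    IsTop (fun i => (u i : ℝ)) a i ↔ IsTop u a i := by
  simp [IsTop, ahead_cast]

theorem prio_cast (hn : 0 < n) (u : Fin n → ℚ) (a : Fin n → Fin m) :
    prio hn (fun i => (u i : ℝ)) a = prio hn u a := by
  rw [prio_eq_iff, isTop_cast]; exact isTop_prio hn u a

theorem bid_cast (I : Market ℚ n m) (u : Fin n → ℚ) (i : Fin n) :
    bid I.toReal (fun i => (u i : ℝ)) i = ((bid I u i : ℚ) : ℝ) := by
  have ha : ∀ (j : Fin m) (k : Fin n) (l : Fin m), Allowed (fun i => (u i : ℝ)) i j k l ↔ Allowed u i j k l := by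
    intro j k l
    simp only [Allowed, ahead_cast]
  simp only [bid, Market.toReal, ha, Rat.cast_sum, Rat.cast_mul, Rat.cast_prod]
  refine Finset.sum_congr rfl fun j _ => ?_
  congr 1
  refine Finset.prod_congr rfl fun k _ => Finset.sum_congr rfl fun l _ => ?_
  by_cases h : Allowed u i j k l
  · rw [if_pos h, if_pos ((ha j k l).2 h)]
  · rw [if_neg h, if_neg (mt (ha j k l).1 h), Rat.cast_zero]

theorem frozen_cast (I : Market ℚ n m) (t : ℕ) (u : Fin n → ℚ) :
    Frozen I.toReal t (fun i => (u i : ℝ)) ↔ Frozen I t u := by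
  simp only [Frozen, bid_cast]
  refine and_congr Iff.rfl ?_
  rw [← Rat.cast_le (K := ℝ)]
  push_cast
  rfl

theorem reset_cast (t : ℕ) (u : Fin n → ℚ) :
    reset t (fun i => (u i : ℝ)) = fun i => ((reset t u i : ℚ) : ℝ) := by
  funext i
  simp only [reset]
  split_ifs <;> simp

theorem rate_cast (n : ℕ) : rate ℝ n = (rate ℚ n : ℝ) := by
  simp [rate]

/-- The program computes in `ℚ`, the utilities live in `ℝ`. Priorities and the test for freezing are
comparisons, so they survive the cast and both iterations take the same branches. -/
theorem track_cast (I : Market ℚ n m) (t : ℕ) :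
    track I.toReal t = fun i => ((track I t i : ℚ) : ℝ) := by
  induction t with
  | zero => funext i; simp [track]
  | succ t ih =>
    funext i
    have hr : reset t (track I.toReal t) = fun i => ((reset t (track I t) i : ℚ) : ℝ) := by
      rw [ih, reset_cast]
    have hf := frozen_cast I t (reset t (track I t))
    rw [← hr] at hf
    by_cases h : Frozen I t (reset t (track I t))
    · simp only [track, if_pos h, if_pos (hf.2 h), hr]
    · simp only [track, if_neg h, if_neg (mt hf.1 h), hr, bid_cast, rate_cast]
      push_cast
      rfl

end Cast

/-! ### Utilities under Full Revelation -/

section Real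

variable {n m : ℕ}

/-- The probability that the values are those given by `a`. -/
noncomputable def profileProb (I : Market ℝ n m) (a : Fin n → Fin m) : ℝ := ∏ k, I.prob k (a k)

theorem profileProb_nonneg (I : Market ℝ n m) (a : Fin n → Fin m) : 0 ≤ profileProb I a :=
  Finset.prod_nonneg fun k _ => I.prob_nonneg k (a k)

/-- `y` is the vector of utilities of a Full Revelation scheme. -/
def IsRevealed (I : Market ℝ n m) (y : Fin n → ℝ) : Prop :=
  ∃ s : (Fin n → Fin m) → Fin n → ℝ, (∀ a, s a ∈ stdSimplex ℝ (Fin n)) ∧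
    (∀ a, 0 < profileProb I a → ∀ i, s a i ≠ 0 → ∀ k, a k ≤ a i) ∧
    ∀ i, y i = ∑ a, profileProb I a * s a i * I.val (a i)

open Classical in
/-- The largest expected utility of agent `i` under Full Revelation. -/
noncomputable def maxUtility (I : Market ℝ n m) (i : Fin n) : ℝ :=
  ∑ a, profileProb I a * (if ∀ k, a k ≤ a i then 1 else 0) * I.val (a i)

/-- Expanding the product of sums turns the factorized formula into an expectation over profiles;
for a given profile only the index `j = a i` contributes. -/
theorem bid_eq_sum (I : Market ℝ n m) (u : Fin n → ℝ) (i : Fin n) :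
    bid I u i = ∑ a, profileProb I a * (Pi.single (prio I.n_pos u a) 1 : Fin n → ℝ) i *
      I.val (a i) := by
  classical
  unfold bid
  simp only [Finset.prod_univ_sum, Fintype.piFinset_univ, Finset.mul_sum]
  rw [Finset.sum_comm]
  refine Finset.sum_congr rfl fun a _ => ?_
  rw [Finset.sum_eq_single (a i)]
  · rw [Finset.prod_ite_zero]
    simp only [Finset.mem_univ, true_implies, ← isTop_iff_allowed, Pi.single_apply,
      eq_comm (a := i), prio_eq_iff, profileProb]
    split_ifs <;> ring
  · intro j _ hj
    rw [Finset.prod_eq_zero (Finset.mem_univ i), mul_zero]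
    refine if_neg ?_
    rintro (⟨-, h⟩ | ⟨h, -⟩ | ⟨h, -⟩)
    · exact hj h.symm
    · exact h.ne rfl
    · exact h.ne rfl
  · simp

theorem bid_nonneg (I : Market ℝ n m) (u : Fin n → ℝ) (i : Fin n) : 0 ≤ bid I u i := by
  rw [bid_eq_sum]
  refine Finset.sum_nonneg fun a _ => mul_nonneg (mul_nonneg (profileProb_nonneg I a) ?_)
    (I.val_nonneg _)
  rw [Pi.single_apply]; split_ifs <;> norm_num

theorem maxUtility_nonneg (I : Market ℝ n m) (i : Fin n) : 0 ≤ maxUtility I i :=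
  Finset.sum_nonneg fun a _ => mul_nonneg (mul_nonneg (profileProb_nonneg I a)
    (by split_ifs <;> norm_num)) (I.val_nonneg _)

theorem bid_le_maxUtility (I : Market ℝ n m) (u : Fin n → ℝ) (i : Fin n) :
    bid I u i ≤ maxUtility I i := by
  rw [bid_eq_sum]
  refine Finset.sum_le_sum fun a _ => mul_le_mul_of_nonneg_right (mul_le_mul_of_nonneg_left ?_
    (profileProb_nonneg I a)) (I.val_nonneg _)
  rw [Pi.single_apply]
  split_ifs with h1 h2 h2
  · exact le_rfl
  · exact absurd (fun k => ((prio_eq_iff I.n_pos u a i).1 h1.symm).le k) h2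
  · norm_num
  · exact le_rfl

theorem IsRevealed.nonneg {I : Market ℝ n m} {y : Fin n → ℝ} (h : IsRevealed I y) (i : Fin n) :
    0 ≤ y i := by
  obtain ⟨s, hs, -, hy⟩ := h
  rw [hy]
  exact Finset.sum_nonneg fun a _ => mul_nonneg (mul_nonneg (profileProb_nonneg I a)
    ((hs a).1 i)) (I.val_nonneg _)

theorem IsRevealed.le_maxUtility {I : Market ℝ n m} {y : Fin n → ℝ} (h : IsRevealed I y)
    (i : Fin n) : y i ≤ maxUtility I i := by
  obtain ⟨s, hs, hmax, hy⟩ := h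
  rw [hy]
  refine Finset.sum_le_sum fun a _ => mul_le_mul_of_nonneg_right ?_ (I.val_nonneg _)
  rcases (profileProb_nonneg I a).eq_or_lt with h0 | h0
  · simp [← h0]
  · refine mul_le_mul_of_nonneg_left ?_ h0.le
    have h1 : s a i ≤ 1 := by
      rw [← (hs a).2]
      exact Finset.single_le_sum (fun j _ => (hs a).1 j) (Finset.mem_univ i)
    by_cases hi : s a i = 0
    · rw [hi]; split_ifs <;> norm_num
    · rw [if_pos (hmax a h0 i hi)]; exact h1

/-- A set of agents that is closed under higher priority gets the most when the priorities are
followed. -/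
theorem IsRevealed.sum_le_sum_bid {I : Market ℝ n m} {y : Fin n → ℝ} (h : IsRevealed I y)
    (u : Fin n → ℝ) (P : Finset (Fin n)) (hP : ∀ i ∈ P, ∀ k, Ahead u k i → k ∈ P) :
    ∑ i ∈ P, y i ≤ ∑ i ∈ P, bid I u i := by
  obtain ⟨s, hs, hmax, hy⟩ := h
  simp only [hy, bid_eq_sum]
  rw [Finset.sum_comm, Finset.sum_comm (s := P)]
  refine Finset.sum_le_sum fun a _ => ?_
  rcases (profileProb_nonneg I a).eq_or_lt with h0 | h0
  · simp [← h0]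
  simp only [mul_assoc]
  rw [← Finset.mul_sum, ← Finset.mul_sum]
  refine mul_le_mul_of_nonneg_left ?_ h0.le
  set p := prio I.n_pos u a with hp
  have htop : IsTop u a p := isTop_prio I.n_pos u a
  have hle : ∀ i ∈ P, s a i * I.val (a i) ≤ s a i * I.val (a p) := fun i _ =>
    mul_le_mul_of_nonneg_left (I.val_strictMono.monotone (htop.le i)) ((hs a).1 i)
  by_cases hpP : p ∈ P
  · calc ∑ i ∈ P, s a i * I.val (a i) ≤ ∑ i ∈ P, s a i * I.val (a p) := Finset.sum_le_sum hle
      _ = (∑ i ∈ P, s a i) * I.val (a p) := by rw [Finset.sum_mul]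
      _ ≤ 1 * I.val (a p) := by
        refine mul_le_mul_of_nonneg_right ?_ (I.val_nonneg _)
        rw [← (hs a).2]
        exact Finset.sum_le_sum_of_subset_of_nonneg (Finset.subset_univ P)
          fun i _ _ => (hs a).1 i
      _ = ∑ i ∈ P, (Pi.single p 1 : Fin n → ℝ) i * I.val (a i) := by
        simp [Pi.single_apply, hpP]
  -- If a member of `P` had the top value, the winner `p` would precede it in the ranking and hence
  -- belong to `P`.
  · have hzero : ∀ i ∈ P, s a i = 0 := by
      intro i hi
      by_contra hne
      have hip : p ≠ i := fun e => hpP (e ▸ hi)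
      rcases htop i hip.symm with h1 | ⟨-, h1⟩
      · exact absurd (hmax a h0 i hne p) (not_le.2 h1)
      · exact hpP (hP i hi p h1)
    rw [Finset.sum_eq_zero fun i hi => by rw [hzero i hi, zero_mul]]
    refine Finset.sum_nonneg fun i _ => mul_nonneg ?_ (I.val_nonneg _)
    rw [Pi.single_apply]; split_ifs <;> norm_num

/-- `Tuple.sort` is stable, so it breaks ties by the index just as `Ahead` does, and its prefixes
are closed under higher priority. -/
theorem ahead_sort_mem {u : Fin n → ℝ} {k : ℕ} {r : Fin n} (hr : r.val < k) {i : Fin n}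
    (hi : Ahead u i (Tuple.sort u r)) : ((Tuple.sort u).symm i).val < k := by
  refine lt_of_le_of_lt ?_ hr
  by_contra hlt
  push Not at hlt
  obtain ⟨hmono, hstab⟩ := (Tuple.eq_sort_iff (f := u) (σ := Tuple.sort u)).1 rfl
  set q := (Tuple.sort u).symm i with hq
  have hiq : i = Tuple.sort u q := by simp [hq]
  rw [hiq] at hi
  rcases hi with h | ⟨h, h'⟩
  · exact absurd (hmono (le_of_lt (show r < q from hlt))) (not_le.2 h)
  · exact lt_asymm h' (hstab r q hlt h.symm)

theorem IsRevealed.sum_sort_le {I : Market ℝ n m} {y : Fin n → ℝ} (h : IsRevealed I y)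
    (u : Fin n → ℝ) (k : ℕ) :
    ∑ r : Fin n with r.val < k, y (Tuple.sort u r) ≤
      ∑ r : Fin n with r.val < k, bid I u (Tuple.sort u r) := by
  have key := h.sum_le_sum_bid u
    ((Finset.univ.filter fun r : Fin n => r.val < k).map (Tuple.sort u).toEmbedding) (by
      intro i hi l hl
      simp only [Finset.mem_map, Finset.mem_filter, Finset.mem_univ, true_and,
        Equiv.coe_toEmbedding] at hi ⊢
      obtain ⟨r, hr, rfl⟩ := hi
      exact ⟨_, ahead_sort_mem hr hl, by simp⟩)
  simpa [Finset.sum_map] using key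

/-! ### Full Revelation schemes -/

theorem MappingRule.map_eq_zero (g : MappingRule n m) {i : Fin n} {j : Fin m} {s t : g.Γ i}
    (h : g.map i j s = 1) (hts : t ≠ s) : g.map i j t = 0 := by
  classical
  have h1 := (g.map_mem i j).2
  rw [← Finset.add_sum_erase _ _ (Finset.mem_univ s), h, add_eq_left] at h1
  exact (Finset.sum_eq_zero_iff_of_nonneg fun t _ => (g.map_mem i j).1 t).1 h1 t
    (Finset.mem_erase.2 ⟨hts, Finset.mem_univ t⟩)

section Names

variable (I : Market ℝ n m) (g : MappingRule n m) (f : ∀ i, Fin m → g.Γ i)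
  (hf : ∀ i, Function.Injective (f i)) (hmap : ∀ i j, g.map i j (f i j) = 1)

include hf hmap

theorem MappingRule.agentSignalProb_name (i : Fin n) (j : Fin m) :
    g.agentSignalProb I i (f i j) = I.prob i j := by
  unfold MappingRule.agentSignalProb
  rw [Finset.sum_eq_single j, hmap, mul_one]
  · intro j' _ hj'
    rw [g.map_eq_zero (hmap i j') fun e => hj' (hf i e).symm, mul_zero]
  · simp

theorem MappingRule.signalProb_name (a : Fin n → Fin m) :
    g.signalProb I (fun k => f k (a k)) = profileProb I a :=
  Finset.prod_congr rfl fun k _ => g.agentSignalProb_name I f hf hmap k (a k)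

theorem MappingRule.posteriorMean_name {i : Fin n} {j : Fin m} (h : I.prob i j ≠ 0) :
    g.posteriorMean I i (f i j) = I.val j := by
  unfold MappingRule.posteriorMean
  rw [g.agentSignalProb_name I f hf hmap, Finset.sum_eq_single j, hmap, mul_one,
    mul_div_cancel_right₀ _ h]
  · intro j' _ hj'
    rw [g.map_eq_zero (hmap i j') fun e => hj' (hf i e).symm, mul_zero, mul_zero]
  · simp

end Names

theorem prob_ne_zero_of_profileProb_pos {I : Market ℝ n m} {a : Fin n → Fin m}
    (h : 0 < profileProb I a) (i : Fin n) : I.prob i (a i) ≠ 0 := fun e =>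
  h.ne' (Finset.prod_eq_zero (Finset.mem_univ i) e)

/-- Signals that name no value have probability zero. The posterior mean is identified only on
profiles of positive probability, and the others carry no weight. -/
theorem Scheme.utility_eq_sum {I : Market ℝ n m} (ω : Scheme I) (f : ∀ i, Fin m → ω.Γ i)
    (hf : ∀ i, Function.Injective (f i)) (hmap : ∀ i j, ω.map i j (f i j) = 1) (i : Fin n) :
    ω.utility i = ∑ a : Fin n → Fin m,
      profileProb I a * ω.select (fun k => f k (a k)) i * I.val (a i) := by
  unfold Scheme.utility
  symm
  refine Finset.sum_of_injOn (fun a k => f k (a k)) ?_ ?_ ?_ ?_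
  · intro a _ a' _ h
    funext k
    exact hf k (congrFun h k)
  · simp
  · intro σ _ hσ
    have : ∃ k, ∀ j, σ k ≠ f k j := by
      by_contra hcon
      push Not at hcon
      choose a ha using hcon
      exact hσ ⟨a, by simp, by funext k; exact (ha k).symm⟩
    obtain ⟨k, hk⟩ := this
    have : ω.signalProb I σ = 0 := Finset.prod_eq_zero (Finset.mem_univ k)
      (Finset.sum_eq_zero fun j _ => by rw [ω.map_eq_zero (hmap k j) (hk j), mul_zero])
    rw [this, zero_mul, zero_mul]
  · intro a _
    rw [ω.signalProb_name I f hf hmap]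
    rcases (profileProb_nonneg I a).eq_or_lt with h0 | h0
    · simp [← h0]
    · rw [ω.posteriorMean_name I f hf hmap (prob_ne_zero_of_profileProb_pos h0 i)]

theorem Scheme.isRevealed_utility {I : Market ℝ n m} (ω : Scheme I)
    (h : ω.IsFullRevelation) : IsRevealed I ω.utility := by
  obtain ⟨f, hf, hmap⟩ := h
  refine ⟨fun a => ω.select fun k => f k (a k), fun a => ω.select_mem _, ?_,
    fun i => ω.utility_eq_sum f hf hmap i⟩
  intro a ha i hi k
  have h := ω.select_max (fun k => f k (a k))
    (by rw [ω.signalProb_name I f hf hmap]; exact ha) i hi k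
  rw [ω.posteriorMean_name I f hf hmap (prob_ne_zero_of_profileProb_pos ha k),
    ω.posteriorMean_name I f hf hmap (prob_ne_zero_of_profileProb_pos ha i)] at h
  exact I.val_strictMono.le_iff_le.1 h

theorem reveal_isFullRevelation (n m : ℕ) : (reveal n m).IsFullRevelation :=
  ⟨fun _ j => j, fun _ _ _ h => h, fun _ _ => Pi.single_eq_same _ _⟩

theorem SelectionRule.utility_eq_sum {I : Market ℝ n m} (w : SelectionRule I) (i : Fin n) :
    w.policy.utility i = ∑ a, profileProb I a * w.select a i * I.val (a i) := by
  have h : w.policy.utility i = w.scheme.utility i := MeasureTheory.integral_dirac _ ()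
  rw [h]
  exact w.scheme.utility_eq_sum (fun _ j => j) (fun _ _ _ h => h)
    (fun _ _ => Pi.single_eq_same _ _) i

theorem SelectionRule.policy_mem {I : Market ℝ n m} (w : SelectionRule I) :
    w.policy ∈ fullRevelationPolicies I :=
  show ∀ᵐ _ω ∂w.policy.law, (reveal n m).IsFullRevelation from
    Filter.Eventually.of_forall fun _ => reveal_isFullRevelation n m

theorem SelectionRule.isRevealed_utility {I : Market ℝ n m} (w : SelectionRule I) :
    IsRevealed I w.policy.utility :=
  ⟨w.select, w.select_mem,
    fun a _ i hi k => I.val_strictMono.le_iff_le.1 (w.select_max a i hi k), w.utility_eq_sum⟩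

/-! ### Random Full Revelation schemes. -/

section Policies

variable {I : Market ℝ n m} {Q : Policy I} (hQ : Q ∈ fullRevelationPolicies I)

include hQ

theorem ae_isRevealed : ∀ᵐ ω ∂Q.law, IsRevealed I (Q.scheme ω).utility := by
  filter_upwards [show ∀ᵐ ω ∂Q.law, (Q.scheme ω).IsFullRevelation from hQ] with ω hω
  exact (Q.scheme ω).isRevealed_utility hω

/-- A policy only provides measurability of the utilities; almost surely they lie between zero and
`maxUtility`. -/
theorem integrable_utility (i : Fin n) :
    MeasureTheory.Integrable (fun ω => (Q.scheme ω).utility i) Q.law := by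
  refine MeasureTheory.Integrable.of_bound (Q.measurable_utility i).aestronglyMeasurable
    (maxUtility I i) ?_
  filter_upwards [ae_isRevealed hQ] with ω hω
  rw [Real.norm_of_nonneg (hω.nonneg i)]
  exact hω.le_maxUtility i

theorem policy_utility_nonneg (i : Fin n) : 0 ≤ Q.utility i := by
  refine MeasureTheory.integral_nonneg_of_ae ?_
  filter_upwards [ae_isRevealed hQ] with ω hω
  exact hω.nonneg i

/-- The set of agents is fixed by `u` and does not depend on the random scheme, so the pointwise
bound passes to the expectation. Sums of smallest entries, taken scheme by scheme, would not allow
this. -/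
theorem policy_sum_sort_le (u : Fin n → ℝ) (k : ℕ) :
    ∑ r : Fin n with r.val < k, Q.utility (Tuple.sort u r) ≤
      ∑ r : Fin n with r.val < k, bid I u (Tuple.sort u r) := by
  unfold Policy.utility
  rw [← MeasureTheory.integral_finsetSum _ fun r _ => integrable_utility hQ _]
  refine (MeasureTheory.integral_mono_ae (MeasureTheory.integrable_finsetSum _
    fun r _ => integrable_utility hQ _) (MeasureTheory.integrable_const
      (∑ r : Fin n with r.val < k, bid I u (Tuple.sort u r))) ?_).trans_eq (by simp)
  filter_upwards [ae_isRevealed hQ] with ω hω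
  exact hω.sum_sort_le u k

end Policies

end Real

/-! ### Convergence of the iteration -/

theorem coinsPerStep_spec (n : ℕ) :
    4 * (n + 1) ^ 2 ≤ 2 ^ coinsPerStep n ∧ 2 ^ coinsPerStep n ≤ 2 * (4 * (n + 1) ^ 2) := by
  refine ⟨Nat.le_pow_clog one_lt_two _, ?_⟩
  have h1 : 1 < 4 * (n + 1) ^ 2 := by nlinarith [Nat.zero_le n]
  have h := Nat.pow_pred_clog_lt_self one_lt_two h1
  have hpos : 0 < coinsPerStep n := Nat.clog_pos one_lt_two h1
  have e : 2 ^ coinsPerStep n = 2 ^ (coinsPerStep n).pred * 2 := by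
    rw [← pow_succ, Nat.pred_eq_sub_one, Nat.sub_add_cancel hpos]
  have h' : 2 ^ (coinsPerStep n).pred < 4 * (n + 1) ^ 2 := h
  omega

section Real

variable {n m : ℕ}

theorem rate_pos (n : ℕ) : 0 < rate ℝ n := by unfold rate; positivity

theorem rate_eq_inv (n : ℕ) : rate ℝ n = ((2 : ℝ) ^ coinsPerStep n)⁻¹ := by simp [rate]

theorem rate_mul_le (n : ℕ) : rate ℝ n * (4 * (n + 1) ^ 2) ≤ 1 := by
  have h : (4 * (n + 1) ^ 2 : ℝ) ≤ 2 ^ coinsPerStep n := by exact_mod_cast (coinsPerStep_spec n).1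
  rw [rate_eq_inv, inv_mul_le_iff₀ (by positivity), mul_one]
  exact h

theorem one_le_rate_mul (n : ℕ) : 1 ≤ rate ℝ n * (2 * (4 * (n + 1) ^ 2)) := by
  have h : (2 : ℝ) ^ coinsPerStep n ≤ 2 * (4 * (n + 1) ^ 2) := by
    exact_mod_cast (coinsPerStep_spec n).2
  rw [rate_eq_inv, le_inv_mul_iff₀ (by positivity), mul_one]
  exact h

theorem rate_le_one (n : ℕ) : rate ℝ n ≤ 1 := by
  have h := rate_mul_le n
  have h0 := rate_pos n
  have h1 : (1 : ℝ) ≤ 4 * (n + 1) ^ 2 := by nlinarith [Nat.cast_nonneg (α := ℝ) n]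
  nlinarith

theorem reset_nonneg {t : ℕ} {u : Fin n → ℝ} (hu : ∀ i, 0 ≤ u i) (i : Fin n) :
    0 ≤ reset t u i := by
  unfold reset; split_ifs
  exacts [le_rfl, hu i]

theorem reset_le {t : ℕ} {u : Fin n → ℝ} (hu : ∀ i, 0 ≤ u i) (i : Fin n) :
    reset t u i ≤ u i := by
  unfold reset; split_ifs
  exacts [hu i, le_rfl]

theorem reset_of_le {K : Type} [Field K] {t : ℕ} (ht : n ≤ t) (u : Fin n → K) :
    reset t u = u := by
  funext i
  exact if_neg (by have := i.2; omega)

theorem track_succ_of_frozen {K : Type} [Field K] [LinearOrder K] {I : Market K n m} {t : ℕ}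
    (h : Frozen I t (reset t (track I t))) : track I (t + 1) = track I t := by
  simp only [track, if_pos h]
  exact reset_of_le h.1 _

theorem track_succ_of_not_frozen {K : Type} [Field K] [LinearOrder K] {I : Market K n m} {t : ℕ}
    (h : ¬ Frozen I t (reset t (track I t))) (i : Fin n) :
    track I (t + 1) i = reset t (track I t) i +
      rate K n * (bid I (reset t (track I t)) i - reset t (track I t) i) := by
  simp only [track, if_neg h]

theorem track_bounds (I : Market ℝ n m) (t : ℕ) (i : Fin n) :
    0 ≤ track I t i ∧ track I t i ≤ maxUtility I i := by
  induction t generalizing i with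
  | zero => exact ⟨le_rfl, maxUtility_nonneg I i⟩
  | succ t ih =>
    by_cases h : Frozen I t (reset t (track I t))
    · rw [track_succ_of_frozen h]; exact ih i
    · rw [track_succ_of_not_frozen h]
      have h0 := reset_nonneg (t := t) (fun i => (ih i).1) i
      have h1 := (reset_le (t := t) (fun i => (ih i).1) i).trans (ih i).2
      have h2 := bid_nonneg I (reset t (track I t)) i
      have h3 := bid_le_maxUtility I (reset t (track I t)) i
      have := rate_pos n
      have := rate_le_one n
      constructor <;> nlinarith

/-- Agent `i` loses a profile in which it has the top value only to some `p` ahead of it with the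
same value. As `maxUtility I p = 0`, such a profile has probability times value zero and costs
nothing. -/
theorem bid_eq_maxUtility (I : Market ℝ n m) {u : Fin n → ℝ} {i : Fin n}
    (h : ∀ k, Ahead u k i → maxUtility I k = 0) : bid I u i = maxUtility I i := by
  classical
  rw [bid_eq_sum]
  refine Finset.sum_congr rfl fun a _ => ?_
  by_cases hp : prio I.n_pos u a = i
  · rw [if_pos (((prio_eq_iff _ _ _ _).1 hp).le), hp, Pi.single_eq_same]
  rw [Pi.single_eq_of_ne (Ne.symm hp)]
  split_ifs with hmax
  · have htop := isTop_prio I.n_pos u a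
    set p := prio I.n_pos u a
    rcases htop i (Ne.symm hp) with h1 | ⟨h1, h2⟩
    · exact absurd (hmax p) (not_le.2 h1)
    · have h3 := (Finset.sum_eq_zero_iff_of_nonneg fun a _ => mul_nonneg
        (mul_nonneg (profileProb_nonneg I a) (by split_ifs <;> norm_num)) (I.val_nonneg _)).1
        (h p h2) a (Finset.mem_univ a)
      rw [if_pos htop.le] at h3
      rw [h1, h3]; ring
  · rfl

/-- After the first `n` steps every agent has a fixed share of its largest utility. -/
theorem le_track (I : Market ℝ n m) (t : ℕ) (ht : t ≤ n) (i : Fin n) (hi : i.val < t) :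
    rate ℝ n * (1 - rate ℝ n) ^ t * maxUtility I i ≤ track I t i := by
  have hr := rate_pos n
  have hr1 := rate_le_one n
  induction t generalizing i with
  | zero => omega
  | succ t ih =>
    have hnf : ¬ Frozen I t (reset t (track I t)) := fun h => by have := h.1; omega
    rw [track_succ_of_not_frozen hnf]
    have hm := maxUtility_nonneg I i
    have hpow : 0 ≤ (1 - rate ℝ n) ^ t := pow_nonneg (by linarith) t
    rcases Nat.lt_succ_iff_lt_or_eq.1 hi with h | h
    · have h1 := ih (by omega) i h
      have h2 : reset t (track I t) i = track I t i := if_neg (by omega)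
      have h3 := bid_nonneg I (reset t (track I t)) i
      have h4 := mul_le_mul_of_nonneg_left h1 (sub_nonneg.2 hr1)
      have h5 := mul_nonneg hr.le h3
      rw [h2, pow_succ]
      nlinarith
    · have h2 : reset t (track I t) i = 0 := if_pos h
      -- The reset agent has utility zero, so only agents with a smaller index and utility zero are
      -- ahead of it. By the induction hypothesis these have largest utility zero.
      have hb : bid I (reset t (track I t)) i = maxUtility I i := by
        refine bid_eq_maxUtility I fun k hk => ?_
        have h0 := reset_nonneg (t := t) (fun i => (track_bounds I t i).1) k
        have hk' : reset t (track I t) k = 0 ∧ k < i := by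
          rcases hk with hk | hk
          · rw [h2] at hk; exact absurd h0 (not_le.2 hk)
          · rw [h2] at hk; exact hk
        have hkt : k.val < t := h ▸ hk'.2
        have h3 := ih (by omega) k hkt
        have h4 : reset t (track I t) k = track I t k := if_neg (by omega)
        rw [← h4, hk'.1] at h3
        have hp : 0 < rate ℝ n * (1 - rate ℝ n) ^ t := by
          refine mul_pos hr (pow_pos ?_ t)
          have hn : (1 : ℝ) ≤ (n + 1) ^ 2 := by nlinarith [Nat.cast_nonneg (α := ℝ) n]
          nlinarith [rate_mul_le n]
        exact le_antisymm (by
          by_contra hc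
          exact absurd (mul_pos hp (not_le.1 hc)) (not_lt.2 h3)) (maxUtility_nonneg I k)
      rw [h2, hb]
      have hle : (1 - rate ℝ n) ^ (t + 1) ≤ 1 := pow_le_one₀ (by linarith) (by linarith)
      have := mul_nonneg hr.le hm
      nlinarith

theorem one_sub_mul_rate_le (k : ℕ) (n : ℕ) : 1 - k * rate ℝ n ≤ (1 - rate ℝ n) ^ k := by
  have h := one_add_mul_le_pow (a := -rate ℝ n) (by linarith [rate_le_one n]) k
  calc 1 - k * rate ℝ n = 1 + k * (-rate ℝ n) := by ring
    _ ≤ _ := h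
    _ = _ := by rw [← sub_eq_add_neg]

theorem half_rate_mul_le_track (I : Market ℝ n m) (i : Fin n) :
    rate ℝ n / 2 * maxUtility I i ≤ track I n i := by
  refine le_trans (mul_le_mul_of_nonneg_right ?_ (maxUtility_nonneg I i))
    (le_track I n le_rfl i i.2)
  have h1 := one_sub_mul_rate_le n n
  have h2 := rate_mul_le n
  have h0 := rate_pos n
  have hn : (2 * n : ℝ) ≤ 4 * (n + 1) ^ 2 := by nlinarith [Nat.cast_nonneg (α := ℝ) n]
  have h3 : (1 : ℝ) / 2 ≤ (1 - rate ℝ n) ^ n := by nlinarith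
  nlinarith

/-- Agents with positive largest utility never return to zero, so the quotients in the gap are
genuine for them; for all others numerator and denominator vanish. -/
theorem track_pos (I : Market ℝ n m) {t : ℕ} (ht : n ≤ t) {i : Fin n}
    (hi : 0 < maxUtility I i) : 0 < track I t i := by
  have hr1 : rate ℝ n < 1 := by
    have := rate_mul_le n
    have h0 := rate_pos n
    have hn : (1 : ℝ) ≤ (n + 1) ^ 2 := by nlinarith [Nat.cast_nonneg (α := ℝ) n]
    nlinarith
  induction t, ht using Nat.le_induction with
  | base => exact lt_of_lt_of_le (mul_pos (half_pos (rate_pos n)) hi) (half_rate_mul_le_track I i)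
  | succ t ht ih =>
    by_cases h : Frozen I t (reset t (track I t))
    · rwa [track_succ_of_frozen h]
    · rw [track_succ_of_not_frozen h, reset_of_le ht]
      have h2 := bid_nonneg I (track I t) i
      have := rate_pos n
      nlinarith [mul_nonneg this.le h2, mul_pos (sub_pos.2 hr1) ih]

theorem one_add_sum_le_prod {ι : Type*} (s : Finset ι) (x : ι → ℝ) (hx : ∀ i ∈ s, 0 ≤ x i) :
    1 + ∑ i ∈ s, x i ≤ ∏ i ∈ s, (1 + x i) := by
  classical
  induction s using Finset.induction_on with
  | empty => simp
  | insert a s ha ih =>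
    rw [Finset.sum_insert ha, Finset.prod_insert ha]
    have h1 := ih fun i hi => hx i (Finset.mem_insert_of_mem hi)
    have h2 := hx a (Finset.mem_insert_self a s)
    have h3 : 0 ≤ ∑ i ∈ s, x i := Finset.sum_nonneg fun i hi => hx i (Finset.mem_insert_of_mem hi)
    nlinarith

open Classical in
/-- The agents that can get a positive utility. -/
noncomputable def active (I : Market ℝ n m) : Finset (Fin n) :=
  Finset.univ.filter fun i => 0 < maxUtility I i

theorem mem_active {I : Market ℝ n m} {i : Fin n} : i ∈ active I ↔ 0 < maxUtility I i := by
  simp [active]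

/-- The potential: the product of the shares that the agents have of their largest utilities. -/
noncomputable def potential (I : Market ℝ n m) (t : ℕ) : ℝ :=
  ∏ i ∈ active I, track I t i / maxUtility I i

theorem potential_le_one (I : Market ℝ n m) (t : ℕ) : potential I t ≤ 1 :=
  Finset.prod_le_one (fun i _ => div_nonneg (track_bounds I t i).1 (maxUtility_nonneg I i))
    fun i hi => (div_le_one (mem_active.1 hi)).2 (track_bounds I t i).2

theorem potential_nonneg (I : Market ℝ n m) (t : ℕ) : 0 ≤ potential I t :=
  Finset.prod_nonneg fun i _ => div_nonneg (track_bounds I t i).1 (maxUtility_nonneg I i)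

theorem le_potential (I : Market ℝ n m) :
    (rate ℝ n / 2) ^ (active I).card ≤ potential I n := by
  rw [← Finset.prod_const]
  refine Finset.prod_le_prod (fun i _ => (half_pos (rate_pos n)).le) fun i hi => ?_
  rw [le_div_iff₀ (mem_active.1 hi)]
  exact half_rate_mul_le_track I i

theorem card_active_le (I : Market ℝ n m) : (active I).card ≤ n := by
  simpa using Finset.card_le_univ (active I)

/-- Write `r` for the rate, `c` for the number of active agents and `x i` for `bid / track`. The
shares are multiplied by `1 - r + r * x i`, and not being frozen means `∑ x i ≥ c + 1/2`. Hence the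
product grows at least by `(1 - r)^c * (1 + r * ∑ x i) ≥ (1 - c * r) * (1 + r * (c + 1/2)) = 1 + r /
2 - r^2 * c * (c + 1/2)`, and the rate is small enough for `r * c * (c + 1/2) ≤ 1/4`. -/
theorem potential_succ (I : Market ℝ n m) {t : ℕ} (ht : n ≤ t)
    (h : ¬ Frozen I t (reset t (track I t))) :
    potential I t * (1 + rate ℝ n / 4) ≤ potential I (t + 1) := by
  have hr := rate_pos n
  have hr1 := rate_le_one n
  set x : Fin n → ℝ := fun i => bid I (track I t) i / track I t i with hx
  have hx0 : ∀ i, 0 ≤ x i := fun i => div_nonneg (bid_nonneg I _ i) (track_bounds I t i).1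
  have hstep : ∀ i ∈ active I, track I (t + 1) i / maxUtility I i =
      track I t i / maxUtility I i * (1 - rate ℝ n + rate ℝ n * x i) := by
    intro i hi
    rw [track_succ_of_not_frozen h, reset_of_le ht]
    have h1 := (track_pos I ht (mem_active.1 hi)).ne'
    have h2 := (mem_active.1 hi).ne'
    simp only [hx]
    field_simp
    ring
  have hgap : (active I).card + 1 / 2 ≤ ∑ i ∈ active I, x i := by
    have h1 : ¬ ∑ i, (bid I (track I t) i - track I t i) / track I t i ≤ 1 / 2 := fun hle =>
      h ⟨ht, by rw [reset_of_le ht]; exact hle⟩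
    have h2 : ∑ i, (bid I (track I t) i - track I t i) / track I t i =
        ∑ i ∈ active I, (x i - 1) := by
      symm
      refine Finset.sum_subset_zero_on_sdiff (Finset.subset_univ _) (fun i hi => ?_) fun i hi => ?_
      · have h3 : maxUtility I i = 0 := by
          refine le_antisymm (not_lt.1 fun h0 => ?_) (maxUtility_nonneg I i)
          exact (Finset.mem_sdiff.1 hi).2 (mem_active.2 h0)
        have h4 : track I t i = 0 :=
          le_antisymm (h3 ▸ (track_bounds I t i).2) (track_bounds I t i).1
        rw [h4, div_zero]
      · have h1 := (track_pos I ht (mem_active.1 hi)).ne'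
        simp only [hx]
        rw [sub_div, div_self h1]
    rw [h2, Finset.sum_sub_distrib] at h1
    simp only [Finset.sum_const, nsmul_eq_mul, mul_one] at h1
    linarith
  unfold potential
  rw [Finset.prod_congr rfl hstep, Finset.prod_mul_distrib]
  refine mul_le_mul_of_nonneg_left ?_ (potential_nonneg I t)
  -- Each factor loses only the nonnegative term `r^2 * x i`.
  have h1 : ∏ i ∈ active I, ((1 - rate ℝ n) * (1 + rate ℝ n * x i)) ≤
      ∏ i ∈ active I, (1 - rate ℝ n + rate ℝ n * x i) := by
    refine Finset.prod_le_prod (fun i _ => mul_nonneg (by linarith)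
      (by have := mul_nonneg hr.le (hx0 i); linarith)) fun i _ => ?_
    nlinarith [mul_nonneg (mul_nonneg hr.le hr.le) (hx0 i)]
  rw [Finset.prod_mul_distrib, Finset.prod_const] at h1
  refine le_trans ?_ h1
  have h2 := one_add_sum_le_prod (active I) (fun i => rate ℝ n * x i)
    fun i _ => mul_nonneg hr.le (hx0 i)
  rw [← Finset.mul_sum] at h2
  have h3 : 1 + rate ℝ n * ((active I).card + 1 / 2) ≤ ∏ i ∈ active I, (1 + rate ℝ n * x i) :=
    le_trans (by nlinarith) h2
  have h4 := one_sub_mul_rate_le (active I).card n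
  have hc : ((active I).card : ℝ) ≤ n := by exact_mod_cast card_active_le I
  have hc0 : (0 : ℝ) ≤ (active I).card := Nat.cast_nonneg _
  have h5 := rate_mul_le n
  have h6 : rate ℝ n * ((active I).card * ((active I).card + 1 / 2)) ≤ 1 / 4 := by
    have : ((active I).card : ℝ) * ((active I).card + 1 / 2) ≤ (n + 1) ^ 2 := by nlinarith
    nlinarith
  have h7 : 0 ≤ 1 - (active I).card * rate ℝ n := by nlinarith
  calc 1 + rate ℝ n / 4
      ≤ (1 - (active I).card * rate ℝ n) * (1 + rate ℝ n * ((active I).card + 1 / 2)) := by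
        nlinarith
    _ ≤ _ := mul_le_mul h4 h3 (by positivity) (pow_nonneg (by linarith) _)

/-- The potential starts at no less than `(rate / 2)` to the number of active agents and never
exceeds 1. With `N` further steps per agent it would exceed 1: by Bernoulli `rate / 2 * (1 + rate /
4)^N ≥ rate / 2 + N * rate^2 / 8`, and `N = 32 * (4 * (n + 1)^2)^2` gives `N * rate^2 ≥ 8`, because
the rate is at least the inverse of `2 * (4 * (n + 1)^2)`. -/
theorem exists_frozen (I : Market ℝ n m) :
    ∃ t, n ≤ t ∧ t ≤ numSteps n ∧ Frozen I t (reset t (track I t)) := by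
  by_contra hcon
  push Not at hcon
  have hr := rate_pos n
  obtain ⟨N, hN⟩ : ∃ N, N = 32 * (4 * (n + 1) ^ 2) ^ 2 := ⟨_, rfl⟩
  have hT : numSteps n = n + n * N := by unfold numSteps; rw [hN]; ring
  have hpot : ∀ s, s ≤ n * N → potential I n * (1 + rate ℝ n / 4) ^ s ≤ potential I (n + s) := by
    intro s
    induction s with
    | zero => simp
    | succ s ih =>
      intro hs
      rw [pow_succ, ← mul_assoc]
      exact (mul_le_mul_of_nonneg_right (ih (by omega)) (by positivity)).trans
        (potential_succ I (by omega) (hcon _ (by omega) (by omega)))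
  have hbig : 1 < rate ℝ n / 2 * (1 + rate ℝ n / 4) ^ N := by
    have h1 := one_add_mul_le_pow (a := rate ℝ n / 4) (by linarith) N
    have h2 := one_le_rate_mul n
    have h3 : (8 : ℝ) ≤ N * rate ℝ n ^ 2 := by
      rw [hN]; push_cast
      nlinarith
    calc (1 : ℝ) < rate ℝ n / 2 * (1 + N * (rate ℝ n / 4)) := by nlinarith
      _ ≤ _ := mul_le_mul_of_nonneg_left h1 (by positivity)
  have hcard : (active I).card ≠ 0 := by
    intro h0
    have hempty := Finset.card_eq_zero.1 h0
    refine hcon n le_rfl (by omega) ⟨le_rfl, ?_⟩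
    rw [reset_of_le le_rfl, Finset.sum_eq_zero]
    · norm_num
    · intro i _
      have h3 : maxUtility I i = 0 := by
        refine le_antisymm (not_lt.1 fun h0 => ?_) (maxUtility_nonneg I i)
        have := mem_active.2 h0
        rw [hempty] at this
        simp at this
      have h4 : track I n i = 0 :=
        le_antisymm (h3 ▸ (track_bounds I n i).2) (track_bounds I n i).1
      rw [h4, div_zero]
  have h1 : 1 < (rate ℝ n / 2 * (1 + rate ℝ n / 4) ^ N) ^ (active I).card :=
    one_lt_pow₀ hbig hcard
  have h2 : (rate ℝ n / 2 * (1 + rate ℝ n / 4) ^ N) ^ (active I).card ≤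
      potential I n * (1 + rate ℝ n / 4) ^ (n * N) := by
    rw [mul_pow, ← pow_mul]
    refine mul_le_mul (le_potential I) (pow_le_pow_right₀ (by linarith) ?_) (by positivity)
      (potential_nonneg I n)
    rw [mul_comm N]
    exact Nat.mul_le_mul_right N (card_active_le I)
  have h3 := (hpot _ le_rfl).trans (potential_le_one I _)
  linarith

theorem gap_le (I : Market ℝ n m) :
    ∑ i, (bid I (track I (numSteps n)) i - track I (numSteps n) i) / track I (numSteps n) i ≤
      1 / 2 := by
  obtain ⟨t, hnt, htT, hf⟩ := exists_frozen I
  -- A frozen step does not change the utilities and resets are over, so the condition holds again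
  -- in the next step.
  have key : ∀ s, t ≤ s → track I s = track I t := by
    intro s hs
    induction s, hs using Nat.le_induction with
    | base => rfl
    | succ s hs ih =>
      rw [← ih]
      refine track_succ_of_frozen ⟨hnt.trans hs, ?_⟩
      rw [reset_of_le (hnt.trans hs), ih, ← reset_of_le hnt (track I t)]
      exact hf.2
  rw [key _ htT, ← reset_of_le hnt (track I t)]
  exact hf.2

/-! ### The selection rule -/

theorem single_prio_max (I : Market ℝ n m) (u : Fin n → ℝ) (a : Fin n → Fin m) {i : Fin n}
    (h : (Pi.single (prio I.n_pos u a) 1 : Fin n → ℝ) i ≠ 0) (k : Fin n) : a k ≤ a i := by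
  have hi : i = prio I.n_pos u a := by
    by_contra hne
    exact h (Pi.single_eq_of_ne hne _)
  rw [hi]
  exact (isTop_prio I.n_pos u a).le k

theorem selectProb_mem (I : Market ℝ n m) (a : Fin n → Fin m) (t : ℕ) :
    selectProb I a t ∈ stdSimplex ℝ (Fin n) := by
  induction t with
  | zero => exact single_mem_stdSimplex ℝ _
  | succ t ih =>
    simp only [selectProb]
    split_ifs with h
    · exact ih
    · exact convex_stdSimplex ℝ (Fin n) ih (single_mem_stdSimplex ℝ _)
        (sub_nonneg.2 (rate_le_one n)) (rate_pos n).le (sub_add_cancel _ _)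

theorem selectProb_max (I : Market ℝ n m) (a : Fin n → Fin m) (t : ℕ) {i : Fin n}
    (hi : selectProb I a t i ≠ 0) (k : Fin n) : a k ≤ a i := by
  induction t with
  | zero => exact single_prio_max I _ a hi k
  | succ t ih =>
    simp only [selectProb] at hi
    split_ifs at hi with h
    · exact ih hi
    · by_cases h1 : selectProb I a t i = 0
      · simp only [h1, mul_zero, zero_add] at hi
        exact single_prio_max I _ a (right_ne_zero_of_mul hi) k
      · exact ih h1

/-- The selection rule that the iteration arrives at. -/
noncomputable def fairRule (I : Market ℝ n m) : SelectionRule I where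
  select a := selectProb I a (numSteps n)
  select_mem a := selectProb_mem I a _
  select_max a _ hi k := I.val_strictMono.monotone (selectProb_max I a _ hi k)

/-- Utilities are affine in the selection probabilities, so both sides follow the same recursion,
except that resets lower the left side. -/
theorem track_le_sum (I : Market ℝ n m) (t : ℕ) (i : Fin n) :
    track I t i ≤ ∑ a, profileProb I a * selectProb I a t i * I.val (a i) := by
  induction t generalizing i with
  | zero =>
    exact Finset.sum_nonneg fun a _ => mul_nonneg (mul_nonneg (profileProb_nonneg I a)
      ((selectProb_mem I a 0).1 i)) (I.val_nonneg _)
  | succ t ih =>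
    by_cases h : Frozen I t (reset t (track I t))
    · rw [track_succ_of_frozen h]
      simpa only [selectProb, if_pos h] using ih i
    · rw [track_succ_of_not_frozen h]
      simp only [selectProb, if_neg h]
      have h1 : ∑ a, profileProb I a * ((1 - rate ℝ n) * selectProb I a t i + rate ℝ n *
          (Pi.single (prio I.n_pos (reset t (track I t)) a) 1 : Fin n → ℝ) i) * I.val (a i) =
          (1 - rate ℝ n) * ∑ a, profileProb I a * selectProb I a t i * I.val (a i) +
            rate ℝ n * bid I (reset t (track I t)) i := by
        rw [bid_eq_sum, Finset.mul_sum, Finset.mul_sum, ← Finset.sum_add_distrib]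
        exact Finset.sum_congr rfl fun a _ => by ring
      rw [h1]
      have h2 := (reset_le (t := t) (fun i => (track_bounds I t i).1) i).trans (ih i)
      have h3 := mul_le_mul_of_nonneg_left h2 (sub_nonneg.2 (rate_le_one n))
      linarith

/-- The comparison is made for `track`, which may lie below the true utilities. The prefix sums of
`track` are nevertheless at most those of its `bid`, because the utilities of the rule itself
dominate `track` and are those of a Full Revelation policy. -/
theorem fairRule_isMajorizedWithin (I : Market ℝ n m) :
    IsMajorizedWithin 2 (fullRevelationPolicies I) (fairRule I).policy := by
  refine ⟨(fairRule I).policy_mem, fun k _ hk Q' hQ' => ?_⟩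
  have hle : ∀ i, track I (numSteps n) i ≤ (fairRule I).policy.utility i := fun i => by
    rw [SelectionRule.utility_eq_sum]
    exact track_le_sum I _ i
  have h := sumSmallest_le_two_mul (track I (numSteps n)) (bid I (track I (numSteps n)))
    Q'.utility (fun i => (track_bounds I _ i).1) (policy_utility_nonneg hQ')
    (fun k _ => policy_sum_sort_le hQ' _ k)
    (fun k _ => (Finset.sum_le_sum fun r _ => hle _).trans
      ((fairRule I).isRevealed_utility.sum_sort_le _ k))
    (fun i hi => by
      refine le_antisymm (le_trans (bid_le_maxUtility I _ i) (not_lt.1 fun h0 => ?_))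
        (bid_nonneg I _ i)
      exact (track_pos I (by unfold numSteps; omega) h0).ne' hi)
    (gap_le I) k hk
  have h' := sumSmallest_mono k hle
  linarith

end Real

/-! ### Lengths of rational numbers -/

theorem one_le_bits (q : ℚ) : 1 ≤ bits q := by
  have : 0 < q.den.size := Nat.size_pos.2 q.den_pos
  unfold bits; omega

theorem bits_le_of_eq_div {q : ℚ} {z : ℤ} {D N : ℕ} (hD : 0 < D) (h : q = z / D)
    (hz : z.natAbs ≤ N) : bits q ≤ N.size + D.size := by
  have h' : q = Rat.divInt z D := by rw [h, Rat.divInt_eq_div]; simp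
  have hD' : (D : ℤ) ≠ 0 := by exact_mod_cast hD.ne'
  refine Nat.add_le_add (Nat.size_le_size ?_) (Nat.size_le_size ?_)
  · rcases eq_or_ne z 0 with rfl | hz0
    · have : q = 0 := by rw [h]; simp
      rw [this]; simp
    · refine le_trans ?_ hz
      have := Rat.num_dvd z hD'
      rw [← h'] at this
      exact Nat.le_of_dvd (Int.natAbs_pos.2 hz0) (Int.natAbs_dvd_natAbs.2 this)
  · have := Rat.den_dvd z D
    rw [← h'] at this
    exact Nat.le_of_dvd hD (Int.natCast_dvd_natCast.1 this)

/-- A rational number with denominator `D` and absolute value at most `R` is short. -/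
theorem bits_le_of_mul_eq_int {q : ℚ} {z : ℤ} {D R : ℕ} (hD : 0 < D) (h : q * D = z)
    (hR : |q| ≤ R) : bits q ≤ (R * D).size + D.size := by
  have hD' : (0 : ℚ) < D := by exact_mod_cast hD
  refine bits_le_of_eq_div hD (z := z) (by rw [← h]; field_simp) ?_
  have h1 : |(z : ℚ)| ≤ R * D := by
    rw [← h, abs_mul, abs_of_pos hD']
    exact mul_le_mul_of_nonneg_right hR hD'.le
  have h2 : ((z.natAbs : ℕ) : ℚ) = |(z : ℚ)| := by
    rw [Nat.cast_natAbs]; push_cast; rfl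
  exact_mod_cast h2.trans_le h1

theorem size_mul_le (a b : ℕ) : (a * b).size ≤ a.size + b.size := by
  rw [Nat.size_le, pow_add]
  have h1 := Nat.lt_size_self a
  have h2 := Nat.lt_size_self b
  exact Nat.mul_lt_mul'' h1 h2

theorem size_prod_le {ι : Type*} (s : Finset ι) (f : ι → ℕ) :
    (∏ i ∈ s, f i).size ≤ ∑ i ∈ s, (f i).size + 1 := by
  classical
  induction s using Finset.induction_on with
  | empty => simp
  | insert a s ha ih =>
    rw [Finset.prod_insert ha, Finset.sum_insert ha]
    have := size_mul_le (f a) (∏ i ∈ s, f i)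
    omega

theorem size_pow_le (a k : ℕ) : (a ^ k).size ≤ k * a.size + 1 := by
  have := size_prod_le (Finset.range k) fun _ => a
  simpa using this

theorem size_le_self (a : ℕ) : a.size ≤ a := by
  rw [Nat.size_le]; exact Nat.lt_two_pow_self

theorem bits_natCast_le {a N : ℕ} (h : a ≤ N) : bits (a : ℚ) ≤ N + 1 := by
  have h1 := size_le_self a
  simp only [bits, Rat.num_natCast, Int.natAbs_natCast, Rat.den_natCast, Nat.size_one]
  omega

theorem bits_mul_le (q r : ℚ) : bits (q * r) ≤ bits q + bits r := by
  have h : q * r = ((q.num * r.num : ℤ) : ℚ) / ((q.den * r.den : ℕ) : ℚ) := by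
    conv_lhs => rw [← Rat.num_div_den q, ← Rat.num_div_den r]
    push_cast
    rw [div_mul_div_comm]
  have := bits_le_of_eq_div (Nat.mul_pos q.den_pos r.den_pos) h le_rfl
  rw [Int.natAbs_mul] at this
  have h1 := size_mul_le q.num.natAbs r.num.natAbs
  have h2 := size_mul_le q.den r.den
  unfold bits at *
  omega

/-- The numerator is a sum of two cross products, each no longer than `bits q + bits r`, and the
carry adds one bit; the denominator has at most `bits q + bits r` bits. The factor 3 absorbs the
carry. -/
theorem bits_add_le (q r : ℚ) : bits (q + r) ≤ 3 * (bits q + bits r) := by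
  have hq : (q.den : ℚ) ≠ 0 := by exact_mod_cast q.den_nz
  have hr : (r.den : ℚ) ≠ 0 := by exact_mod_cast r.den_nz
  have h : q + r = ((q.num * r.den + r.num * q.den : ℤ) : ℚ) / ((q.den * r.den : ℕ) : ℚ) := by
    conv_lhs => rw [← Rat.num_div_den q, ← Rat.num_div_den r]
    push_cast
    field_simp
  have h0 := bits_le_of_eq_div (Nat.mul_pos q.den_pos r.den_pos) h
    (N := q.num.natAbs * r.den + r.num.natAbs * q.den) (by
      refine (Int.natAbs_add_le _ _).trans ?_
      simp [Int.natAbs_mul])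
  have h1 : (q.num.natAbs * r.den + r.num.natAbs * q.den).size ≤ bits q + bits r + 1 := by
    rw [Nat.size_le]
    have e1 : q.num.natAbs * r.den < 2 ^ (bits q + bits r) := by
      rw [← Nat.size_le]
      have := size_mul_le q.num.natAbs r.den
      unfold bits; omega
    have e2 : r.num.natAbs * q.den < 2 ^ (bits q + bits r) := by
      rw [← Nat.size_le]
      have := size_mul_le r.num.natAbs q.den
      unfold bits; omega
    rw [pow_succ]; omega
  have h2 := size_mul_le q.den r.den
  have h3 := one_le_bits q
  have h4 : q.den.size + r.den.size ≤ bits q + bits r := by unfold bits; omega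
  omega

theorem bits_neg (q : ℚ) : bits (-q) = bits q := by simp [bits]

theorem bits_sub_le (q r : ℚ) : bits (q - r) ≤ 3 * (bits q + bits r) := by
  rw [sub_eq_add_neg, ← bits_neg r]; exact bits_add_le q (-r)

theorem bits_inv (q : ℚ) : bits q⁻¹ = bits q := by
  rcases eq_or_ne q 0 with rfl | hq
  · simp
  · have hn : q.num ≠ 0 := Rat.num_ne_zero.2 hq
    unfold bits
    rw [Rat.num_inv, Rat.den_inv, if_neg hn, Int.natAbs_mul]
    have : q.num.sign.natAbs = 1 := Int.natAbs_sign_of_ne_zero hn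
    rw [this]
    simp [add_comm]

theorem bits_div_le (q r : ℚ) : bits (q / r) ≤ bits q + bits r := by
  rw [div_eq_mul_inv, ← bits_inv r]; exact bits_mul_le q r⁻¹

theorem bits_floor_le (q : ℚ) : bits ((⌊q⌋ : ℤ) : ℚ) ≤ bits q := by
  unfold bits
  rw [Rat.num_intCast, Rat.den_intCast, Nat.size_one, Rat.floor_def']
  have h1 : (q.num / (q.den : ℤ)).natAbs ≤ q.num.natAbs := Int.natAbs_ediv_le_natAbs _ _
  have h2 := Nat.size_le_size h1
  have h3 : 0 < q.den.size := Nat.size_pos.2 q.den_pos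
  omega

/-! ### Costs of expressions and programs -/

/-- All numbers in the memory have at most `B` bits. -/
def Bdd (B : ℕ) (M : Memory) : Prop := ∀ a k, bits (M a k) ≤ B

namespace AExp

/-- The length of the value of an expression, relative to the lengths of the numbers in memory. -/
def valWeight : AExp → ℕ
  | const q => bits q
  | get _ _ => 1
  | add e₁ e₂ => 3 * (e₁.valWeight + e₂.valWeight)
  | sub e₁ e₂ => 3 * (e₁.valWeight + e₂.valWeight)
  | mul e₁ e₂ => 3 * (e₁.valWeight + e₂.valWeight)
  | div e₁ e₂ => 3 * (e₁.valWeight + e₂.valWeight)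
  | floor e => e.valWeight

/-- The cost of an expression, relative to the lengths of the numbers in memory. -/
def weight : AExp → ℕ
  | const q => bits q
  | get _ e => e.weight + 1
  | add e₁ e₂ => e₁.weight + e₂.weight + 3 * (e₁.valWeight + e₂.valWeight)
  | sub e₁ e₂ => e₁.weight + e₂.weight + 3 * (e₁.valWeight + e₂.valWeight)
  | mul e₁ e₂ => e₁.weight + e₂.weight + 3 * (e₁.valWeight + e₂.valWeight)
  | div e₁ e₂ => e₁.weight + e₂.weight + 3 * (e₁.valWeight + e₂.valWeight)
  | floor e => e.weight + e.valWeight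

theorem bits_eval_le {B : ℕ} {M : Memory} (hB : 1 ≤ B) (hM : Bdd B M) (e : AExp) :
    bits (e.eval M) ≤ e.valWeight * B := by
  induction e with
  | const q => simp only [eval, valWeight]; nlinarith
  | get a e _ => simp only [eval, valWeight, one_mul]; exact hM _ _
  | add e₁ e₂ h₁ h₂ =>
    simp only [eval, valWeight]
    have := bits_add_le (e₁.eval M) (e₂.eval M)
    nlinarith
  | sub e₁ e₂ h₁ h₂ =>
    simp only [eval, valWeight]
    have := bits_sub_le (e₁.eval M) (e₂.eval M)
    nlinarith
  | mul e₁ e₂ h₁ h₂ =>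
    simp only [eval, valWeight]
    have := bits_mul_le (e₁.eval M) (e₂.eval M)
    nlinarith
  | div e₁ e₂ h₁ h₂ =>
    simp only [eval, valWeight]
    have := bits_div_le (e₁.eval M) (e₂.eval M)
    nlinarith
  | floor e h =>
    simp only [eval, valWeight]
    exact (bits_floor_le _).trans h

theorem cost_le {B : ℕ} {M : Memory} (hB : 1 ≤ B) (hM : Bdd B M) (e : AExp) :
    e.cost M ≤ e.weight * B := by
  induction e with
  | const q => simp only [cost, weight]; nlinarith
  | get a e h =>
    simp only [cost, weight]
    have := bits_eval_le hB hM (get a e)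
    simp only [valWeight] at this
    nlinarith
  | add e₁ e₂ h₁ h₂ =>
    simp only [cost, weight]
    have := bits_eval_le hB hM (add e₁ e₂)
    simp only [valWeight] at this
    nlinarith
  | sub e₁ e₂ h₁ h₂ =>
    simp only [cost, weight]
    have := bits_eval_le hB hM (sub e₁ e₂)
    simp only [valWeight] at this
    nlinarith
  | mul e₁ e₂ h₁ h₂ =>
    simp only [cost, weight]
    have := bits_eval_le hB hM (mul e₁ e₂)
    simp only [valWeight] at this
    nlinarith
  | div e₁ e₂ h₁ h₂ =>
    simp only [cost, weight]
    have := bits_eval_le hB hM (div e₁ e₂)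
    simp only [valWeight] at this
    nlinarith
  | floor e h =>
    simp only [cost, weight]
    have := bits_eval_le hB hM (floor e)
    simp only [valWeight] at this
    nlinarith

end AExp

open Polynomial in
/-- A bound for the cost of a program whose loops are run through at most `X` times each, relative
to the lengths of the numbers in memory. -/
noncomputable def Program.stepPoly : Program → ℕ[X]
  | .skip => 1
  | .assign _ e e' => C (e.weight + e'.weight + 1)
  | .seq p q => p.stepPoly + q.stepPoly + 1
  | .ite e e' p q => C (e.weight + e'.weight + 1) + p.stepPoly + q.stepPoly
  | .loop e e' p => (X + 1) * C (e.weight + e'.weight + 1) + X * p.stepPoly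

/-- The program `p` turns the memory `M` into `M'`, running through each loop at most `L` times
and with all numbers of at most `B` bits. -/
def Run (L B : ℕ) (p : Program) (M M' : Memory) : Prop :=
  Bdd B M' ∧ ∃ t, Exec p M M' t ∧ t ≤ p.stepPoly.eval L * B

/-- The memory `M` with the entry of array `a` at position `k` replaced by `v`. -/
def write (M : Memory) (a k : ℕ) (v : ℚ) : Memory :=
  Function.update M a (Function.update (M a) k v)

theorem write_same (M : Memory) (a k : ℕ) (v : ℚ) (k' : ℕ) :
    write M a k v a k' = if k' = k then v else M a k' := by
  simp [write, Function.update_apply]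

theorem write_of_ne (M : Memory) {a a' : ℕ} (h : a' ≠ a) (k : ℕ) (v : ℚ) :
    write M a k v a' = M a' := by
  simp [write, h]

namespace Run

variable {L B : ℕ} {M M' M₁ : Memory} {p q : Program} {e e' : AExp}

theorem bdd (h : Run L B p M M') : Bdd B M' := h.1

theorem one_le_of_bdd (hM : Bdd B M) : 1 ≤ B := (one_le_bits _).trans (hM 0 0)

theorem skip (hM : Bdd B M) : Run L B .skip M M := by
  refine ⟨hM, 1, Exec.skip M, ?_⟩
  have := one_le_of_bdd hM
  simpa [Program.stepPoly] using this

theorem assign {a k : ℕ} {v : ℚ} (hM : Bdd B M) (hk : ⌊e.eval M⌋₊ = k) (hv : e'.eval M = v)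
    (hB : bits v ≤ B) : Run L B (.assign a e e') M (write M a k v) := by
  have h1 := one_le_of_bdd hM
  refine ⟨fun b l => ?_, e.cost M + e'.cost M + 1, ?_, ?_⟩
  · by_cases hb : b = a
    · subst hb
      rw [write_same]
      split_ifs
      exacts [hB, hM _ _]
    · rw [write_of_ne _ hb]; exact hM _ _
  · subst hk hv
    exact Exec.assign M a e e'
  · have h2 := e.cost_le h1 hM
    have h3 := e'.cost_le h1 hM
    simp only [Program.stepPoly, Polynomial.eval_C]
    nlinarith

theorem seq (h₁ : Run L B p M M₁) (h₂ : Run L B q M₁ M') : Run L B (.seq p q) M M' := by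
  obtain ⟨hM₁, t₁, h₁, ht₁⟩ := h₁
  obtain ⟨hM', t₂, h₂, ht₂⟩ := h₂
  refine ⟨hM', _, Exec.seq h₁ h₂, ?_⟩
  have := one_le_of_bdd hM'
  simp only [Program.stepPoly, Polynomial.eval_add, Polynomial.eval_one]
  nlinarith

theorem ite_true (hM : Bdd B M) (hc : e.eval M ≤ e'.eval M) (h : Run L B p M M') :
    Run L B (.ite e e' p q) M M' := by
  obtain ⟨hM', t, h, ht⟩ := h
  refine ⟨hM', _, Exec.ite_true hc h, ?_⟩
  have h1 := one_le_of_bdd hM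
  have h2 := e.cost_le h1 hM
  have h3 := e'.cost_le h1 hM
  simp only [Program.stepPoly, Polynomial.eval_add, Polynomial.eval_C]
  have := Nat.zero_le (q.stepPoly.eval L * B)
  nlinarith

theorem ite_false (hM : Bdd B M) (hc : ¬ e.eval M ≤ e'.eval M) (h : Run L B q M M') :
    Run L B (.ite e e' p q) M M' := by
  obtain ⟨hM', t, h, ht⟩ := h
  refine ⟨hM', _, Exec.ite_false hc h, ?_⟩
  have h1 := one_le_of_bdd hM
  have h2 := e.cost_le h1 hM
  have h3 := e'.cost_le h1 hM
  simp only [Program.stepPoly, Polynomial.eval_add, Polynomial.eval_C]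
  have := Nat.zero_le (p.stepPoly.eval L * B)
  nlinarith

/-- The uniform bound `B` on all intermediate memories gives each iteration the same cost bound, so
the total is linear in the number of iterations. -/
theorem loop {n : ℕ} (Inv : ℕ → Memory → Prop) (hn : n ≤ L)
    (hstep : ∀ k < n, ∀ M, Bdd B M → Inv k M →
      e.eval M < e'.eval M ∧ ∃ M', Run L B p M M' ∧ Inv (k + 1) M')
    (hdone : ∀ M, Inv n M → ¬ e.eval M < e'.eval M) (hM : Bdd B M) (h0 : Inv 0 M) :
    ∃ M', Run L B (.loop e e' p) M M' ∧ Inv n M' := by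
  have h1 := one_le_of_bdd hM
  set w := (e.weight + e'.weight + 1) * B with hw
  set s := p.stepPoly.eval L * B with hs
  have hcost : ∀ M, Bdd B M → e.cost M + e'.cost M + 1 ≤ w := by
    intro M hM
    have h2 := e.cost_le h1 hM
    have h3 := e'.cost_le h1 hM
    rw [hw]; nlinarith
  have key : ∀ j k, k + j = n → ∀ M, Bdd B M → Inv k M →
      ∃ M' t, Exec (.loop e e' p) M M' t ∧ Bdd B M' ∧ Inv n M' ∧ t ≤ (j + 1) * w + j * s := by
    intro j
    induction j with
    | zero =>
      intro k hk M hM hI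
      have hk' : k = n := by omega
      subst hk'
      refine ⟨M, _, Exec.loop_done (hdone M hI), hM, hI, ?_⟩
      have := hcost M hM
      omega
    | succ j ih =>
      intro k hk M hM hI
      obtain ⟨hlt, M₁, ⟨hM₁, t₁, hE₁, ht₁⟩, hI₁⟩ := hstep k (by omega) M hM hI
      obtain ⟨M', t₂, hE₂, hM', hI', ht₂⟩ := ih (k + 1) (by omega) M₁ hM₁ hI₁
      refine ⟨M', _, Exec.loop_step hlt hE₁ hE₂, hM', hI', ?_⟩
      have h2 := hcost M hM
      have h3 : t₁ ≤ s := ht₁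
      have e1 : (j + 1 + 1) * w + (j + 1) * s = (j + 1) * w + j * s + w + s := by ring
      omega
  obtain ⟨M', t, hE, hM', hI, ht⟩ := key n 0 (by omega) M hM h0
  refine ⟨M', ⟨hM', t, hE, ht.trans ?_⟩, hI⟩
  simp only [Program.stepPoly, Polynomial.eval_add, Polynomial.eval_mul, Polynomial.eval_C,
    Polynomial.eval_X, Polynomial.eval_one]
  have e1 : ((L + 1) * (e.weight + e'.weight + 1) + L * Polynomial.eval L p.stepPoly) * B =
      (L + 1) * w + L * s := by rw [hw, hs]; ring
  rw [e1]
  exact Nat.add_le_add (Nat.mul_le_mul_right _ (by omega)) (Nat.mul_le_mul_right _ hn)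

end Run

/-! ### Reasoning about memories -/

/-- The memories `M` and `M'` agree outside the arrays in `W`. -/
def Frame (W : List ℕ) (M M' : Memory) : Prop := ∀ a, a ∉ W → M' a = M a

namespace Frame

variable {W W' : List ℕ} {M M' M₁ : Memory}

theorem refl (W : List ℕ) (M : Memory) : Frame W M M := fun _ _ => rfl

theorem mono (h : Frame W M M') (hW : W ⊆ W') : Frame W' M M' := fun a ha => h a fun h' => ha (hW h')

theorem trans (h : Frame W M M₁) (h' : Frame W M₁ M') : Frame W M M' := fun a ha =>
  (h' a ha).trans (h a ha)

theorem write (h : Frame W M M') {a : ℕ} (ha : a ∈ W) (k : ℕ) (v : ℚ) :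
    Frame W M (write M' a k v) := fun b hb => by
  rw [write_of_ne _ (show b ≠ a from fun e => hb (e.symm ▸ ha))]
  exact h b hb

end Frame

theorem Bdd.write {B : ℕ} {M : Memory} (hM : Bdd B M) {v : ℚ} (hv : bits v ≤ B) (a k : ℕ) :
    Bdd B (write M a k v) := by
  intro b l
  by_cases hb : b = a
  · subst hb
    rw [write_same]
    split_ifs
    exacts [hv, hM _ _]
  · rw [write_of_ne _ hb]; exact hM _ _

/-- The entry of array `a` at position `0`. -/
abbrev cell (a : ℕ) : AExp := .get a (.const 0)

theorem eval_cell (a : ℕ) (M : Memory) : (cell a).eval M = M a 0 := by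
  simp [AExp.eval]

theorem eval_add (e e' : AExp) (M : Memory) : (e.add e').eval M = e.eval M + e'.eval M := rfl

theorem eval_sub (e e' : AExp) (M : Memory) : (e.sub e').eval M = e.eval M - e'.eval M := rfl

theorem eval_mul (e e' : AExp) (M : Memory) : (e.mul e').eval M = e.eval M * e'.eval M := rfl

theorem eval_div (e e' : AExp) (M : Memory) : (e.div e').eval M = e.eval M / e'.eval M := rfl

theorem eval_get {M : Memory} {e : AExp} {k : ℕ} (a : ℕ) (h : e.eval M = k) :
    (AExp.get a e).eval M = M a k := by
  simp [AExp.eval, h]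

/-- The assignment of the value of `e` to the entry of array `a` at position `0`. -/
abbrev setCell (a : ℕ) (e : AExp) : Program := .assign a (.const 0) e

theorem Run.setCell {L B a : ℕ} {M : Memory} {e : AExp} {v : ℚ} (hM : Bdd B M)
    (hv : e.eval M = v) (hB : bits v ≤ B) : Run L B (setCell a e) M (write M a 0 v) :=
  Run.assign hM (by simp [AExp.eval]) hv hB

/-! ### The utilities under given priorities, with natural numbers as indices -/

section Formulas

variable (n : ℕ) (V : ℕ → ℚ) (p : ℕ → ℕ → ℚ)

/-- The least value index of agent `k` if agent `i` is selected with value index `j`. -/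
def loIndex (i j k : ℕ) : ℕ := if k = i then j else 0

/-- The bound of the value indices of agent `k` if agent `i` is selected with value index `j`. -/
def hiIndex (u : ℕ → ℚ) (i j k : ℕ) : ℕ := if u k < u i ∨ (u k = u i ∧ k < i) then j else j + 1

/-- The probability that the value of agent `k` lets agent `i` be selected with value index `j`. -/
def factor (u : ℕ → ℚ) (i j k : ℕ) : ℚ :=
  ∑ l ∈ Finset.Ico (loIndex i j k) (hiIndex u i j k), p k l

/-- The contribution of the first value indices to the expected utility of agent `i`. -/
def partialBid (u : ℕ → ℚ) (i j : ℕ) : ℚ :=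
  ∑ j' ∈ Finset.range j, V j' * ∏ k ∈ Finset.range n, factor p u i j' k

/-- The contribution of the first agents to the relative excess. -/
def partialGap (m : ℕ) (u : ℕ → ℚ) (i : ℕ) : ℚ :=
  ∑ i' ∈ Finset.range i, (partialBid n V p u i' m - u i') / u i'

/-- The memory holds the data of the market. -/
structure Holds (m : ℕ) (M : Memory) : Prop where
  agents : M 0 0 = n
  values : M 0 1 = m
  val : ∀ j < m, M 1 j = V j
  prob : ∀ k < n, ∀ l < m, M 2 (k * m + l) = p k l

/-- Bounds for the numbers that occur in the computation of the utilities for `u`. -/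
structure Short (m B N : ℕ) (u : ℕ → ℚ) : Prop where
  nat : ∀ x : ℕ, x ≤ N → bits (x : ℚ) ≤ B
  agents_le : n ≤ N
  values_le : m ≤ N
  sum : ∀ k < n, ∀ l l', l' ≤ m → bits (∑ i ∈ Finset.Ico l l', p k i) ≤ B
  prod : ∀ i < n, ∀ j < m, ∀ k ≤ n, bits (∏ k' ∈ Finset.range k, factor p u i j k') ≤ B
  bid : ∀ i < n, ∀ j ≤ m, bits (partialBid n V p u i j) ≤ B
  gap : ∀ i ≤ n, bits (partialGap n V p m u i) ≤ B

end Formulas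

theorem Holds.frame {n m : ℕ} {V : ℕ → ℚ} {p : ℕ → ℕ → ℚ} {M M' : Memory} {W : List ℕ}
    (h : Holds n V p m M) (hF : Frame W M M') (h0 : 0 ∉ W) (h1 : 1 ∉ W) (h2 : 2 ∉ W) :
    Holds n V p m M' :=
  ⟨by rw [hF 0 h0]; exact h.agents, by rw [hF 0 h0]; exact h.values,
    by rw [hF 1 h1]; exact h.val, by rw [hF 2 h2]; exact h.prob⟩

theorem loIndex_le_hiIndex (u : ℕ → ℚ) (i j k : ℕ) : loIndex i j k ≤ hiIndex u i j k := by
  unfold loIndex hiIndex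
  split_ifs with h1 h2 h2
  all_goals omega

theorem hiIndex_le (u : ℕ → ℚ) (i j k : ℕ) : hiIndex u i j k ≤ j + 1 := by
  unfold hiIndex; split_ifs <;> omega

/-! ### The program -/

/-- Adds the entries of row `M 17 0` of array 2 from column `M 18 0` to before `M 19 0` to
`M 20 0`. -/
def sumLoop : Program :=
  .loop (cell 18) (cell 19) (.seq
    (setCell 20 (.add (cell 20) (.get 2 (.add (.mul (cell 17) (.get 0 (.const 1))) (cell 18)))))
    (setCell 18 (.add (cell 18) (.const 1))))

/-- Computes `loIndex` and `hiIndex`. -/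
def indexRange : Program :=
  .seq (setCell 20 (.const 0)) (.seq (setCell 18 (.const 0)) (.seq
    (setCell 19 (.add (cell 16) (.const 1)))
    (.ite (.get 6 (cell 14)) (.get 6 (cell 17))
      (.ite (.get 6 (cell 17)) (.get 6 (cell 14))
        (.ite (cell 14) (cell 17)
          (.ite (cell 17) (cell 14) (setCell 18 (cell 16)) .skip)
          (setCell 19 (cell 16)))
        .skip)
      (setCell 19 (cell 16)))))

/-- Multiplies the factors of all agents. -/
def prodLoop : Program :=
  .loop (cell 17) (.get 0 (.const 0)) (.seq indexRange (.seq sumLoop (.seq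
    (setCell 21 (.mul (cell 21) (cell 20))) (setCell 17 (.add (cell 17) (.const 1))))))

/-- Adds the contributions of all values to the utility of agent `M 14 0`. -/
def valueLoop : Program :=
  .loop (cell 16) (.get 0 (.const 1)) (.seq (setCell 21 (.const 1)) (.seq
    (setCell 17 (.const 0)) (.seq prodLoop (.seq
      (setCell 22 (.add (cell 22) (.mul (.get 1 (cell 16)) (cell 21))))
      (setCell 16 (.add (cell 16) (.const 1)))))))

/-- Computes the utilities of all agents and their relative excess. -/
def bidLoop : Program :=
  .loop (cell 14) (.get 0 (.const 0)) (.seq (setCell 22 (.const 0)) (.seq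
    (setCell 16 (.const 0)) (.seq valueLoop (.seq
      (.assign 7 (cell 14) (cell 22)) (.seq
      (setCell 15 (.add (cell 15)
        (.div (.sub (cell 22) (.get 6 (cell 14))) (.get 6 (cell 14)))))
      (setCell 14 (.add (cell 14) (.const 1))))))))

/-! ### Correctness and cost of the loops that compute the utilities and the gap. -/

section Runs

variable {n m L B N : ℕ} {V : ℕ → ℚ} {p : ℕ → ℕ → ℚ} {u : ℕ → ℚ} {M : Memory}

theorem sumLoop_run (hS : Short n V p m B N u) (hM : Bdd B M) (hH : Holds n V p m M)
    {k lo hi : ℕ} (hk : M 17 0 = k) (hlo : M 18 0 = lo) (hhi : M 19 0 = hi) (h20 : M 20 0 = 0)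
    (hkn : k < n) (hle : lo ≤ hi) (him : hi ≤ m) (hL : m ≤ L) :
    ∃ M', Run L B sumLoop M M' ∧ Frame [18, 20] M M' ∧
      M' 20 0 = ∑ l ∈ Finset.Ico lo hi, p k l := by
  refine Exists.imp ?_ (Run.loop (L := L) (B := B) (M := M) (e := cell 18) (e' := cell 19)
    (p := .seq (setCell 20 (.add (cell 20)
      (.get 2 (.add (.mul (cell 17) (.get 0 (.const 1))) (cell 18)))))
    (setCell 18 (.add (cell 18) (.const 1)))) (n := hi - lo)
    (fun r M₁ => Frame [18, 20] M M₁ ∧ M₁ 18 0 = ((lo + r : ℕ) : ℚ) ∧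
      M₁ 20 0 = ∑ l ∈ Finset.Ico lo (lo + r), p k l) (by omega) ?_ ?_ hM
    ⟨Frame.refl _ _, by simpa using hlo, by simpa using h20⟩)
  · rintro M' ⟨hR, hF, -, h⟩
    refine ⟨hR, hF, ?_⟩
    rw [h, Nat.add_sub_cancel' hle]
  · rintro r hr M₁ hM₁ ⟨hF, h18, h20⟩
    have e17 : M₁ 17 0 = k := by rw [hF 17 (by decide), hk]
    have e19 : M₁ 19 0 = hi := by rw [hF 19 (by decide), hhi]
    have e0 : M₁ 0 1 = m := by rw [hF 0 (by decide), hH.values]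
    have e2 : (AExp.get 2 (.add (.mul (cell 17) (.get 0 (.const 1))) (cell 18))).eval M₁ =
        p k (lo + r) := by
      rw [eval_get (k := k * m + (lo + r)) 2 (by simp [AExp.eval, e17, e0, h18]),
        hF 2 (by decide), hH.prob k hkn _ (by omega)]
    have hb1 := hS.sum k hkn lo (lo + (r + 1)) (by omega)
    refine ⟨?_, _, Run.seq (Run.setCell hM₁ (v := ∑ l ∈ Finset.Ico lo (lo + (r + 1)), p k l)
      ?_ hb1) (Run.setCell (hM₁.write hb1 _ _) (v := ((lo + (r + 1) : ℕ) : ℚ)) ?_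
        (hS.nat _ (by have := hS.values_le; omega))), ?_, ?_, ?_⟩
    · rw [eval_cell, eval_cell, h18, e19]
      exact_mod_cast (by omega : lo + r < hi)
    · rw [AExp.eval, e2, eval_cell, h20, ← add_assoc, Finset.sum_Ico_succ_top (by omega)]
    · simp [AExp.eval, write_of_ne, h18]; ring
    · exact (hF.write (by decide) _ _).write (by decide) _ _
    · simp [write_same]
    · simp [write_of_ne, write_same]
  · rintro M₁ ⟨hF, h18, -⟩
    have e19 : M₁ 19 0 = hi := by rw [hF 19 (by decide), hhi]
    rw [eval_cell, eval_cell, h18, e19, Nat.add_sub_cancel' hle]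
    exact lt_irrefl _

theorem indexRange_run (hS : Short n V p m B N u) (hM : Bdd B M) {i j k : ℕ}
    (hi : M 14 0 = i) (hj : M 16 0 = j) (hk : M 17 0 = k) (hu : ∀ i < n, M 6 i = u i)
    (hin : i < n) (hjm : j < m) (hkn : k < n) :
    ∃ M', Run L B indexRange M M' ∧ Frame [18, 19, 20] M M' ∧ M' 20 0 = 0 ∧
      M' 18 0 = loIndex i j k ∧ M' 19 0 = hiIndex u i j k := by
  have hb0 : bits (0 : ℚ) ≤ B := by exact_mod_cast hS.nat 0 (Nat.zero_le _)
  have hmN := hS.values_le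
  have hbj := hS.nat j (by omega)
  have hbj1 := hS.nat (j + 1) (by omega)
  have hM₁ := ((hM.write hb0 20 0).write hb0 18 0).write hbj1 19 0
  set M₁ := write (write (write M 20 0 0) 18 0 0) 19 0 ((j + 1 : ℕ) : ℚ) with hM₁'
  have hF : Frame [18, 19, 20] M M₁ :=
    (((Frame.refl _ M).write (by decide) _ _).write (by decide) _ _).write (by decide) _ _
  have e20 : M₁ 20 0 = 0 := by simp [hM₁', write_same, write_of_ne]
  have e18 : M₁ 18 0 = 0 := by simp [hM₁', write_same, write_of_ne]
  have e19 : M₁ 19 0 = ((j + 1 : ℕ) : ℚ) := by simp [hM₁', write_same]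
  have e14 : M₁ 14 0 = i := by rw [hF 14 (by decide), hi]
  have e16 : M₁ 16 0 = j := by rw [hF 16 (by decide), hj]
  have e17 : M₁ 17 0 = k := by rw [hF 17 (by decide), hk]
  have eui : (AExp.get 6 (cell 14)).eval M₁ = u i := by
    rw [eval_get (k := i) 6 (by rw [eval_cell, e14]), hF 6 (by decide), hu i hin]
  have euk : (AExp.get 6 (cell 17)).eval M₁ = u k := by
    rw [eval_get (k := k) 6 (by rw [eval_cell, e17]), hF 6 (by decide), hu k hkn]
  -- The common prefix of all branches: empty sum, lower end 0, upper end `j + 1`. The branches only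
  -- correct one of the ends to `j`.
  have hstart : ∀ q M', Run L B q M₁ M' → Run L B (.seq (setCell 20 (.const 0))
      (.seq (setCell 18 (.const 0)) (.seq (setCell 19 (.add (cell 16) (.const 1))) q))) M M' :=
    fun q M' hq => Run.seq (Run.setCell hM (v := 0) (by simp [AExp.eval]) hb0)
      (Run.seq (Run.setCell (hM.write hb0 _ _) (v := 0) (by simp [AExp.eval]) hb0)
        (Run.seq (Run.setCell ((hM.write hb0 _ _).write hb0 _ _) (v := ((j + 1 : ℕ) : ℚ))
          (by simp [AExp.eval, write_of_ne, hj]) hbj1) hq))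
  have r18 : Run L B (setCell 18 (cell 16)) M₁ (write M₁ 18 0 j) :=
    Run.setCell hM₁ (by rw [eval_cell, e16]) hbj
  have r19 : Run L B (setCell 19 (cell 16)) M₁ (write M₁ 19 0 j) :=
    Run.setCell hM₁ (by rw [eval_cell, e16]) hbj
  unfold indexRange
  by_cases h1 : u i ≤ u k
  · by_cases h2 : u k ≤ u i
    · have h12 := le_antisymm h1 h2
      by_cases h3 : i ≤ k
      · by_cases h4 : k ≤ i
        · have h34 := le_antisymm h3 h4
          refine ⟨_, hstart _ _ (Run.ite_true hM₁ (by rw [eui, euk]; exact h1)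
            (Run.ite_true hM₁ (by rw [eui, euk]; exact h2)
            (Run.ite_true hM₁ (by rw [eval_cell, eval_cell, e14, e17]; exact_mod_cast h3)
            (Run.ite_true hM₁ (by rw [eval_cell, eval_cell, e14, e17]; exact_mod_cast h4)
              r18)))), hF.write (by decide) _ _, ?_, ?_, ?_⟩
          · simp [write_of_ne, e20]
          · simp [write_same, loIndex, h34]
          · simp [write_of_ne, e19, hiIndex, h34]
        · refine ⟨_, hstart _ _ (Run.ite_true hM₁ (by rw [eui, euk]; exact h1)
            (Run.ite_true hM₁ (by rw [eui, euk]; exact h2)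
            (Run.ite_true hM₁ (by rw [eval_cell, eval_cell, e14, e17]; exact_mod_cast h3)
            (Run.ite_false hM₁ (by rw [eval_cell, eval_cell, e14, e17]; exact_mod_cast h4)
              (Run.skip hM₁))))), hF, e20, ?_, ?_⟩
          · simp [e18, loIndex, show k ≠ i by omega]
          · rw [e19, hiIndex, if_neg]
            rintro (h | ⟨-, h⟩)
            · exact absurd h1 (not_le.2 h)
            · omega
      · refine ⟨_, hstart _ _ (Run.ite_true hM₁ (by rw [eui, euk]; exact h1)
          (Run.ite_true hM₁ (by rw [eui, euk]; exact h2)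
          (Run.ite_false hM₁ (by rw [eval_cell, eval_cell, e14, e17]; exact_mod_cast h3)
            r19))), hF.write (by decide) _ _, ?_, ?_, ?_⟩
        · simp [write_of_ne, e20]
        · simp [write_of_ne, e18, loIndex, show k ≠ i by omega]
        · simp [write_same, hiIndex, h12, not_le.1 h3]
    · refine ⟨_, hstart _ _ (Run.ite_true hM₁ (by rw [eui, euk]; exact h1)
        (Run.ite_false hM₁ (by rw [eui, euk]; exact h2) (Run.skip hM₁))), hF, e20, ?_, ?_⟩
      · have : k ≠ i := by rintro rfl; exact h2 le_rfl
        simp [e18, loIndex, this]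
      · rw [e19, hiIndex, if_neg]
        rintro (h | ⟨h, -⟩)
        · exact h2 h.le
        · exact h2 h.le
  · refine ⟨_, hstart _ _ (Run.ite_false hM₁ (by rw [eui, euk]; exact h1) r19),
      hF.write (by decide) _ _, ?_, ?_, ?_⟩
    · simp [write_of_ne, e20]
    · have : k ≠ i := by rintro rfl; exact h1 le_rfl
      simp [write_of_ne, e18, loIndex, this]
    · simp [write_same, hiIndex, not_le.1 h1]

theorem prodLoop_run (hS : Short n V p m B N u) (hM : Bdd B M) (hH : Holds n V p m M) {i j : ℕ}
    (hi : M 14 0 = i) (hj : M 16 0 = j) (hk : M 17 0 = 0) (hu : ∀ i < n, M 6 i = u i)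
    (h21 : M 21 0 = 1) (hin : i < n) (hjm : j < m) (hnL : n ≤ L) (hmL : m ≤ L) :
    ∃ M', Run L B prodLoop M M' ∧ Frame [17, 18, 19, 20, 21] M M' ∧
      M' 21 0 = ∏ k ∈ Finset.range n, factor p u i j k := by
  refine Exists.imp ?_ (Run.loop (L := L) (B := B) (M := M) (e := cell 17)
    (e' := .get 0 (.const 0)) (p := .seq indexRange (.seq sumLoop (.seq
    (setCell 21 (.mul (cell 21) (cell 20))) (setCell 17 (.add (cell 17) (.const 1)))))) (n := n)
    (fun k M₁ => Frame [17, 18, 19, 20, 21] M M₁ ∧ M₁ 17 0 = (k : ℚ) ∧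
      M₁ 21 0 = ∏ k' ∈ Finset.range k, factor p u i j k') hnL ?_ ?_ hM
    ⟨Frame.refl _ _, by simpa using hk, by simpa using h21⟩)
  · exact fun M' ⟨hR, hF, _, h⟩ => ⟨hR, hF, h⟩
  · rintro k hk M₁ hM₁ ⟨hF, h17, h21⟩
    have hH₁ := hH.frame hF (by decide) (by decide) (by decide)
    have e14 : M₁ 14 0 = i := by rw [hF 14 (by decide), hi]
    have e16 : M₁ 16 0 = j := by rw [hF 16 (by decide), hj]
    have e6 : ∀ i < n, M₁ 6 i = u i := by rw [hF 6 (by decide)]; exact hu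
    obtain ⟨M₂, hR₂, hF₂, h20, hlo, hhi⟩ :=
      indexRange_run (L := L) hS hM₁ e14 e16 h17 e6 hin hjm hk
    have hH₂ := hH₁.frame hF₂ (by decide) (by decide) (by decide)
    have hle := hiIndex_le u i j k
    obtain ⟨M₃, hR₃, hF₃, h20⟩ := sumLoop_run (L := L) hS hR₂.bdd hH₂
      (by rw [hF₂ 17 (by decide), h17]) hlo hhi h20 hk (loIndex_le_hiIndex u i j k) (by omega) hmL
    have e21 : M₃ 21 0 = ∏ k' ∈ Finset.range k, factor p u i j k' := by
      rw [hF₃ 21 (by decide), hF₂ 21 (by decide), h21]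
    have e17 : M₃ 17 0 = k := by rw [hF₃ 17 (by decide), hF₂ 17 (by decide), h17]
    have hb := hS.prod i hin j hjm (k + 1) hk
    refine ⟨?_, _, Run.seq hR₂ (Run.seq hR₃ (Run.seq (Run.setCell hR₃.bdd
      (v := ∏ k' ∈ Finset.range (k + 1), factor p u i j k') ?_ hb)
      (Run.setCell (hR₃.bdd.write hb _ _) (v := ((k + 1 : ℕ) : ℚ)) ?_
        (hS.nat _ (by have := hS.agents_le; omega))))), ?_, ?_, ?_⟩
    · rw [eval_cell, h17, eval_get (k := 0) 0 (by simp [AExp.eval]), hH₁.agents]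
      exact_mod_cast hk
    · rw [AExp.eval, eval_cell, eval_cell, e21, h20, Finset.prod_range_succ]
      rfl
    · simp [AExp.eval, write_of_ne, e17]
    · exact ((hF.trans (hF₂.mono (by decide))).trans (hF₃.mono (by decide))).write
        (by decide) _ _ |>.write (by decide) _ _
    · simp [write_same]
    · simp [write_of_ne, write_same]
  · rintro M₁ ⟨hF, h17, -⟩
    have hH₁ := hH.frame hF (by decide) (by decide) (by decide)
    rw [eval_cell, h17, eval_get (k := 0) 0 (by simp [AExp.eval]), hH₁.agents]
    exact lt_irrefl _

theorem valueLoop_run (hS : Short n V p m B N u) (hM : Bdd B M) (hH : Holds n V p m M) {i : ℕ}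
    (hi : M 14 0 = i) (hj : M 16 0 = 0) (hu : ∀ i < n, M 6 i = u i)
    (h22 : M 22 0 = 0) (hin : i < n) (hnL : n ≤ L) (hmL : m ≤ L) :
    ∃ M', Run L B valueLoop M M' ∧ Frame [16, 17, 18, 19, 20, 21, 22] M M' ∧
      M' 22 0 = partialBid n V p u i m := by
  have hb0 : bits (0 : ℚ) ≤ B := by exact_mod_cast hS.nat 0 (Nat.zero_le _)
  have hb1 : bits (1 : ℚ) ≤ B := by
    exact_mod_cast hS.nat 1 (by have := hS.agents_le; omega)
  refine Exists.imp ?_ (Run.loop (L := L) (B := B) (M := M) (e := cell 16)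
    (e' := .get 0 (.const 1)) (p := .seq (setCell 21 (.const 1)) (.seq
    (setCell 17 (.const 0)) (.seq prodLoop (.seq
      (setCell 22 (.add (cell 22) (.mul (.get 1 (cell 16)) (cell 21))))
      (setCell 16 (.add (cell 16) (.const 1))))))) (n := m)
    (fun j M₁ => Frame [16, 17, 18, 19, 20, 21, 22] M M₁ ∧ M₁ 16 0 = (j : ℚ) ∧
      M₁ 22 0 = partialBid n V p u i j) hmL ?_ ?_ hM
    ⟨Frame.refl _ _, by simpa using hj, by simpa [partialBid] using h22⟩)
  · exact fun M' ⟨hR, hF, _, h⟩ => ⟨hR, hF, h⟩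
  · rintro j hj M₁ hM₁ ⟨hF, h16, h22⟩
    have hH₁ := hH.frame hF (by decide) (by decide) (by decide)
    have hM₂ := (hM₁.write hb1 21 0).write hb0 17 0
    have hF₂ : Frame [16, 17, 18, 19, 20, 21, 22] M (write (write M₁ 21 0 1) 17 0 0) :=
      (hF.write (by decide) _ _).write (by decide) _ _
    have hH₂ := hH.frame hF₂ (by decide) (by decide) (by decide)
    obtain ⟨M₃, hR₃, hF₃, h21⟩ := prodLoop_run (L := L) hS hM₂ hH₂ (i := i) (j := j)
      (by rw [hF₂ 14 (by decide), hi]) (by simp [write_of_ne, h16]) (by simp [write_same])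
      (by rw [hF₂ 6 (by decide)]; exact hu) (by simp [write_same, write_of_ne]) hin hj hnL hmL
    have hF₃' := hF₂.trans (hF₃.mono (by decide))
    have hH₃ := hH.frame hF₃' (by decide) (by decide) (by decide)
    have e16 : M₃ 16 0 = j := by rw [hF₃ 16 (by decide)]; simp [write_of_ne, h16]
    have e22 : M₃ 22 0 = partialBid n V p u i j := by
      rw [hF₃ 22 (by decide)]; simp [write_of_ne, h22]
    have hb := hS.bid i hin (j + 1) hj
    refine ⟨?_, _, Run.seq (Run.setCell hM₁ (v := 1) (by simp [AExp.eval]) hb1)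
      (Run.seq (Run.setCell (hM₁.write hb1 _ _) (v := 0) (by simp [AExp.eval]) hb0)
      (Run.seq hR₃ (Run.seq (Run.setCell hR₃.bdd (v := partialBid n V p u i (j + 1)) ?_ hb)
      (Run.setCell (hR₃.bdd.write hb _ _) (v := ((j + 1 : ℕ) : ℚ)) ?_
        (hS.nat _ (by have := hS.values_le; omega)))))), ?_, ?_, ?_⟩
    · rw [eval_cell, h16, eval_get (k := 1) 0 (by simp [AExp.eval]), hH₁.values]
      exact_mod_cast hj
    · have e1 : (AExp.get 1 (cell 16)).eval M₃ = V j := by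
        rw [eval_get (k := j) 1 (by rw [eval_cell, e16]), hH₃.val j hj]
      rw [eval_add, eval_mul, eval_cell, eval_cell, e1, e22, h21, partialBid, partialBid,
        Finset.sum_range_succ]
    · simp [AExp.eval, write_of_ne, e16]
    · exact (hF₃'.write (by decide) _ _).write (by decide) _ _
    · simp [write_same]
    · simp [write_of_ne, write_same]
  · rintro M₁ ⟨hF, h16, -⟩
    have hH₁ := hH.frame hF (by decide) (by decide) (by decide)
    rw [eval_cell, h16, eval_get (k := 1) 0 (by simp [AExp.eval]), hH₁.values]
    exact lt_irrefl _

theorem bidLoop_run (hS : Short n V p m B N u) (hM : Bdd B M) (hH : Holds n V p m M)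
    (hi : M 14 0 = 0) (hu : ∀ i < n, M 6 i = u i) (h15 : M 15 0 = 0)
    (hnL : n ≤ L) (hmL : m ≤ L) :
    ∃ M', Run L B bidLoop M M' ∧ Frame [7, 14, 15, 16, 17, 18, 19, 20, 21, 22] M M' ∧
      (∀ i < n, M' 7 i = partialBid n V p u i m) ∧ M' 15 0 = partialGap n V p m u n := by
  have hb0 : bits (0 : ℚ) ≤ B := by exact_mod_cast hS.nat 0 (Nat.zero_le _)
  refine Exists.imp ?_ (Run.loop (L := L) (B := B) (M := M) (e := cell 14)
    (e' := .get 0 (.const 0)) (p := .seq (setCell 22 (.const 0)) (.seq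
    (setCell 16 (.const 0)) (.seq valueLoop (.seq
      (.assign 7 (cell 14) (cell 22)) (.seq
      (setCell 15 (.add (cell 15)
        (.div (.sub (cell 22) (.get 6 (cell 14))) (.get 6 (cell 14)))))
      (setCell 14 (.add (cell 14) (.const 1)))))))) (n := n)
    (fun i M₁ => Frame [7, 14, 15, 16, 17, 18, 19, 20, 21, 22] M M₁ ∧ M₁ 14 0 = (i : ℚ) ∧
      (∀ i' < i, M₁ 7 i' = partialBid n V p u i' m) ∧
      M₁ 15 0 = partialGap n V p m u i) hnL ?_ ?_ hM
    ⟨Frame.refl _ _, by simpa using hi, by simp, by simpa [partialGap] using h15⟩)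
  · exact fun M' ⟨hR, hF, _, h7, h⟩ => ⟨hR, hF, h7, h⟩
  · rintro i hi M₁ hM₁ ⟨hF, h14, h7, h15⟩
    have hH₁ := hH.frame hF (by decide) (by decide) (by decide)
    have hM₂ := (hM₁.write hb0 22 0).write hb0 16 0
    have hF₂ : Frame [7, 14, 15, 16, 17, 18, 19, 20, 21, 22] M
        (write (write M₁ 22 0 0) 16 0 0) :=
      (hF.write (by decide) _ _).write (by decide) _ _
    have hH₂ := hH.frame hF₂ (by decide) (by decide) (by decide)
    obtain ⟨M₃, hR₃, hF₃, h22⟩ := valueLoop_run (L := L) hS hM₂ hH₂ (i := i)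
      (by simp [write_of_ne, h14]) (by simp [write_same])
      (by rw [hF₂ 6 (by decide)]; exact hu) (by simp [write_same, write_of_ne]) hi hnL hmL
    have hF₃' := hF₂.trans (hF₃.mono (by decide))
    have e14 : M₃ 14 0 = i := by rw [hF₃ 14 (by decide)]; simp [write_of_ne, h14]
    have e15 : M₃ 15 0 = partialGap n V p m u i := by
      rw [hF₃ 15 (by decide)]; simp [write_of_ne, h15]
    have e7 : M₃ 7 = M₁ 7 := by
      rw [hF₃ 7 (by decide)]; simp [write_of_ne]
    have e6 : M₃ 6 i = u i := by
      rw [hF₃' 6 (by decide), hu i hi]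
    have hb := hS.bid i hi m le_rfl
    have hbg := hS.gap (i + 1) hi
    have hM₄ := hR₃.bdd.write hb 7 i
    refine ⟨?_, _, Run.seq (Run.setCell hM₁ (v := 0) (by simp [AExp.eval]) hb0)
      (Run.seq (Run.setCell (hM₁.write hb0 _ _) (v := 0) (by simp [AExp.eval]) hb0)
      (Run.seq hR₃ (Run.seq (Run.assign hR₃.bdd (k := i) (v := partialBid n V p u i m)
        (by rw [eval_cell, e14, Nat.floor_natCast]) (by rw [eval_cell, h22]) hb)
      (Run.seq (Run.setCell hM₄ (v := partialGap n V p m u (i + 1)) ?_ hbg)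
      (Run.setCell (hM₄.write hbg _ _) (v := ((i + 1 : ℕ) : ℚ)) ?_
        (hS.nat _ (by have := hS.agents_le; omega))))))), ?_, ?_, ?_, ?_⟩
    · rw [eval_cell, h14, eval_get (k := 0) 0 (by simp [AExp.eval]), hH₁.agents]
      exact_mod_cast hi
    · have e1 : (AExp.get 6 (cell 14)).eval (write M₃ 7 i (partialBid n V p u i m)) = u i := by
        rw [eval_get (k := i) 6 (by rw [eval_cell]; simp [write_of_ne, e14])]
        simp [write_of_ne, e6]
      rw [eval_add, eval_div, eval_sub, e1, eval_cell, eval_cell, partialGap,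
        Finset.sum_range_succ]
      simp [write_of_ne, e15, h22, partialGap]
    · simp [AExp.eval, write_of_ne, e14]
    · exact ((hF₃'.write (by decide) _ _).write (by decide) _ _).write (by decide) _ _
    · simp [write_same]
    · intro i' hi'
      have : write (write (write M₃ 7 i (partialBid n V p u i m)) 15 0
          (partialGap n V p m u (i + 1))) 14 0 ((i + 1 : ℕ) : ℚ) 7 i' =
          if i' = i then partialBid n V p u i m else M₁ 7 i' := by
        rw [write_of_ne _ (by decide), write_of_ne _ (by decide), write_same, e7]
      rw [this]
      split_ifs with h
      · rw [h]
      · exact h7 i' (by omega)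
    · simp [write_of_ne, write_same]
  · rintro M₁ ⟨hF, h14, -⟩
    have hH₁ := hH.frame hF (by decide) (by decide) (by decide)
    rw [eval_cell, h14, eval_get (k := 0) 0 (by simp [AExp.eval]), hH₁.agents]
    exact lt_irrefl _

end Runs

/-! ### One step of the iteration: coins, selection, update. -/

/-- Tosses `coinsPerStep` coins: `M 11 0` becomes the step size, and `M 12 0` the number of coins
that show one. -/
def coinLoop : Program :=
  .loop (.const 1) (.mul (cell 11) (.mul (.const 4) (.mul (.add (.get 0 (.const 0)) (.const 1))
      (.add (.get 0 (.const 0)) (.const 1)))))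
    (.seq (setCell 11 (.div (cell 11) (.const 2)))
      (.seq (setCell 12 (.add (cell 12) (.get 4 (cell 13))))
        (setCell 13 (.add (cell 13) (.const 1)))))

/-- Selects the agent with the highest priority among those with the largest value. -/
def select : Program :=
  .seq (setCell 5 (.const 0)) (.seq (setCell 14 (.const 1))
    (.loop (cell 14) (.get 0 (.const 0)) (.seq
      (.ite (.get 3 (cell 14)) (.get 3 (cell 5))
        (.ite (.get 3 (cell 5)) (.get 3 (cell 14))
          (.ite (.get 6 (cell 5)) (.get 6 (cell 14)) .skip (setCell 5 (cell 14)))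
          .skip)
        (setCell 5 (cell 14)))
      (setCell 14 (.add (cell 14) (.const 1))))))

/-- Moves the utilities towards those for the current priorities. -/
def moveLoop : Program :=
  .seq (setCell 14 (.const 0)) (.loop (cell 14) (.get 0 (.const 0)) (.seq
    (.assign 6 (cell 14) (.add (.get 6 (cell 14))
      (.mul (cell 11) (.sub (.get 7 (cell 14)) (.get 6 (cell 14))))))
    (setCell 14 (.add (cell 14) (.const 1)))))

/-- Adopts the current priorities, with the probability that is the step size. -/
def adopt : Program := .seq (.ite (cell 12) (.const 0) select .skip) moveLoop

/-- One step of the iteration. -/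
def stepBody : Program :=
  .seq (.assign 6 (cell 10) (.const 0)) (.seq (setCell 11 (.const 1)) (.seq
    (setCell 12 (.const 0)) (.seq coinLoop (.seq (setCell 15 (.const 0)) (.seq
    (setCell 14 (.const 0)) (.seq bidLoop (.seq
    (.ite (.get 0 (.const 0)) (cell 10) (.ite (cell 15) (.const (1 / 2)) .skip adopt) adopt)
    (setCell 10 (.add (cell 10) (.const 1))))))))))

section Runs

variable {n m L B N : ℕ} {V : ℕ → ℚ} {p : ℕ → ℕ → ℚ} {u A : ℕ → ℚ} {c : ℕ → Bool} {M : Memory}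

/-- The value of a coin. -/
def coinValue (b : Bool) : ℕ := if b then 1 else 0

theorem sum_coinValue_le (c : ℕ → Bool) (s r : ℕ) :
    ∑ k ∈ Finset.range r, coinValue (c (s + k)) ≤ r := by
  calc ∑ k ∈ Finset.range r, coinValue (c (s + k)) ≤ ∑ _k ∈ Finset.range r, 1 :=
        Finset.sum_le_sum fun k _ => by unfold coinValue; split_ifs <;> omega
    _ = r := by simp

theorem eval_agents {M : Memory} (hM : M 0 0 = n) : (AExp.get 0 (.const 0)).eval M = n := by
  rw [eval_get (k := 0) 0 (by simp [AExp.eval]), hM]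

theorem coinLoop_run (hn : ∀ x : ℕ, x ≤ N → bits (x : ℚ) ≤ B)
    (hq : ∀ r ≤ coinsPerStep n, bits ((1 / 2 : ℚ) ^ r) ≤ B) (hM : Bdd B M) (h0 : M 0 0 = n)
    {s : ℕ} (h11 : M 11 0 = 1) (h12 : M 12 0 = 0) (h13 : M 13 0 = s)
    (hc : ∀ k < coinsPerStep n, M 4 (s + k) = (coinValue (c (s + k)) : ℕ))
    (hsN : s + coinsPerStep n ≤ N) (hL : coinsPerStep n ≤ L) :
    ∃ M', Run L B coinLoop M M' ∧ Frame [11, 12, 13] M M' ∧ M' 11 0 = rate ℚ n ∧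
      M' 12 0 = (∑ k ∈ Finset.range (coinsPerStep n), coinValue (c (s + k)) : ℕ) ∧
      M' 13 0 = (s + coinsPerStep n : ℕ) := by
  -- After `r` halvings the test reads `2 ^ r < 4 * (n + 1) ^ 2`, which is the defining property of
  -- `Nat.clog`; thus the loop finds the number of coins without computing a logarithm.
  have hcond : ∀ M₁ : Memory, ∀ r, M₁ 0 0 = n → M₁ 11 0 = (1 / 2 : ℚ) ^ r →
      ((AExp.const 1).eval M₁ < (AExp.mul (cell 11) (.mul (.const 4)
        (.mul (.add (.get 0 (.const 0)) (.const 1))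
        (.add (.get 0 (.const 0)) (.const 1))))).eval M₁ ↔ r < coinsPerStep n) := by
    intro M₁ r h0 h11
    have e1 : (AExp.mul (cell 11) (.mul (.const 4) (.mul (.add (.get 0 (.const 0)) (.const 1))
        (.add (.get 0 (.const 0)) (.const 1))))).eval M₁ =
        (4 * (n + 1) ^ 2 : ℚ) / 2 ^ r := by
      simp only [AExp.eval, Nat.floor_zero, h0, h11]
      rw [one_div, inv_pow]; ring
    rw [e1, AExp.eval, lt_div_iff₀ (by positivity), one_mul, coinsPerStep,
      Nat.lt_clog_iff_pow_lt one_lt_two]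
    norm_cast
  refine Exists.imp ?_ (Run.loop (L := L) (B := B) (M := M) (e := .const 1)
    (e' := .mul (cell 11) (.mul (.const 4) (.mul (.add (.get 0 (.const 0)) (.const 1))
      (.add (.get 0 (.const 0)) (.const 1)))))
    (p := .seq (setCell 11 (.div (cell 11) (.const 2)))
      (.seq (setCell 12 (.add (cell 12) (.get 4 (cell 13))))
        (setCell 13 (.add (cell 13) (.const 1))))) (n := coinsPerStep n)
    (fun r M₁ => Frame [11, 12, 13] M M₁ ∧ M₁ 11 0 = (1 / 2 : ℚ) ^ r ∧
      M₁ 12 0 = (∑ k ∈ Finset.range r, coinValue (c (s + k)) : ℕ) ∧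
      M₁ 13 0 = (s + r : ℕ)) hL ?_ ?_ hM ⟨Frame.refl _ _, by simpa using h11,
        by simpa using h12, by simpa using h13⟩)
  · exact fun M' ⟨hR, hF, h11, h12, h13⟩ => ⟨hR, hF, h11, h12, h13⟩
  · rintro r hr M₁ hM₁ ⟨hF, h11, h12, h13⟩
    have e0 : M₁ 0 0 = n := by rw [hF 0 (by decide), h0]
    have hb1 := hq (r + 1) hr
    have hb2 := hn (∑ k ∈ Finset.range (r + 1), coinValue (c (s + k)))
      ((sum_coinValue_le c s _).trans (by omega))
    have hb3 := hn (s + (r + 1)) (by omega)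
    have e4 : M₁ 4 (s + r) = (coinValue (c (s + r)) : ℕ) := by rw [hF 4 (by decide), hc r hr]
    refine ⟨(hcond M₁ r e0 h11).2 hr, _, Run.seq (Run.setCell hM₁ (v := (1 / 2) ^ (r + 1)) ?_ hb1)
      (Run.seq (Run.setCell (hM₁.write hb1 _ _)
        (v := ((∑ k ∈ Finset.range (r + 1), coinValue (c (s + k)) : ℕ) : ℚ)) ?_ hb2)
      (Run.setCell ((hM₁.write hb1 _ _).write hb2 _ _) (v := ((s + (r + 1) : ℕ) : ℚ)) ?_ hb3)),
      ?_, ?_, ?_, ?_⟩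
    · rw [eval_div, eval_cell, h11, AExp.eval, pow_succ]; ring
    · have e5 : (AExp.get 4 (cell 13)).eval (write M₁ 11 0 ((1 / 2) ^ (r + 1))) =
          (coinValue (c (s + r)) : ℕ) := by
        rw [eval_get (k := s + r) 4 (by rw [eval_cell, write_of_ne _ (by decide), h13]),
          write_of_ne _ (by decide), e4]
      rw [eval_add, e5, eval_cell, write_of_ne _ (by decide), h12, Finset.sum_range_succ,
        Nat.cast_add]
    · rw [eval_add, eval_cell, write_of_ne _ (by decide), write_of_ne _ (by decide), h13,
        AExp.eval]
      push_cast; ring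
    · exact ((hF.write (by decide) _ _).write (by decide) _ _).write (by decide) _ _
    · simp [write_same, write_of_ne]
    · rw [write_of_ne _ (by decide), write_same, if_pos rfl]
    · rw [write_same, if_pos rfl]
  · rintro M₁ ⟨hF, h11, -⟩
    have e0 : M₁ 0 0 = n := by rw [hF 0 (by decide), h0]
    rw [hcond M₁ _ e0 h11]
    exact lt_irrefl _

/-- Agent `r` has the highest priority among the agents before `k` with the largest value. -/
def IsTopBelow (u A : ℕ → ℚ) (k r : ℕ) : Prop :=
  r < k ∧ ∀ s < k, s ≠ r → A s < A r ∨ A s = A r ∧ (u r < u s ∨ u r = u s ∧ r < s)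

theorem select_run (hn : ∀ x : ℕ, x ≤ N → bits (x : ℚ) ≤ B) (hM : Bdd B M) (h0 : M 0 0 = n)
    (hA : ∀ i < n, M 3 i = A i) (hu : ∀ i < n, M 6 i = u i) (hnp : 0 < n) (hnN : n ≤ N)
    (hnL : n ≤ L) :
    ∃ M', Run L B select M M' ∧ Frame [5, 14] M M' ∧
      ∃ r : ℕ, M' 5 0 = r ∧ IsTopBelow u A n r := by
  have hb0 : bits (0 : ℚ) ≤ B := by exact_mod_cast hn 0 (Nat.zero_le _)
  have hb1 : bits (1 : ℚ) ≤ B := by exact_mod_cast hn 1 (by omega)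
  have hM₀ := (hM.write hb0 5 0).write hb1 14 0
  have key : ∃ M', Run L B (.loop (cell 14) (.get 0 (.const 0)) (.seq
      (.ite (.get 3 (cell 14)) (.get 3 (cell 5))
        (.ite (.get 3 (cell 5)) (.get 3 (cell 14))
          (.ite (.get 6 (cell 5)) (.get 6 (cell 14)) .skip (setCell 5 (cell 14)))
          .skip)
        (setCell 5 (cell 14)))
      (setCell 14 (.add (cell 14) (.const 1))))) (write (write M 5 0 0) 14 0 1) M' ∧
      (Frame [5, 14] M M' ∧ M' 14 0 = (n - 1 + 1 : ℕ) ∧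
        ∃ r : ℕ, M' 5 0 = r ∧ IsTopBelow u A (n - 1 + 1) r) := by
    -- Agent 0 is the initial candidate and the counter starts at 1, so after `k` iterations the
    -- candidate is best among the first `k + 1` agents.
    refine Run.loop (n := n - 1) (fun k M₁ => Frame [5, 14] M M₁ ∧ M₁ 14 0 = (k + 1 : ℕ) ∧
      ∃ r : ℕ, M₁ 5 0 = r ∧ IsTopBelow u A (k + 1) r) (by omega) ?_ ?_ hM₀ ?_
    · rintro k hk M₁ hM₁ ⟨hF, h14, r, h5, hr, htop⟩
      have e0 : M₁ 0 0 = n := by rw [hF 0 (by decide), h0]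
      have hkn : k + 1 < n := by omega
      have hrn : r < n := by omega
      have eA1 : (AExp.get 3 (cell 14)).eval M₁ = A (k + 1) := by
        rw [eval_get (k := k + 1) 3 (by rw [eval_cell, h14]), hF 3 (by decide), hA _ hkn]
      have eA2 : (AExp.get 3 (cell 5)).eval M₁ = A r := by
        rw [eval_get (k := r) 3 (by rw [eval_cell, h5]), hF 3 (by decide), hA _ hrn]
      have eu1 : (AExp.get 6 (cell 14)).eval M₁ = u (k + 1) := by
        rw [eval_get (k := k + 1) 6 (by rw [eval_cell, h14]), hF 6 (by decide), hu _ hkn]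
      have eu2 : (AExp.get 6 (cell 5)).eval M₁ = u r := by
        rw [eval_get (k := r) 6 (by rw [eval_cell, h5]), hF 6 (by decide), hu _ hrn]
      have hbk := hn (k + 1) (by omega)
      have hbk2 := hn (k + 1 + 1) (by omega)
      refine ⟨by rw [eval_cell, eval_agents e0, h14]; exact_mod_cast hkn, ?_⟩
      have hset : Run L B (setCell 5 (cell 14)) M₁ (write M₁ 5 0 ((k + 1 : ℕ) : ℚ)) :=
        Run.setCell hM₁ (by rw [eval_cell, h14]) hbk
      have hincr : ∀ M₂ : Memory, Bdd B M₂ → M₂ 14 0 = (k + 1 : ℕ) →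
          Run L B (setCell 14 (.add (cell 14) (.const 1))) M₂
            (write M₂ 14 0 ((k + 1 + 1 : ℕ) : ℚ)) := fun M₂ hM₂ h => Run.setCell hM₂
        (by rw [eval_add, eval_cell, h, AExp.eval]; push_cast; ring) hbk2
      have hset14 : write M₁ 5 0 ((k + 1 : ℕ) : ℚ) 14 0 = (k + 1 : ℕ) := by
        rw [write_of_ne _ (by decide), h14]
      have hnew : ∀ s : ℕ, (∀ s' ≤ k, s' ≠ r → A s' < A r ∨
            A s' = A r ∧ (u r < u s' ∨ u r = u s' ∧ r < s')) → s = k + 1 →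
          (A r < A s ∨ A r = A s ∧ u s < u r) → IsTopBelow u A (k + 1 + 1) s := by
        rintro s htop rfl hlt
        refine ⟨by omega, fun s' hs' hne => ?_⟩
        by_cases hs'r : s' = r
        · subst hs'r
          exact hlt.imp id fun h => ⟨h.1, Or.inl h.2⟩
        · rcases htop s' (by omega) hs'r with h1 | ⟨h1, h2⟩
          · exact Or.inl (hlt.elim h1.trans fun h => h1.trans_eq h.1)
          · rcases hlt with h | ⟨h, h'⟩
            · exact Or.inl (h1 ▸ h)
            · refine Or.inr ⟨h1.trans h, Or.inl ?_⟩
              rcases h2 with h2 | ⟨h2, -⟩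
              · exact h'.trans h2
              · exact h2 ▸ h'
      have hold : ∀ (_ : A (k + 1) < A r ∨ A (k + 1) = A r ∧ u r ≤ u (k + 1)),
          IsTopBelow u A (k + 1 + 1) r := by
        intro hle
        refine ⟨by omega, fun s hs hne => ?_⟩
        by_cases hsk : s = k + 1
        · subst hsk
          refine hle.imp id fun h => ⟨h.1, h.2.lt_or_eq.imp id fun h => ⟨h, by omega⟩⟩
        · exact htop s (by omega) hne
      have htop' : ∀ s' ≤ k, s' ≠ r → A s' < A r ∨
          A s' = A r ∧ (u r < u s' ∨ u r = u s' ∧ r < s') := fun s' hs' => htop s' (by omega)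
      by_cases h1 : A (k + 1) ≤ A r
      · by_cases h2 : A r ≤ A (k + 1)
        · by_cases h3 : u r ≤ u (k + 1)
          · refine ⟨_, Run.seq (Run.ite_true hM₁ (by rw [eA1, eA2]; exact h1)
              (Run.ite_true hM₁ (by rw [eA1, eA2]; exact h2)
              (Run.ite_true hM₁ (by rw [eu1, eu2]; exact h3) (Run.skip hM₁))))
              (hincr _ hM₁ h14), hF.write (by decide) _ _, by rw [write_same, if_pos rfl], r,
              by rw [write_of_ne _ (by decide), h5], hold (Or.inr ⟨le_antisymm h1 h2, h3⟩)⟩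
          · refine ⟨_, Run.seq (Run.ite_true hM₁ (by rw [eA1, eA2]; exact h1)
              (Run.ite_true hM₁ (by rw [eA1, eA2]; exact h2)
              (Run.ite_false hM₁ (by rw [eu1, eu2]; exact h3) hset)))
              (hincr _ hset.bdd hset14), (hF.write (by decide) _ _).write (by decide) _ _,
              by rw [write_same, if_pos rfl], k + 1,
              by rw [write_of_ne _ (by decide), write_same, if_pos rfl],
              hnew _ htop' rfl (Or.inr ⟨le_antisymm h2 h1, not_le.1 h3⟩)⟩
        · refine ⟨_, Run.seq (Run.ite_true hM₁ (by rw [eA1, eA2]; exact h1)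
            (Run.ite_false hM₁ (by rw [eA1, eA2]; exact h2) (Run.skip hM₁)))
            (hincr _ hM₁ h14), hF.write (by decide) _ _, by rw [write_same, if_pos rfl], r,
            by rw [write_of_ne _ (by decide), h5], hold (Or.inl (not_le.1 h2))⟩
      · refine ⟨_, Run.seq (Run.ite_false hM₁ (by rw [eA1, eA2]; exact h1) hset)
          (hincr _ hset.bdd hset14), (hF.write (by decide) _ _).write (by decide) _ _,
          by rw [write_same, if_pos rfl], k + 1,
          by rw [write_of_ne _ (by decide), write_same, if_pos rfl],
          hnew _ htop' rfl (Or.inl (not_le.1 h1))⟩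
    · rintro M₁ ⟨hF, h14, -⟩
      have e0 : M₁ 0 0 = n := by rw [hF 0 (by decide), h0]
      rw [eval_cell, eval_agents e0, h14, Nat.sub_add_cancel hnp]
      exact lt_irrefl _
    · refine ⟨((Frame.refl _ M).write (by decide) _ _).write (by decide) _ _,
        by simp [write_same], 0, by simp [write_same, write_of_ne], by omega, ?_⟩
      intro s hs hne
      omega
  obtain ⟨M', hR, hF, -, r, h5, hr⟩ := key
  rw [Nat.sub_add_cancel hnp] at hr
  exact ⟨M', Run.seq (Run.setCell hM (v := 0) (by simp [AExp.eval]) hb0)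
    (Run.seq (Run.setCell (hM.write hb0 _ _) (v := 1) (by simp [AExp.eval]) hb1) hR), hF, r, h5, hr⟩

theorem moveLoop_run {b : ℕ → ℚ} {q : ℚ} (hn : ∀ x : ℕ, x ≤ N → bits (x : ℚ) ≤ B)
    (hM : Bdd B M) (h0 : M 0 0 = n) (hu : ∀ i < n, M 6 i = u i) (hb : ∀ i < n, M 7 i = b i)
    (hq : M 11 0 = q) (hbits : ∀ i < n, bits (u i + q * (b i - u i)) ≤ B) (hnN : n ≤ N)
    (hnL : n ≤ L) :
    ∃ M', Run L B moveLoop M M' ∧ Frame [6, 14] M M' ∧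
      ∀ i < n, M' 6 i = u i + q * (b i - u i) := by
  have hb0 : bits (0 : ℚ) ≤ B := by exact_mod_cast hn 0 (Nat.zero_le _)
  have key : ∃ M', Run L B (.loop (cell 14) (.get 0 (.const 0)) (.seq
    (.assign 6 (cell 14) (.add (.get 6 (cell 14))
      (.mul (cell 11) (.sub (.get 7 (cell 14)) (.get 6 (cell 14))))))
    (setCell 14 (.add (cell 14) (.const 1))))) (write M 14 0 0) M' ∧
      (Frame [6, 14] M M' ∧ M' 14 0 = n ∧
        ∀ i < n, M' 6 i = if i < n then u i + q * (b i - u i) else u i) := by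
    refine Run.loop (n := n) (fun k M₁ => Frame [6, 14] M M₁ ∧ M₁ 14 0 = k ∧
        ∀ i < n, M₁ 6 i = if i < k then u i + q * (b i - u i) else u i) hnL ?_ ?_
      (hM.write hb0 _ _) ?_
    · rintro k hk M₁ hM₁ ⟨hF, h14, h6⟩
      have e0 : M₁ 0 0 = n := by rw [hF 0 (by decide), h0]
      have e6 : (AExp.get 6 (cell 14)).eval M₁ = u k := by
        rw [eval_get (k := k) 6 (by rw [eval_cell, h14]), h6 k hk, if_neg (lt_irrefl k)]
      have e7 : (AExp.get 7 (cell 14)).eval M₁ = b k := by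
        rw [eval_get (k := k) 7 (by rw [eval_cell, h14]), hF 7 (by decide), hb k hk]
      have e11 : (cell 11).eval M₁ = q := by rw [eval_cell, hF 11 (by decide), hq]
      have hbk := hbits k hk
      refine ⟨by rw [eval_cell, eval_agents e0, h14]; exact_mod_cast hk, _,
        Run.seq (Run.assign hM₁ (k := k) (v := u k + q * (b k - u k))
          (by rw [eval_cell, h14, Nat.floor_natCast])
          (by rw [eval_add, eval_mul, eval_sub, e6, e7, e11]) hbk)
        (Run.setCell (hM₁.write hbk _ _) (v := ((k + 1 : ℕ) : ℚ)) ?_ (hn _ (by omega))),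
        (hF.write (by decide) _ _).write (by decide) _ _, by rw [write_same, if_pos rfl], ?_⟩
      · rw [eval_add, eval_cell, write_of_ne _ (by decide), h14, AExp.eval]
        push_cast; ring
      · intro i hi
        rw [write_of_ne _ (by decide), write_same]
        split_ifs with h1 h2 h2
        · rw [h1]
        · omega
        · rw [h6 i hi, if_pos (by omega)]
        · rw [h6 i hi, if_neg (by omega)]
    · rintro M₁ ⟨hF, h14, -⟩
      have e0 : M₁ 0 0 = n := by rw [hF 0 (by decide), h0]
      rw [eval_cell, eval_agents e0, h14]
      exact lt_irrefl _
    · refine ⟨(Frame.refl _ M).write (by decide) _ _, by simp [write_same], fun i hi => ?_⟩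
      rw [write_of_ne _ (by decide), hu i hi]
      simp
  obtain ⟨M', hR, hF, -, h6⟩ := key
  exact ⟨M', Run.seq (Run.setCell hM (v := 0) (by simp [AExp.eval]) hb0) hR, hF,
    fun i hi => by rw [h6 i hi, if_pos hi]⟩

theorem adopt_run {b : ℕ → ℚ} {q : ℚ} {x : ℕ} (hn : ∀ x : ℕ, x ≤ N → bits (x : ℚ) ≤ B)
    (hM : Bdd B M) (h0 : M 0 0 = n) (hA : ∀ i < n, M 3 i = A i) (hu : ∀ i < n, M 6 i = u i)
    (hb : ∀ i < n, M 7 i = b i) (hx : M 12 0 = x)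
    (hq : M 11 0 = q) (hbits : ∀ i < n, bits (u i + q * (b i - u i)) ≤ B) (hnp : 0 < n)
    (hnN : n ≤ N) (hnL : n ≤ L) :
    ∃ M', Run L B adopt M M' ∧ Frame [5, 6, 14] M M' ∧
      (∀ i < n, M' 6 i = u i + q * (b i - u i)) ∧
      (x = 0 → ∃ r : ℕ, M' 5 0 = r ∧ IsTopBelow u A n r) ∧ (x ≠ 0 → M' 5 = M 5) := by
  have hsel : ∃ M₁, Run L B (.ite (cell 12) (.const 0) select .skip) M M₁ ∧ Frame [5, 14] M M₁ ∧
      (x = 0 → ∃ r : ℕ, M₁ 5 0 = r ∧ IsTopBelow u A n r) ∧ (x ≠ 0 → M₁ 5 = M 5) := by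
    by_cases hx0 : x = 0
    · obtain ⟨M₁, hR, hF, hr⟩ := select_run (L := L) hn hM h0 hA hu hnp hnN hnL
      exact ⟨M₁, Run.ite_true hM (by rw [eval_cell, hx, hx0]; simp [AExp.eval]) hR, hF,
        fun _ => hr, fun h => absurd hx0 h⟩
    · refine ⟨M, Run.ite_false hM ?_ (Run.skip hM), Frame.refl _ _, fun h => absurd h hx0,
        fun _ => rfl⟩
      rw [eval_cell, hx, AExp.eval]
      exact_mod_cast (by omega : ¬ x ≤ 0)
  obtain ⟨M₁, hR₁, hF₁, hs, hs'⟩ := hsel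
  obtain ⟨M₂, hR₂, hF₂, h6⟩ := moveLoop_run (L := L) (q := q) (b := b) (u := u) hn hR₁.bdd
    (by rw [hF₁ 0 (by decide), h0]) (by rw [hF₁ 6 (by decide)]; exact hu)
    (by rw [hF₁ 7 (by decide)]; exact hb) (by rw [hF₁ 11 (by decide), hq]) hbits hnN hnL
  have h5 : M₂ 5 = M₁ 5 := hF₂ 5 (by decide)
  exact ⟨M₂, Run.seq hR₁ hR₂, (hF₁.mono (by decide)).trans (hF₂.mono (by decide)), h6,
    by rw [h5]; exact hs, by rw [h5]; exact hs'⟩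

/-- Coins are tossed before the test for freezing, so that step `t` always reads the block of coins
starting at `t * coinsPerStep n`. The two last conclusions are the branches of `track` and
`selAgent`. -/
theorem stepBody_run {t : ℕ} {v : ℕ → ℚ} (hv : ∀ i < n, v i = if i = t then 0 else u i)
    (hS : Short n V p m B N v)
    (hq : ∀ r ≤ coinsPerStep n, bits ((1 / 2 : ℚ) ^ r) ≤ B)
    (hbits : ∀ i < n, bits (v i + rate ℚ n * (partialBid n V p v i m - v i)) ≤ B)
    (hM : Bdd B M) (hH : Holds n V p m M) (hA : ∀ i < n, M 3 i = A i)
    (hu : ∀ i < n, M 6 i = u i) (ht : M 10 0 = t) (hpos : M 13 0 = (t * coinsPerStep n : ℕ))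
    (hc : ∀ k < coinsPerStep n,
      M 4 (t * coinsPerStep n + k) = (coinValue (c (t * coinsPerStep n + k)) : ℕ))
    (hnp : 0 < n) (htN : t + 1 ≤ N) (hsN : t * coinsPerStep n + coinsPerStep n ≤ N)
    (hgL : coinsPerStep n ≤ L) (hnL : n ≤ L) (hmL : m ≤ L) :
    ∃ M', Run L B stepBody M M' ∧
      Frame [5, 6, 7, 10, 11, 12, 13, 14, 15, 16, 17, 18, 19, 20, 21, 22] M M' ∧
      M' 10 0 = (t + 1 : ℕ) ∧ M' 13 0 = ((t + 1) * coinsPerStep n : ℕ) ∧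
      ((n ≤ t ∧ partialGap n V p m v n ≤ 1 / 2) → M' 5 = M 5 ∧ ∀ i < n, M' 6 i = v i) ∧
      (¬ (n ≤ t ∧ partialGap n V p m v n ≤ 1 / 2) →
        (∀ i < n, M' 6 i = v i + rate ℚ n * (partialBid n V p v i m - v i)) ∧
        ((∀ k < coinsPerStep n, c (t * coinsPerStep n + k) = false) →
          ∃ r : ℕ, M' 5 0 = r ∧ IsTopBelow v A n r) ∧
        (¬ (∀ k < coinsPerStep n, c (t * coinsPerStep n + k) = false) → M' 5 = M 5)) := by
  have hn := hS.nat
  have hnN := hS.agents_le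
  have hb0 : bits (0 : ℚ) ≤ B := by exact_mod_cast hn 0 (Nat.zero_le _)
  have hb1 : bits (1 : ℚ) ≤ B := by exact_mod_cast hn 1 (by omega)
  set W := [5, 6, 7, 10, 11, 12, 13, 14, 15, 16, 17, 18, 19, 20, 21, 22] with hW
  -- For `t ≥ n` this reset lands beyond the entries of the agents, as in `reset`, where it then has
  -- no effect.
  have hM₁ := hM.write hb0 6 t
  have hM₂ := hM₁.write hb1 11 0
  have hM₃ := hM₂.write hb0 12 0
  have hF₃ : Frame [6, 11, 12] M (write (write (write M 6 t 0) 11 0 1) 12 0 0) :=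
    (((Frame.refl _ M).write (by decide) _ _).write (by decide) _ _).write (by decide) _ _
  have h6₃ : ∀ i < n, write (write (write M 6 t 0) 11 0 1) 12 0 0 6 i = v i := by
    intro i hi
    rw [write_of_ne _ (by decide), write_of_ne _ (by decide), write_same, hv i hi, hu i hi]
  set M₃ := write (write (write M 6 t 0) 11 0 1) 12 0 0 with hM₃'
  obtain ⟨M₄, hR₄, hF₄, h11, h12, h13⟩ := coinLoop_run (L := L) (c := c) hn hq hM₃
    (by rw [hF₃ 0 (by decide), hH.agents]) (s := t * coinsPerStep n)
    (by simp [hM₃', write_same, write_of_ne]) (by simp [hM₃', write_same])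
    (by rw [hF₃ 13 (by decide), hpos]) (by rw [hF₃ 4 (by decide)]; exact hc) hsN hgL
  have hM₆ := (hR₄.bdd.write hb0 15 0).write hb0 14 0
  have hF₆ : Frame [14, 15] M₄ (write (write M₄ 15 0 0) 14 0 0) :=
    ((Frame.refl _ M₄).write (by decide) _ _).write (by decide) _ _
  have hFM₆ : Frame W M (write (write M₄ 15 0 0) 14 0 0) :=
    ((hF₃.mono (by decide)).trans (hF₄.mono (by decide))).trans (hF₆.mono (by decide))
  have h14 : write (write M₄ 15 0 0) 14 0 0 14 0 = 0 := by simp [write_same]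
  have h15 : write (write M₄ 15 0 0) 14 0 0 15 0 = 0 := by simp [write_same, write_of_ne]
  obtain ⟨M₇, hR₇, hF₇, h7, h15⟩ := bidLoop_run (L := L) hS hM₆
    (hH.frame hFM₆ (by decide) (by decide) (by decide)) h14
    (by rw [hF₆ 6 (by decide), hF₄ 6 (by decide)]; exact h6₃) h15 hnL hmL
  have hFM₇ : Frame W M M₇ := hFM₆.trans (hF₇.mono (by decide))
  have e0 : M₇ 0 0 = n := by rw [hFM₇ 0 (by decide), hH.agents]
  have e5 : M₇ 5 = M 5 := by
    rw [hF₇ 5 (by decide), hF₆ 5 (by decide), hF₄ 5 (by decide), hF₃ 5 (by decide)]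
  have e6 : ∀ i < n, M₇ 6 i = v i := by
    rw [hF₇ 6 (by decide), hF₆ 6 (by decide), hF₄ 6 (by decide)]; exact h6₃
  have e10 : M₇ 10 0 = t := by
    rw [hF₇ 10 (by decide), hF₆ 10 (by decide), hF₄ 10 (by decide), hF₃ 10 (by decide), ht]
  have e13 : M₇ 13 0 = ((t + 1) * coinsPerStep n : ℕ) := by
    rw [hF₇ 13 (by decide), hF₆ 13 (by decide), h13]
    congr 1; ring
  obtain ⟨M₈, hR₈, hF₈, h6₈, hs, hs'⟩ := adopt_run (L := L) (A := A) (u := v) (q := rate ℚ n)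
    (b := fun i => partialBid n V p v i m)
    (x := ∑ k ∈ Finset.range (coinsPerStep n), coinValue (c (t * coinsPerStep n + k))) hn hR₇.bdd
    e0 (by rw [hFM₇ 3 (by decide)]; exact hA) e6 h7
    (by rw [hF₇ 12 (by decide), hF₆ 12 (by decide), h12])
    (by rw [hF₇ 11 (by decide), hF₆ 11 (by decide), h11]) hbits hnp hnN hnL
  have hx : (∑ k ∈ Finset.range (coinsPerStep n), coinValue (c (t * coinsPerStep n + k)) = 0) ↔
      ∀ k < coinsPerStep n, c (t * coinsPerStep n + k) = false := by
    rw [Finset.sum_eq_zero_iff]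
    refine forall_congr' fun k => ?_
    rw [Finset.mem_range]
    refine imp_congr Iff.rfl ?_
    unfold coinValue
    cases c (t * coinsPerStep n + k) <;> simp
  have hstart : ∀ q M', Run L B q M₇ M' → Run L B (.seq (.assign 6 (cell 10) (.const 0))
      (.seq (setCell 11 (.const 1)) (.seq (setCell 12 (.const 0)) (.seq coinLoop
      (.seq (setCell 15 (.const 0)) (.seq (setCell 14 (.const 0)) (.seq bidLoop q))))))) M M' :=
    fun q M' hq => Run.seq (Run.assign hM (k := t) (v := 0)
        (by rw [eval_cell, ht, Nat.floor_natCast]) rfl hb0)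
      (Run.seq (Run.setCell hM₁ (v := 1) rfl hb1)
      (Run.seq (Run.setCell hM₂ (v := 0) rfl hb0)
      (Run.seq hR₄ (Run.seq (Run.setCell hR₄.bdd (v := 0) rfl hb0)
      (Run.seq (Run.setCell (hR₄.bdd.write hb0 _ _) (v := 0) rfl hb0) (Run.seq hR₇ hq))))))
  have hend : ∀ M₉ : Memory, Bdd B M₉ → M₉ 10 0 = t →
      Run L B (setCell 10 (.add (cell 10) (.const 1))) M₉ (write M₉ 10 0 ((t + 1 : ℕ) : ℚ)) :=
    fun M₉ hM₉ h => Run.setCell hM₉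
      (by rw [eval_add, eval_cell, h, AExp.eval]; push_cast; ring) (hn _ htN)
  have hcn : (AExp.get 0 (.const 0)).eval M₇ ≤ (cell 10).eval M₇ ↔ n ≤ t := by
    rw [eval_agents e0, eval_cell, e10]; exact Nat.cast_le
  have hcg : (cell 15).eval M₇ ≤ (AExp.const (1 / 2)).eval M₇ ↔
      partialGap n V p m v n ≤ 1 / 2 := by
    rw [eval_cell, h15, AExp.eval]
  by_cases hfr : n ≤ t ∧ partialGap n V p m v n ≤ 1 / 2
  · refine ⟨_, hstart _ _ (Run.seq (Run.ite_true hR₇.bdd (hcn.2 hfr.1)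
      (Run.ite_true hR₇.bdd (hcg.2 hfr.2) (Run.skip hR₇.bdd))) (hend _ hR₇.bdd e10)),
      hFM₇.write (by decide) _ _, by rw [write_same, if_pos rfl],
      by rw [write_of_ne _ (by decide), e13], fun _ => ⟨?_, ?_⟩, fun h => absurd hfr h⟩
    · rw [write_of_ne _ (by decide), e5]
    · rw [write_of_ne _ (by decide)]; exact e6
  · have hR₉ : Run L B (.ite (.get 0 (.const 0)) (cell 10)
        (.ite (cell 15) (.const (1 / 2)) .skip adopt) adopt) M₇ M₈ := by
      by_cases h1 : n ≤ t
      · exact Run.ite_true hR₇.bdd (hcn.2 h1)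
          (Run.ite_false hR₇.bdd (fun h => hfr ⟨h1, hcg.1 h⟩) hR₈)
      · exact Run.ite_false hR₇.bdd (fun h => h1 (hcn.1 h)) hR₈
    refine ⟨_, hstart _ _ (Run.seq hR₉ (hend _ hR₈.bdd (by rw [hF₈ 10 (by decide), e10]))),
      (hFM₇.trans (hF₈.mono (by decide))).write (by decide) _ _, by rw [write_same, if_pos rfl],
      by rw [write_of_ne _ (by decide), hF₈ 13 (by decide), e13], fun h => absurd h hfr,
      fun _ => ⟨?_, ?_, ?_⟩⟩
    · rw [write_of_ne _ (by decide)]; exact h6₈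
    · rw [write_of_ne _ (by decide)]; exact fun h => hs (hx.2 h)
    · rw [write_of_ne _ (by decide), ← e5]; exact fun h => hs' fun h' => h (hx.1 h')

end Runs

/-! ### The program on a market -/

/-- A vector, extended by zeros. -/
def extend {n : ℕ} (u : Fin n → ℚ) (i : ℕ) : ℚ := if h : i < n then u ⟨i, h⟩ else 0

theorem extend_of_lt {n : ℕ} (u : Fin n → ℚ) {i : ℕ} (h : i < n) : extend u i = u ⟨i, h⟩ :=
  dif_pos h

theorem extend_val {n : ℕ} (u : Fin n → ℚ) (i : Fin n) : extend u i.val = u i :=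
  extend_of_lt u i.2

theorem extend_reset {n : ℕ} (u : Fin n → ℚ) (t i : ℕ) :
    extend (reset t u) i = if i = t then 0 else extend u i := by
  unfold extend reset
  split_ifs <;> rfl

/-- The coins, extended by zeros. -/
def extendCoins {ℓ : ℕ} (c : Fin ℓ → Bool) (k : ℕ) : Bool := if h : k < ℓ then c ⟨k, h⟩ else false

section Market

variable {n m : ℕ} (I : Market ℚ n m)

/-- The probabilities, extended by zeros. -/
def extendProb (k l : ℕ) : ℚ := if h : k < n then extend (I.prob ⟨k, h⟩) l else 0

theorem extendProb_val (k : Fin n) (l : Fin m) : extendProb I k l = I.prob k l := by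
  simp [extendProb, extend]

/-- The allowed value indices form an interval: `{j}` for the selected agent, those below `j` for
agents ahead of it, those up to `j` for the rest. -/
theorem factor_eq (u : Fin n → ℚ) (i k : Fin n) (j : Fin m)
    [∀ l, Decidable (Allowed u i j k l)] :
    factor (extendProb I) (extend u) i j k = ∑ l, if Allowed u i j k l then I.prob k l else 0 := by
  have hmem : ∀ l : Fin m, l.val ∈ Finset.Ico (loIndex i j k) (hiIndex (extend u) i j k) ↔
      Allowed u i j k l := by
    intro l
    have hc : (extend u k.val < extend u i.val ∨ (extend u k.val = extend u i.val ∧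
        k.val < i.val)) ↔ Ahead u k i := by
      simp only [extend_val]; rfl
    rw [Finset.mem_Ico]
    unfold Allowed
    rcases ahead_trichotomy u k i with h | h | h
    · have h1 : loIndex i j k = 0 := if_neg fun e => h.ne (Fin.ext e)
      have h2 : hiIndex (extend u) i j k = j := if_pos (hc.2 h)
      simp [h1, h2, h, h.not_symm, h.ne]
    · subst h
      have h0 : ¬ Ahead u k k := fun h => h.ne rfl
      have h1 : loIndex k j k = j := if_pos rfl
      have h2 : hiIndex (extend u) k j k = j + 1 := if_neg (mt hc.1 h0)
      simp only [h1, h2, h0, true_and, false_and, or_false, Fin.ext_iff]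
      omega
    · have h1 : loIndex i j k = 0 := if_neg fun e => h.ne (Fin.ext e.symm)
      have h2 : hiIndex (extend u) i j k = j + 1 := if_neg (mt hc.1 h.not_symm)
      simp only [h1, h2, h, h.not_symm, h.ne.symm, true_and, false_and, false_or, Fin.le_def]
      omega
  have h1 : ∀ l : Fin m, (if Allowed u i j k l then I.prob k l else 0) =
      (fun x => if x ∈ Finset.Ico (loIndex i j k) (hiIndex (extend u) i j k) then
        extendProb I k x else 0) l.val := by
    intro l
    simp only [hmem, extendProb_val]
  rw [Finset.sum_congr rfl fun l _ => h1 l, Fin.sum_univ_eq_sum_range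
    (fun x => if x ∈ Finset.Ico (loIndex i j k) (hiIndex (extend u) i j k) then
        extendProb I k x else 0) m, ← Finset.sum_filter]
  unfold factor
  refine Finset.sum_congr ?_ fun _ _ => rfl
  ext x
  rw [Finset.mem_filter, Finset.mem_range]
  refine ⟨fun h => ⟨?_, h⟩, fun h => h.2⟩
  have h2 := hiIndex_le (extend u) i j k
  have h3 := (Finset.mem_Ico.1 h).2
  have h4 := j.2
  omega

theorem partialBid_eq (u : Fin n → ℚ) (i : Fin n) :
    partialBid n (extend I.val) (extendProb I) (extend u) i m = bid I u i := by
  classical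
  unfold partialBid bid
  rw [← Fin.sum_univ_eq_sum_range (fun j' => extend I.val j' *
    ∏ k ∈ Finset.range n, factor (extendProb I) (extend u) i j' k)]
  refine Finset.sum_congr rfl fun j _ => ?_
  rw [extend_val, ← Fin.prod_univ_eq_prod_range
    (fun k => factor (extendProb I) (extend u) i j k)]
  exact congrArg _ (Finset.prod_congr rfl fun k _ => factor_eq I u i k j)

theorem partialGap_eq (u : Fin n → ℚ) :
    partialGap n (extend I.val) (extendProb I) m (extend u) n =
      ∑ i, (bid I u i - u i) / u i := by
  unfold partialGap
  rw [← Fin.sum_univ_eq_sum_range (fun i' => (partialBid n (extend I.val) (extendProb I)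
    (extend u) i' m - extend u i') / extend u i')]
  exact Finset.sum_congr rfl fun i _ => by rw [partialBid_eq, extend_val]

theorem eq_prio_of_isTopBelow {u : Fin n → ℚ} {a : Fin n → Fin m} {r : ℕ}
    (h : IsTopBelow (extend u) (extend fun i => I.val (a i)) n r) :
    r = (prio I.n_pos u a).val := by
  obtain ⟨hr, h⟩ := h
  have : prio I.n_pos u a = ⟨r, hr⟩ := by
    rw [prio_eq_iff]
    intro k hk
    have h1 := h k.val k.2 fun e => hk (Fin.ext e)
    simp only [extend_val, extend_of_lt _ hr] at h1
    rw [I.val_strictMono.lt_iff_lt, I.val_strictMono.injective.eq_iff] at h1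
    exact h1
  rw [this]

open Classical in
/-- The agent that is selected after `t` steps, for values given by `a` and coins `c`. -/
noncomputable def selAgent (a : Fin n → Fin m) (c : ℕ → Bool) : ℕ → Fin n
  | 0 => prio I.n_pos (0 : Fin n → ℚ) a
  | t + 1 =>
    let v := reset t (track I t)
    if Frozen I t v then selAgent a c t
    else if ∀ k < coinsPerStep n, c (t * coinsPerStep n + k) = false then prio I.n_pos v a
    else selAgent a c t

/-- The number of steps, as an expression. -/
def numStepsExp : AExp :=
  -- The constant is `32 * 4 ^ 2`, from expanding the square in `numSteps`.
  .add (.get 0 (.const 0)) (.mul (.const 512) (.mul (.get 0 (.const 0))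
    (.mul (.mul (.add (.get 0 (.const 0)) (.const 1)) (.add (.get 0 (.const 0)) (.const 1)))
      (.mul (.add (.get 0 (.const 0)) (.const 1)) (.add (.get 0 (.const 0)) (.const 1))))))

/-- The selection program. -/
def fairProgram : Program := .seq select (.loop (cell 10) numStepsExp stepBody)

theorem eval_numStepsExp {M : Memory} {n : ℕ} (h : M 0 0 = n) :
    numStepsExp.eval M = (numSteps n : ℕ) := by
  simp only [numStepsExp, AExp.eval, Nat.floor_zero, h, numSteps]
  push_cast
  ring

theorem inputMemory_holds (a : Fin n → Fin m) {ℓ : ℕ} (c : Fin ℓ → Bool) :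
    Holds n (extend I.val) (extendProb I) m (inputMemory I a c) := by
  refine ⟨rfl, rfl, fun j _ => rfl, fun k hk l hl => ?_⟩
  have hlt : k * m + l < n * m := by nlinarith
  have e : finProdFinEquiv.symm ⟨k * m + l, hlt⟩ = ((⟨k, hk⟩, ⟨l, hl⟩) : Fin n × Fin m) := by
    rw [Equiv.symm_apply_eq, Fin.ext_iff]
    simp [finProdFinEquiv]
    ring
  have h1 : inputMemory I a c 2 (k * m + l) =
      I.prob (finProdFinEquiv.symm ⟨k * m + l, hlt⟩).1
        (finProdFinEquiv.symm ⟨k * m + l, hlt⟩).2 := dif_pos hlt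
  rw [h1, e]
  exact (extendProb_val I ⟨k, hk⟩ ⟨l, hl⟩).symm

theorem inputMemory_coin (a : Fin n → Fin m) {ℓ : ℕ} (c : Fin ℓ → Bool) (k : ℕ) :
    inputMemory I a c 4 k = (coinValue (extendCoins c k) : ℕ) := by
  show (if h : k < ℓ then (if c ⟨k, h⟩ then (1 : ℚ) else 0) else 0) = _
  unfold extendCoins coinValue
  split_ifs <;> simp_all

theorem fairProgram_run (a : Fin n → Fin m) {ℓ L B N : ℕ} (c : Fin ℓ → Bool)
    (hS : ∀ t, t ≤ numSteps n → Short n (extend I.val) (extendProb I) m B N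
      (extend (reset t (track I t))))
    (hq : ∀ r ≤ coinsPerStep n, bits ((1 / 2 : ℚ) ^ r) ≤ B)
    (hbits : ∀ t < numSteps n, ∀ i, bits (reset t (track I t) i +
      rate ℚ n * (bid I (reset t (track I t)) i - reset t (track I t) i)) ≤ B)
    (hM : Bdd B (inputMemory I a c)) (hTN : numSteps n ≤ N)
    (hgN : numSteps n * coinsPerStep n ≤ N)
    (hgL : coinsPerStep n ≤ L) (hnL : n ≤ L) (hmL : m ≤ L) (hTL : numSteps n ≤ L) :
    ∃ M', Run L B fairProgram (inputMemory I a c) M' ∧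
      M' 5 0 = ((selAgent I a (extendCoins c) (numSteps n)).val : ℕ) := by
  set M := inputMemory I a c with hMdef
  have hH : Holds n (extend I.val) (extendProb I) m M := inputMemory_holds I a c
  have hn := (hS 0 (Nat.zero_le _)).nat
  have hnN := (hS 0 (Nat.zero_le _)).agents_le
  obtain ⟨M₁, hR₁, hF₁, r, h5, hr⟩ := select_run (L := L) (N := N)
    (A := extend fun i => I.val (a i)) (u := extend (0 : Fin n → ℚ)) hn hM hH.agents
    (fun i hi => rfl)
    (fun i hi => by
      rw [extend_of_lt _ hi]; rfl) I.n_pos hnN hnL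
  rw [eq_prio_of_isTopBelow I hr] at h5
  set W := [5, 6, 7, 10, 11, 12, 13, 14, 15, 16, 17, 18, 19, 20, 21, 22] with hW
  have key : ∃ M', Run L B (.loop (cell 10) numStepsExp stepBody) M₁ M' ∧
      (Frame W M M' ∧ M' 10 0 = (numSteps n : ℕ) ∧
        M' 13 0 = (numSteps n * coinsPerStep n : ℕ) ∧
        (∀ i < n, M' 6 i = extend (track I (numSteps n)) i) ∧
        M' 5 0 = ((selAgent I a (extendCoins c) (numSteps n)).val : ℕ)) := by
    -- Invariant: cell 10 counts the steps, cell 13 the coins used, array 6 holds `track`, and cell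
    -- 5 holds the agent selected so far.
    refine Run.loop (n := numSteps n) (fun t M' => Frame W M M' ∧ M' 10 0 = (t : ℕ) ∧
        M' 13 0 = (t * coinsPerStep n : ℕ) ∧ (∀ i < n, M' 6 i = extend (track I t) i) ∧
        M' 5 0 = ((selAgent I a (extendCoins c) t).val : ℕ)) hTL ?_ ?_ hR₁.bdd ?_
    · rintro t ht M₂ hM₂ ⟨hF, h10, h13, h6, h5⟩
      have hH₂ := hH.frame hF (by decide) (by decide) (by decide)
      refine ⟨by rw [eval_cell, eval_numStepsExp hH₂.agents, h10]; exact_mod_cast ht, ?_⟩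
      have hgt : t * coinsPerStep n + coinsPerStep n ≤ numSteps n * coinsPerStep n := by
        rw [← Nat.succ_mul]; exact Nat.mul_le_mul_right _ ht
      obtain ⟨M₃, hR₃, hF₃, h10', h13', hfro, hnfro⟩ := stepBody_run (L := L) (t := t)
        (u := extend (track I t)) (A := extend fun i => I.val (a i)) (c := extendCoins c)
        (v := extend (reset t (track I t))) (fun i _ => extend_reset _ _ _) (hS t ht.le) hq
        (fun i hi => by
          have := hbits t ht ⟨i, hi⟩
          rw [← partialBid_eq] at this
          rw [extend_of_lt _ hi]
          exact this) hM₂ hH₂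
        (fun i hi => by rw [hF 3 (by decide)]; rfl) h6 h10 h13
        (fun k _ => by rw [hF 4 (by decide)]; exact inputMemory_coin I a c _) I.n_pos
        (by omega) (by omega) hgL hnL hmL
      have hfz : Frozen I t (reset t (track I t)) ↔ (n ≤ t ∧ partialGap n (extend I.val)
          (extendProb I) m (extend (reset t (track I t))) n ≤ 1 / 2) := by
        rw [partialGap_eq]; rfl
      refine ⟨M₃, hR₃, hF.trans hF₃, h10', h13', ?_⟩
      by_cases hz : Frozen I t (reset t (track I t))
      · obtain ⟨e5, e6⟩ := hfro (hfz.1 hz)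
        refine ⟨fun i hi => ?_, ?_⟩
        · rw [e6 i hi]; simp only [track, if_pos hz]
        · rw [e5, h5]; simp only [selAgent, if_pos hz]
      · obtain ⟨e6, e5, e5'⟩ := hnfro (mt hfz.2 hz)
        refine ⟨fun i hi => ?_, ?_⟩
        · rw [e6 i hi, extend_of_lt _ hi, extend_of_lt _ hi, track_succ_of_not_frozen hz,
            ← partialBid_eq]
        · by_cases hc : ∀ k < coinsPerStep n, extendCoins c (t * coinsPerStep n + k) = false
          · obtain ⟨r, hr, htop⟩ := e5 hc
            rw [hr, eq_prio_of_isTopBelow I htop]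
            simp only [selAgent, if_neg hz, if_pos hc]
          · rw [e5' hc, h5]
            simp only [selAgent, if_neg hz, if_neg hc]
    · rintro M₂ ⟨hF, h10, -⟩
      have hH₂ := hH.frame hF (by decide) (by decide) (by decide)
      rw [eval_cell, eval_numStepsExp hH₂.agents, h10]
      exact lt_irrefl _
    -- The counters and array 6 start at zero in the input memory, which matches `track I 0 = 0`;
    -- the first call of `select` has therefore ranked the agents by the zero vector.
    · refine ⟨hF₁.mono (by decide), by rw [hF₁ 10 (by decide)]; rfl, ?_, fun i hi => ?_, h5⟩
      · rw [hF₁ 13 (by decide), Nat.zero_mul, Nat.cast_zero]; rfl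
      · rw [hF₁ 6 (by decide), extend_of_lt _ hi]; rfl
  obtain ⟨M', hR, -, -, -, -, h⟩ := key
  exact ⟨M', Run.seq hR₁ hR, h⟩

end Market

/-! ### Lengths of the numbers that occur -/

/-- The rational number `q` is an integer. -/
def IsInt (q : ℚ) : Prop := ∃ z : ℤ, q = z

namespace IsInt

variable {q r : ℚ}

theorem zero : IsInt 0 := ⟨0, by simp⟩

theorem natCast (k : ℕ) : IsInt k := ⟨k, by simp⟩

theorem add (hq : IsInt q) (hr : IsInt r) : IsInt (q + r) := by
  obtain ⟨a, rfl⟩ := hq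
  obtain ⟨b, rfl⟩ := hr
  exact ⟨a + b, by push_cast; rfl⟩

theorem sub (hq : IsInt q) (hr : IsInt r) : IsInt (q - r) := by
  obtain ⟨a, rfl⟩ := hq
  obtain ⟨b, rfl⟩ := hr
  exact ⟨a - b, by push_cast; rfl⟩

theorem mul (hq : IsInt q) (hr : IsInt r) : IsInt (q * r) := by
  obtain ⟨a, rfl⟩ := hq
  obtain ⟨b, rfl⟩ := hr
  exact ⟨a * b, by push_cast; rfl⟩

theorem sum {ι : Type*} (s : Finset ι) (f : ι → ℚ) (h : ∀ i ∈ s, IsInt (f i)) :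
    IsInt (∑ i ∈ s, f i) := by
  classical
  induction s using Finset.induction_on with
  | empty => simpa using zero
  | insert a s ha ih =>
    rw [Finset.sum_insert ha]
    exact (h a (Finset.mem_insert_self a s)).add
      (ih fun i hi => h i (Finset.mem_insert_of_mem hi))

theorem of_den_dvd {D : ℕ} (h : q.den ∣ D) : IsInt (q * D) := by
  obtain ⟨k, rfl⟩ := h
  refine ⟨q.num * k, ?_⟩
  push_cast
  rw [← mul_assoc, Rat.mul_den_eq_num]

end IsInt

theorem bits_le_of_isInt {q : ℚ} {D R : ℕ} (hD : 0 < D) (h : IsInt (q * D)) (hR : |q| ≤ R) :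
    bits q ≤ R.size + D.size + D.size := by
  obtain ⟨z, hz⟩ := h
  have h1 := bits_le_of_mul_eq_int hD hz hR
  have h2 := size_mul_le R D
  omega

theorem coinsPerStep_le (n : ℕ) : coinsPerStep n ≤ 4 * (n + 1) ^ 2 :=
  Nat.clog_le_of_le_pow Nat.lt_two_pow_self.le

theorem numSteps_mono {n s : ℕ} (h : n ≤ s) : numSteps n ≤ numSteps s := by
  unfold numSteps; gcongr

/-- A bound for the natural numbers that occur. -/
def countBound (s : ℕ) : ℕ := numSteps s * (4 * (s + 1) ^ 2) + numSteps s + s + 4 * (s + 1) ^ 2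

/-- A bound for the length of the common denominator of the utilities. -/
def denBound (s : ℕ) : ℕ :=
  (s + 1) + (s * (s + 1) + 1) + (numSteps s * (4 * (s + 1) ^ 2) + 1)

/-- A bound for the lengths of the numbers that occur. -/
def bitBound (s : ℕ) : ℕ :=
  2 * denBound s + s + (2 * s + 1 + denBound s) + 2 * (s * (2 * s + 1 + denBound s) + 1) +
    countBound s + 2

theorem numSteps_mul_le {n s : ℕ} (h : n ≤ s) :
    numSteps n * coinsPerStep n ≤ numSteps s * (4 * (s + 1) ^ 2) :=
  Nat.mul_le_mul (numSteps_mono h) ((coinsPerStep_le n).trans (by gcongr))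

section Market

variable {n m : ℕ} (I : Market ℚ n m)

theorem agents_le_size : n ≤ I.size := by unfold Market.size; omega

theorem values_le_size : m ≤ I.size := by unfold Market.size; omega

theorem sum_bits_val_le : ∑ j, bits (I.val j) ≤ I.size := by unfold Market.size; omega

theorem sum_bits_prob_le : ∑ i, ∑ j, bits (I.prob i j) ≤ I.size := by unfold Market.size; omega

theorem bits_val_le (j : Fin m) : bits (I.val j) ≤ I.size :=
  (Finset.single_le_sum (f := fun j => bits (I.val j)) (fun _ _ => Nat.zero_le _)
    (Finset.mem_univ j)).trans (sum_bits_val_le I)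

theorem bits_prob_le (i : Fin n) (j : Fin m) : bits (I.prob i j) ≤ I.size :=
  ((Finset.single_le_sum (f := fun j => bits (I.prob i j)) (fun _ _ => Nat.zero_le _)
    (Finset.mem_univ j)).trans (Finset.single_le_sum (f := fun i => ∑ j, bits (I.prob i j))
      (fun _ _ => Nat.zero_le _) (Finset.mem_univ i))).trans (sum_bits_prob_le I)

/-- A common denominator of the values. -/
def valDen : ℕ := ∏ j, (I.val j).den

/-- A common denominator of the probabilities. -/
def probDen : ℕ := ∏ x : Fin n × Fin m, (I.prob x.1 x.2).den

theorem valDen_pos : 0 < valDen I := Finset.prod_pos fun j _ => (I.val j).den_pos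

theorem probDen_pos : 0 < probDen I := Finset.prod_pos fun x _ => (I.prob x.1 x.2).den_pos

theorem size_den_le_bits (q : ℚ) : q.den.size ≤ bits q := by unfold bits; omega

theorem size_valDen : (valDen I).size ≤ I.size + 1 :=
  (size_prod_le _ _).trans (Nat.add_le_add_right ((Finset.sum_le_sum fun j _ =>
    size_den_le_bits (I.val j)).trans (sum_bits_val_le I)) 1)

theorem size_probDen : (probDen I).size ≤ I.size + 1 := by
  refine (size_prod_le _ _).trans (Nat.add_le_add_right ?_ 1)
  rw [Fintype.sum_prod_type]
  exact (Finset.sum_le_sum fun i _ => Finset.sum_le_sum fun j _ =>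
    size_den_le_bits (I.prob i j)).trans (sum_bits_prob_le I)

theorem size_probDen_pow : (probDen I ^ n).size ≤ I.size * (I.size + 1) + 1 :=
  (size_pow_le _ _).trans (Nat.add_le_add_right
    (Nat.mul_le_mul (agents_le_size I) (size_probDen I)) 1)

theorem isInt_extend_val (j : ℕ) : IsInt (extend I.val j * valDen I) := by
  unfold extend
  split_ifs with h
  · exact IsInt.of_den_dvd (Finset.dvd_prod_of_mem (fun j => (I.val j).den) (Finset.mem_univ _))
  · simpa using IsInt.zero

theorem isInt_extendProb (k l : ℕ) : IsInt (extendProb I k l * probDen I) := by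
  unfold extendProb extend
  split_ifs with h h'
  · exact IsInt.of_den_dvd (Finset.dvd_prod_of_mem
      (fun x : Fin n × Fin m => (I.prob x.1 x.2).den) (Finset.mem_univ (⟨k, h⟩, ⟨l, h'⟩)))
  · simpa using IsInt.zero
  · simpa using IsInt.zero

theorem extendProb_nonneg (k l : ℕ) : 0 ≤ extendProb I k l := by
  unfold extendProb extend
  split_ifs
  exacts [I.prob_nonneg _ _, le_rfl, le_rfl]

theorem extend_val_nonneg (j : ℕ) : 0 ≤ extend I.val j := by
  unfold extend
  split_ifs
  exacts [I.val_nonneg _, le_rfl]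

theorem extend_val_le (j : ℕ) : extend I.val j ≤ 2 ^ I.size := by
  unfold extend
  split_ifs with h
  · set q := I.val ⟨j, h⟩ with hq
    have h1 : q ≤ q.num.natAbs := by
      have h0 : 0 ≤ q := I.val_nonneg _
      have hd : (1 : ℚ) ≤ q.den := by exact_mod_cast q.den_pos
      calc q ≤ q * q.den := le_mul_of_one_le_right h0 hd
        _ = q.num := Rat.mul_den_eq_num q
        _ ≤ q.num.natAbs := by
          rw [Nat.cast_natAbs]; push_cast; exact le_abs_self _
    have h2 : q.num.natAbs ≤ 2 ^ I.size := by
      refine (Nat.lt_size_self _).le.trans (Nat.pow_le_pow_right two_pos ?_)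
      have := bits_val_le I ⟨j, h⟩
      rw [← hq] at this
      exact (Nat.le_add_right _ _).trans this
    exact h1.trans (by exact_mod_cast h2)
  · positivity

theorem sum_Ico_extendProb {k : ℕ} (hk : k < n) (l : ℕ) {l' : ℕ} (hl : l' ≤ m) :
    0 ≤ ∑ i ∈ Finset.Ico l l', extendProb I k i ∧
      ∑ i ∈ Finset.Ico l l', extendProb I k i ≤ 1 := by
  refine ⟨Finset.sum_nonneg fun i _ => extendProb_nonneg I k i, ?_⟩
  calc ∑ i ∈ Finset.Ico l l', extendProb I k i ≤ ∑ i ∈ Finset.range m, extendProb I k i :=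
        Finset.sum_le_sum_of_subset_of_nonneg
          (fun i hi => Finset.mem_range.2 (by have := (Finset.mem_Ico.1 hi).2; omega))
          fun i _ _ => extendProb_nonneg I k i
    _ = ∑ l, I.prob ⟨k, hk⟩ l := by
        rw [← Fin.sum_univ_eq_sum_range (fun i => extendProb I k i)]
        exact Finset.sum_congr rfl fun l _ => extendProb_val I ⟨k, hk⟩ l
    _ = 1 := I.prob_sum _

section Formulas

variable (u : ℕ → ℚ)

theorem factor_bounds (i : ℕ) {j k : ℕ} (hj : j < m) (hk : k < n) :
    0 ≤ factor (extendProb I) u i j k ∧ factor (extendProb I) u i j k ≤ 1 :=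
  sum_Ico_extendProb I hk _ (by have := hiIndex_le u i j k; omega)

theorem isInt_factor (i j k : ℕ) : IsInt (factor (extendProb I) u i j k * probDen I) := by
  unfold factor
  rw [Finset.sum_mul]
  exact IsInt.sum _ _ fun l _ => isInt_extendProb I k l

theorem prod_factor_bounds (i : ℕ) {j : ℕ} (hj : j < m) {k : ℕ} (hk : k ≤ n) :
    0 ≤ ∏ k' ∈ Finset.range k, factor (extendProb I) u i j k' ∧
      ∏ k' ∈ Finset.range k, factor (extendProb I) u i j k' ≤ 1 := by
  have h : ∀ k' ∈ Finset.range k, k' < n := fun k' hk' => (Finset.mem_range.1 hk').trans_le hk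
  exact ⟨Finset.prod_nonneg fun k' hk' => (factor_bounds I u i hj (h k' hk')).1,
    Finset.prod_le_one (fun k' hk' => (factor_bounds I u i hj (h k' hk')).1)
      fun k' hk' => (factor_bounds I u i hj (h k' hk')).2⟩

theorem isInt_prod_factor (i j : ℕ) {k : ℕ} (hk : k ≤ n) :
    IsInt ((∏ k' ∈ Finset.range k, factor (extendProb I) u i j k') * (probDen I ^ n : ℕ)) := by
  have h : ∀ k, IsInt ((∏ k' ∈ Finset.range k, factor (extendProb I) u i j k') *
      (probDen I : ℚ) ^ k) := by
    intro k
    induction k with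
    | zero => simpa using IsInt.natCast 1
    | succ k ih =>
      rw [Finset.prod_range_succ, pow_succ]
      have := ih.mul (isInt_factor I u i j k)
      rwa [mul_mul_mul_comm] at this
  have h1 := (h k).mul (IsInt.natCast (probDen I ^ (n - k)))
  rw [mul_assoc, Nat.cast_pow, ← pow_add, Nat.add_sub_cancel' hk] at h1
  rwa [Nat.cast_pow]

theorem partialBid_bounds (i : ℕ) {j : ℕ} (hj : j ≤ m) :
    0 ≤ partialBid n (extend I.val) (extendProb I) u i j ∧
      partialBid n (extend I.val) (extendProb I) u i j ≤ (2 ^ (2 * I.size) : ℕ) := by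
  have hlt : ∀ j' ∈ Finset.range j, j' < m := fun j' h => (Finset.mem_range.1 h).trans_le hj
  refine ⟨Finset.sum_nonneg fun j' hj' => mul_nonneg (extend_val_nonneg I j')
    (prod_factor_bounds I u i (hlt j' hj') le_rfl).1, ?_⟩
  have h1 : partialBid n (extend I.val) (extendProb I) u i j ≤
      ∑ _j' ∈ Finset.range j, (2 : ℚ) ^ I.size := by
    refine Finset.sum_le_sum fun j' hj' => ?_
    have h2 := prod_factor_bounds I u i (hlt j' hj') le_rfl
    exact (mul_le_of_le_one_right (extend_val_nonneg I j') h2.2).trans (extend_val_le I j')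
  refine h1.trans ?_
  rw [Finset.sum_const, Finset.card_range, nsmul_eq_mul]
  have h3 : j ≤ 2 ^ I.size := (hj.trans (values_le_size I)).trans Nat.lt_two_pow_self.le
  have h4 : (j : ℚ) ≤ 2 ^ I.size := by exact_mod_cast h3
  push_cast
  rw [two_mul, pow_add]
  exact mul_le_mul_of_nonneg_right h4 (by positivity)

theorem isInt_partialBid (i j : ℕ) :
    IsInt (partialBid n (extend I.val) (extendProb I) u i j *
      (valDen I * probDen I ^ n : ℕ)) := by
  unfold partialBid
  rw [Finset.sum_mul]
  refine IsInt.sum _ _ fun j' _ => ?_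
  rw [Nat.cast_mul, mul_mul_mul_comm]
  exact (isInt_extend_val I j').mul (isInt_prod_factor I u i j' le_rfl)

end Formulas

theorem bid_bounds (u : Fin n → ℚ) (i : Fin n) :
    0 ≤ bid I u i ∧ bid I u i ≤ (2 ^ (2 * I.size) : ℕ) := by
  rw [← partialBid_eq]; exact partialBid_bounds I _ _ le_rfl

/-- A common denominator of the utilities after `t` steps. -/
def trackDen (t : ℕ) : ℕ := valDen I * probDen I ^ n * 2 ^ (coinsPerStep n * t)

theorem trackDen_pos (t : ℕ) : 0 < trackDen I t :=
  Nat.mul_pos (Nat.mul_pos (valDen_pos I) (pow_pos (probDen_pos I) n)) (pow_pos two_pos _)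

theorem size_trackDen {t : ℕ} (ht : t ≤ numSteps n) : (trackDen I t).size ≤ denBound I.size := by
  unfold trackDen denBound
  refine (size_mul_le _ _).trans (Nat.add_le_add ((size_mul_le _ _).trans
    (Nat.add_le_add (size_valDen I) (size_probDen_pow I))) ?_)
  rw [Nat.size_pow]
  refine Nat.add_le_add_right ?_ 1
  rw [mul_comm]
  exact (Nat.mul_le_mul_right _ ht).trans (numSteps_mul_le (agents_le_size I))

theorem trackDen_dvd {t t' : ℕ} (h : t ≤ t') : trackDen I t ∣ trackDen I t' :=
  Nat.mul_dvd_mul_left _ (pow_dvd_pow 2 (Nat.mul_le_mul_left _ h))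

theorem IsInt.of_dvd {q : ℚ} {D D' : ℕ} (h : IsInt (q * D)) (hD : D ∣ D') : IsInt (q * D') := by
  obtain ⟨k, rfl⟩ := hD
  rw [Nat.cast_mul, ← mul_assoc]
  exact h.mul (IsInt.natCast k)

theorem isInt_bid (u : Fin n → ℚ) (i : Fin n) (t : ℕ) : IsInt (bid I u i * trackDen I t) := by
  rw [← partialBid_eq]
  exact (isInt_partialBid I _ _ _).of_dvd (Dvd.intro _ rfl)

theorem rate_eq_div (n : ℕ) : rate ℚ n * (2 ^ coinsPerStep n : ℕ) = 1 := by
  unfold rate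
  push_cast
  rw [one_div, inv_pow, inv_mul_cancel₀ (by positivity)]

theorem rate_bounds (n : ℕ) : 0 ≤ rate ℚ n ∧ rate ℚ n ≤ 1 := by
  unfold rate
  exact ⟨by positivity, pow_le_one₀ (by norm_num) (by norm_num)⟩

/-- A step costs only `coinsPerStep n` further binary digits, since `bid` has the fixed denominator
`valDen I * probDen I ^ n`, whatever the priorities. The lengths thus add up over the steps instead
of multiplying. -/
theorem isInt_step {v : Fin n → ℚ} {t : ℕ} (hv : ∀ i, IsInt (v i * trackDen I t)) (i : Fin n) :
    IsInt ((v i + rate ℚ n * (bid I v i - v i)) * trackDen I (t + 1)) := by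
  have e : trackDen I (t + 1) = trackDen I t * 2 ^ coinsPerStep n := by
    unfold trackDen; rw [mul_add_one, pow_add]; ring
  have h1 := (hv i).mul (IsInt.natCast (2 ^ coinsPerStep n))
  have h2 := (isInt_bid I v i t).sub (hv i)
  have h3 : (v i + rate ℚ n * (bid I v i - v i)) * trackDen I (t + 1) =
      v i * trackDen I t * (2 ^ coinsPerStep n : ℕ) +
        (bid I v i * trackDen I t - v i * trackDen I t) *
          (rate ℚ n * (2 ^ coinsPerStep n : ℕ)) := by
    rw [e]; push_cast; ring
  rw [h3, rate_eq_div, mul_one]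
  exact h1.add h2

theorem step_bounds {v : Fin n → ℚ} (i : Fin n) (h0 : 0 ≤ v i)
    (h1 : v i ≤ (2 ^ (2 * I.size) : ℕ)) :
    0 ≤ v i + rate ℚ n * (bid I v i - v i) ∧
      v i + rate ℚ n * (bid I v i - v i) ≤ (2 ^ (2 * I.size) : ℕ) := by
  obtain ⟨h2, h3⟩ := bid_bounds I v i
  obtain ⟨h4, h5⟩ := rate_bounds n
  have h6 := mul_nonneg h4 h2
  have h7 := mul_nonneg (sub_nonneg.2 h5) h0
  have h8 := mul_le_mul_of_nonneg_left h3 h4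
  have h9 := mul_le_mul_of_nonneg_left h1 (sub_nonneg.2 h5)
  constructor <;> linarith

theorem isInt_reset {u : Fin n → ℚ} {D : ℕ} (h : ∀ i, IsInt (u i * D)) (t : ℕ) (i : Fin n) :
    IsInt (reset t u i * D) := by
  unfold reset
  split_ifs
  · simpa using IsInt.zero
  · exact h i

theorem reset_bounds {u : Fin n → ℚ} {R : ℚ} (h : ∀ i, 0 ≤ u i ∧ u i ≤ R) (t : ℕ) (i : Fin n) :
    0 ≤ reset t u i ∧ reset t u i ≤ R := by
  unfold reset
  split_ifs
  · exact ⟨le_rfl, (h i).1.trans (h i).2⟩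
  · exact h i

theorem isInt_track (t : ℕ) (i : Fin n) : IsInt (track I t i * trackDen I t) := by
  induction t generalizing i with
  | zero =>
    show IsInt (0 * _)
    rw [zero_mul]; exact IsInt.zero
  | succ t ih =>
    by_cases h : Frozen I t (reset t (track I t))
    · rw [track_succ_of_frozen h]
      exact (ih i).of_dvd (trackDen_dvd I (Nat.le_succ t))
    · rw [track_succ_of_not_frozen h]
      exact isInt_step I (isInt_reset ih t) i

theorem track_bounds_rat (t : ℕ) (i : Fin n) :
    0 ≤ track I t i ∧ track I t i ≤ (2 ^ (2 * I.size) : ℕ) := by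
  induction t generalizing i with
  | zero => exact ⟨le_rfl, Nat.cast_nonneg _⟩
  | succ t ih =>
    by_cases h : Frozen I t (reset t (track I t))
    · rw [track_succ_of_frozen h]; exact ih i
    · rw [track_succ_of_not_frozen h]
      have h1 := reset_bounds ih t i
      exact step_bounds I i h1.1 h1.2

theorem size_two_pow_size : (2 ^ (2 * I.size) : ℕ).size = 2 * I.size + 1 := Nat.size_pow

theorem bits_step_le {t : ℕ} (ht : t < numSteps n) (i : Fin n) :
    bits (reset t (track I t) i + rate ℚ n * (bid I (reset t (track I t)) i -
      reset t (track I t) i)) ≤ bitBound I.size := by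
  have h1 := reset_bounds (track_bounds_rat I t) t i
  have h2 := step_bounds I i h1.1 h1.2
  have h3 := bits_le_of_isInt (trackDen_pos I (t + 1))
    (isInt_step I (isInt_reset (isInt_track I t) t) i) (by rw [abs_of_nonneg h2.1]; exact h2.2)
  have h4 := size_trackDen I (t := t + 1) ht
  rw [size_two_pow_size] at h3
  unfold bitBound
  omega

/-- The relative gap of `b` over `v` is short if `D` is a common denominator of both. -/
theorem exists_den_of_gap {b v : ℚ} {D R : ℕ} (hD : 0 < D) (hb : IsInt (b * D))
    (hv : IsInt (v * D)) (hb0 : 0 ≤ b) (hbR : b ≤ R) (hv0 : 0 ≤ v) (hvR : v ≤ R) (hR : 0 < R) :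
    ∃ E : ℕ, 0 < E ∧ E ≤ R * D ∧ IsInt ((b - v) / v * E) ∧ |(b - v) / v| ≤ (R * D : ℕ) := by
  obtain ⟨z, hz⟩ := hv
  have hDq : (0 : ℚ) < D := by exact_mod_cast hD
  rcases hv0.eq_or_lt with h0 | h0
  · refine ⟨1, one_pos, Nat.mul_pos hR hD, ?_, ?_⟩
    · rw [← h0]; simpa using IsInt.zero
    · rw [← h0]; simp; positivity
  · have hzpos : (0 : ℚ) < z := hz ▸ mul_pos h0 hDq
    have hz1 : 0 < z := by exact_mod_cast hzpos
    have hzn : ((z.toNat : ℕ) : ℚ) = z := by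
      have := Int.toNat_of_nonneg hz1.le
      exact_mod_cast this
    -- With `z = v * D` the quotient is `(b * D - z) / z`, so the integer `z` is a denominator. It
    -- is at least 1, which also bounds the quotient.
    refine ⟨z.toNat, by omega, ?_, ?_, ?_⟩
    · have : ((z.toNat : ℕ) : ℚ) ≤ (R * D : ℕ) := by
        rw [hzn, ← hz, Nat.cast_mul]
        exact mul_le_mul_of_nonneg_right hvR hDq.le
      exact_mod_cast this
    · have e : (b - v) / v * (z.toNat : ℕ) = b * D - z := by
        rw [hzn, ← hz]; field_simp
      rw [e]
      exact hb.sub ⟨z, rfl⟩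
    · have h1 : |b - v| ≤ R := by rw [abs_le]; constructor <;> linarith
      have h2 : 1 ≤ v * D := by rw [hz]; exact_mod_cast hz1
      rw [abs_div, abs_of_pos h0, div_le_iff₀ h0, Nat.cast_mul]
      have h3 : (0 : ℚ) ≤ R := Nat.cast_nonneg R
      calc |b - v| ≤ R * 1 := by rw [mul_one]; exact h1
        _ ≤ R * (v * D) := mul_le_mul_of_nonneg_left h2 h3
        _ = R * D * v := by ring

/-- The summands need not share a short denominator, but the product of at most `n` denominators
bounded by `R` is short enough. -/
theorem bits_sum_le {k n : ℕ} (hk : k ≤ n) (f : ℕ → ℚ) (R : ℕ)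
    (h : ∀ i < n, ∃ E : ℕ, 0 < E ∧ E ≤ R ∧ IsInt (f i * E) ∧ |f i| ≤ R) :
    bits (∑ i ∈ Finset.range k, f i) ≤ n + R.size + 2 * (n * R.size + 1) := by
  have hlt : ∀ i ∈ Finset.range k, i < n := fun i hi => (Finset.mem_range.1 hi).trans_le hk
  choose! E hE0 hER hEi hfR using h
  have hD : 0 < ∏ i ∈ Finset.range k, E i := Finset.prod_pos fun i hi => hE0 i (hlt i hi)
  have hint : IsInt ((∑ i ∈ Finset.range k, f i) * (∏ i ∈ Finset.range k, E i : ℕ)) := by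
    rw [Finset.sum_mul]
    exact IsInt.sum _ _ fun i hi => (hEi i (hlt i hi)).of_dvd (Finset.dvd_prod_of_mem E hi)
  have habs : |∑ i ∈ Finset.range k, f i| ≤ (k * R : ℕ) := by
    refine (Finset.abs_sum_le_sum_abs _ _).trans ((Finset.sum_le_sum fun i hi =>
      hfR i (hlt i hi)).trans_eq ?_)
    simp
  have h1 := bits_le_of_isInt hD hint habs
  have h2 : (∏ i ∈ Finset.range k, E i).size ≤ n * R.size + 1 := by
    refine (size_prod_le _ _).trans (Nat.add_le_add_right ?_ 1)
    refine (Finset.sum_le_sum fun i hi => Nat.size_le_size (hER i (hlt i hi))).trans ?_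
    rw [Finset.sum_const, Finset.card_range, smul_eq_mul]
    exact Nat.mul_le_mul_right _ hk
  have h3 := size_mul_le k R
  have h4 := size_le_self k
  omega

theorem short_track {t : ℕ} (ht : t ≤ numSteps n) :
    Short n (extend I.val) (extendProb I) m (bitBound I.size) (countBound I.size)
      (extend (reset t (track I t))) := by
  have hn := agents_le_size I
  have hm := values_le_size I
  have hp := size_probDen I
  have hp' := size_probDen_pow I
  have hv := size_valDen I
  refine ⟨fun x hx => ?_, ?_, ?_, fun k hk l l' hl => ?_, fun i _ j hj k hk => ?_,
    fun i _ j hj => ?_, fun i hi => ?_⟩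
  · have := bits_natCast_le hx
    unfold bitBound; omega
  · unfold countBound; omega
  · unfold countBound; omega
  · have h1 := sum_Ico_extendProb I hk l hl
    have h2 := bits_le_of_isInt (q := ∑ i ∈ Finset.Ico l l', extendProb I k i) (R := 1)
      (probDen_pos I) (by
        rw [Finset.sum_mul]
        exact IsInt.sum _ _ fun i _ => isInt_extendProb I k i)
      (by rw [abs_of_nonneg h1.1]; exact_mod_cast h1.2)
    rw [Nat.size_one] at h2
    unfold bitBound denBound; omega
  · have h1 := prod_factor_bounds I (extend (reset t (track I t))) i hj hk
    have h2 := bits_le_of_isInt (R := 1) (pow_pos (probDen_pos I) n)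
      (isInt_prod_factor I (extend (reset t (track I t))) i j hk)
      (by rw [abs_of_nonneg h1.1]; exact_mod_cast h1.2)
    rw [Nat.size_one] at h2
    unfold bitBound denBound
    omega
  · have h1 := partialBid_bounds I (extend (reset t (track I t))) i hj
    have h2 := bits_le_of_isInt (Nat.mul_pos (valDen_pos I) (pow_pos (probDen_pos I) n))
      (isInt_partialBid I (extend (reset t (track I t))) i j)
      (by rw [abs_of_nonneg h1.1]; exact h1.2)
    rw [size_two_pow_size] at h2
    have h3 := size_mul_le (valDen I) (probDen I ^ n)
    unfold bitBound denBound
    omega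
  -- The gap divides by the utilities, so it leaves the common denominator `trackDen I t`. It is
  -- only compared with `1/2` and never enters the utilities, so its longer denominators do not
  -- accumulate.
  · have h1 := bits_sum_le hi (fun i' => (partialBid n (extend I.val) (extendProb I)
      (extend (reset t (track I t))) i' m - extend (reset t (track I t)) i') /
        extend (reset t (track I t)) i') (2 ^ (2 * I.size) * trackDen I t) (by
      intro i' hi'
      have e := partialBid_eq I (reset t (track I t)) ⟨i', hi'⟩
      simp only at e
      have h2 := bid_bounds I (reset t (track I t)) ⟨i', hi'⟩
      have h3 := reset_bounds (track_bounds_rat I t) t ⟨i', hi'⟩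
      simp only [e, extend_of_lt _ hi']
      exact exists_den_of_gap (trackDen_pos I t) (isInt_bid I _ _ t)
        (isInt_reset (isInt_track I t) t _) h2.1 h2.2 h3.1 h3.2 (by positivity))
    have h4 : (2 ^ (2 * I.size) * trackDen I t).size ≤ 2 * I.size + 1 + denBound I.size := by
      refine (size_mul_le _ _).trans (Nat.add_le_add (size_two_pow_size I).le
        (size_trackDen I ht))
    have h5 := Nat.mul_le_mul hn h4
    unfold partialGap
    unfold bitBound
    omega

theorem bdd_inputMemory (a : Fin n → Fin m) {ℓ : ℕ} (c : Fin ℓ → Bool) :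
    Bdd (bitBound I.size) (inputMemory I a c) := by
  have hs : ∀ q, bits q ≤ I.size → bits q ≤ bitBound I.size := fun q h => by
    unfold bitBound; omega
  have h0 : bits (0 : ℚ) ≤ bitBound I.size :=
    (by exact_mod_cast bits_natCast_le (le_refl 0) : bits (0 : ℚ) ≤ 0 + 1).trans
      (by unfold bitBound; omega)
  have h1 : bits (1 : ℚ) ≤ bitBound I.size :=
    (by exact_mod_cast bits_natCast_le (le_refl 1) : bits (1 : ℚ) ≤ 1 + 1).trans
      (by unfold bitBound; omega)
  have hnat : ∀ x : ℕ, x ≤ I.size → bits (x : ℚ) ≤ bitBound I.size := fun x hx =>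
    (bits_natCast_le hx).trans (by unfold bitBound; omega)
  intro b k
  unfold inputMemory
  split
  · exact hnat n (agents_le_size I)
  · exact hnat m (values_le_size I)
  · split_ifs
    exacts [hs _ (bits_val_le I _), h0]
  · split_ifs
    exacts [hs _ (bits_prob_le I _ _), h0]
  · split_ifs
    exacts [hs _ (bits_val_le I _), h0]
  · split_ifs
    exacts [h1, h0, h0]
  · exact h0

theorem bits_half_pow_le {r : ℕ} (hr : r ≤ coinsPerStep n) :
    bits ((1 / 2 : ℚ) ^ r) ≤ bitBound I.size := by
  have h1 : (1 / 2 : ℚ) ^ r = ((1 : ℤ) : ℚ) / ((2 ^ r : ℕ) : ℚ) := by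
    push_cast; rw [one_div, inv_pow, one_div]
  have h2 := bits_le_of_eq_div (pow_pos two_pos r) h1 (N := 1) (by simp)
  rw [Nat.size_one, Nat.size_pow] at h2
  have h3 := coinsPerStep_le n
  have h4 : 4 * (n + 1) ^ 2 ≤ 4 * (I.size + 1) ^ 2 := by
    have := agents_le_size I
    gcongr
  unfold bitBound countBound
  omega

theorem fairProgram_run_of_size (a : Fin n → Fin m) {ℓ : ℕ} (c : Fin ℓ → Bool) :
    ∃ M', Run (countBound I.size) (bitBound I.size) fairProgram (inputMemory I a c) M' ∧
      M' 5 0 = ((selAgent I a (extendCoins c) (numSteps n)).val : ℕ) := by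
  have hn := agents_le_size I
  have hm := values_le_size I
  have hT := numSteps_mono hn
  have hg : coinsPerStep n ≤ 4 * (I.size + 1) ^ 2 := (coinsPerStep_le n).trans (by gcongr)
  have hTg := numSteps_mul_le hn
  have hN : ∀ x, x ≤ I.size ∨ x ≤ numSteps I.size ∨ x ≤ 4 * (I.size + 1) ^ 2 ∨
      x ≤ numSteps I.size * (4 * (I.size + 1) ^ 2) → x ≤ countBound I.size := by
    intro x hx
    unfold countBound
    omega
  exact fairProgram_run I a c (fun t ht => short_track I ht) (fun r hr => bits_half_pow_le I hr)
    (fun t ht i => bits_step_le I ht i) (bdd_inputMemory I a c) (hN _ (by omega))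
    (hN _ (by omega)) (hN _ (by omega)) (hN _ (by omega)) (hN _ (by omega)) (hN _ (by omega))

end Market

/-! ### Coin tosses -/

section Coins

variable {ℓ : ℕ}

theorem extendCoins_update (c : Fin ℓ → Bool) (p : Fin ℓ) (b : Bool) :
    extendCoins (Function.update c p b) = Function.update (extendCoins c) p.val b := by
  funext k
  unfold extendCoins
  rcases eq_or_ne k p.val with rfl | h
  · simp
  · rw [Function.update_of_ne h]
    split_ifs with hk
    · rw [Function.update_of_ne (fun e => h (congrArg Fin.val e))]
    · rfl

/-- A toss that does not affect `φ` shows tails on half of the mass of `φ`. -/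
theorem sum_coin_false {φ : (ℕ → Bool) → ℝ} {p : ℕ} (hp : p < ℓ)
    (hφ : ∀ c b, φ (Function.update c p b) = φ c) :
    ∑ c : Fin ℓ → Bool, (if extendCoins c p = false then φ (extendCoins c) else 0) =
      1 / 2 * ∑ c : Fin ℓ → Bool, φ (extendCoins c) := by
  -- Flipping the toss at `p` is an involution that preserves `φ` and exchanges the two halves of
  -- the sum.
  let flip : (Fin ℓ → Bool) → (Fin ℓ → Bool) := fun c => Function.update c ⟨p, hp⟩ (!c ⟨p, hp⟩)
  have hflip : Function.Involutive flip := fun c => by simp [flip]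
  have h1 : ∑ c : Fin ℓ → Bool, (if extendCoins c p = false then φ (extendCoins c) else 0) =
      ∑ c : Fin ℓ → Bool, (if extendCoins c p = false then 0 else φ (extendCoins c)) := by
    refine Fintype.sum_equiv hflip.toPerm _ _ fun c => ?_
    have e : extendCoins (flip c) = Function.update (extendCoins c) p (!c ⟨p, hp⟩) :=
      extendCoins_update c ⟨p, hp⟩ _
    have e' : extendCoins c p = c ⟨p, hp⟩ := dif_pos hp
    simp only [Function.Involutive.coe_toPerm, e, hφ, e', Function.update_self]
    cases c ⟨p, hp⟩ <;> simp
  have h2 : ∑ c : Fin ℓ → Bool, φ (extendCoins c) =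
      ∑ c : Fin ℓ → Bool, (if extendCoins c p = false then φ (extendCoins c) else 0) +
        ∑ c : Fin ℓ → Bool, (if extendCoins c p = false then 0 else φ (extendCoins c)) := by
    rw [← Finset.sum_add_distrib]
    exact Finset.sum_congr rfl fun c _ => by split_ifs <;> simp
  rw [h2, ← h1]; ring

/-- One toss at a time: the condition on the first `g` tosses times `φ` does not depend on the toss
at `s + g`. -/
theorem sum_coins_false {φ : (ℕ → Bool) → ℝ} {s : ℕ}
    (hφ : ∀ c p b, s ≤ p → φ (Function.update c p b) = φ c) (g : ℕ) (hg : s + g ≤ ℓ) :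
    ∑ c : Fin ℓ → Bool,
        (if ∀ k < g, extendCoins c (s + k) = false then φ (extendCoins c) else 0) =
      (1 / 2) ^ g * ∑ c : Fin ℓ → Bool, φ (extendCoins c) := by
  induction g with
  | zero => simp
  | succ g ih =>
    have h := sum_coin_false (φ := fun c => if ∀ k < g, c (s + k) = false then φ c else 0)
      (show s + g < ℓ by omega) fun c b => by
        have e : ∀ k < g, Function.update c (s + g) b (s + k) = c (s + k) := fun k hk =>
          Function.update_of_ne (by omega) _ _
        have e' : (∀ k < g, Function.update c (s + g) b (s + k) = false) ↔
            ∀ k < g, c (s + k) = false :=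
          forall₂_congr fun k hk => by rw [e k hk]
        simp only [e', hφ c _ b (Nat.le_add_right s g)]
    rw [ih (by omega)] at h
    rw [pow_succ', mul_assoc, ← h]
    refine Finset.sum_congr rfl fun c _ => ?_
    simp only [Nat.forall_lt_succ_right, ← ite_and]
    exact if_congr and_comm rfl rfl

end Coins

section Selection

variable {n m : ℕ} (I : Market ℚ n m) (a : Fin n → Fin m)

/-- The agent selected after `t` steps depends only on the first `t` blocks of coins, hence is
independent of the next block. -/
theorem selAgent_update (c : ℕ → Bool) (b : Bool) {t p : ℕ} (hp : t * coinsPerStep n ≤ p) :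
    selAgent I a (Function.update c p b) t = selAgent I a c t := by
  induction t with
  | zero => rfl
  | succ t ih =>
    rw [add_one_mul] at hp
    have e : (∀ k < coinsPerStep n,
        Function.update c p b (t * coinsPerStep n + k) = false) ↔
        ∀ k < coinsPerStep n, c (t * coinsPerStep n + k) = false :=
      forall₂_congr fun k hk => by rw [Function.update_of_ne (by omega)]
    simp only [selAgent, e, ih (by omega)]

theorem sum_selAgent {ℓ t : ℕ} (ht : t * coinsPerStep n ≤ ℓ) (i : Fin n) :
    ∑ c : Fin ℓ → Bool, (if selAgent I a (extendCoins c) t = i then (1 : ℝ) else 0) =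
      selectProb I.toReal a t i * 2 ^ ℓ := by
  induction t with
  | zero =>
    have h := prio_cast I.n_pos (0 : Fin n → ℚ) a
    have h0 : (fun i => ((0 : Fin n → ℚ) i : ℝ)) = 0 := by funext; simp
    rw [h0] at h
    simp only [selAgent, selectProb, h, Pi.single_apply, eq_comm (a := i)]
    split_ifs with hi <;> simp [hi]
  | succ t ih =>
    rw [add_one_mul] at ht
    have ih := ih (by omega)
    have hv : reset t (track I.toReal t) = fun i => ((reset t (track I t) i : ℚ) : ℝ) := by
      rw [track_cast, reset_cast]
    have hp := prio_cast I.n_pos (reset t (track I t)) a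
    have hf := frozen_cast I t (reset t (track I t))
    rw [← hv] at hp hf
    by_cases hz : Frozen I t (reset t (track I t))
    · simp only [selAgent, selectProb, hf, hz, if_true, ih]
    · have h1 := sum_coins_false (ℓ := ℓ) (φ := fun c => if selAgent I a c t = i then 1 else 0)
        (s := t * coinsPerStep n)
        (fun c p b hp => by rw [selAgent_update I a c b hp]) (coinsPerStep n) ht
      have h2 := sum_coins_false (ℓ := ℓ)
        (φ := fun _ => if prio I.n_pos (reset t (track I t)) a = i then 1 else 0)
        (s := t * coinsPerStep n) (fun _ _ _ _ => rfl) (coinsPerStep n) ht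
      -- The case distinction is written as a sum in which the block of coins occurs only in
      -- products with quantities that do not depend on it, as `sum_coins_false` requires.
      have h3 : ∀ c : ℕ → Bool, (if selAgent I a c (t + 1) = i then (1 : ℝ) else 0) =
          (if ∀ k < coinsPerStep n, c (t * coinsPerStep n + k) = false then
              (if prio I.n_pos (reset t (track I t)) a = i then 1 else 0) else 0) +
            (if selAgent I a c t = i then 1 else 0) -
            (if ∀ k < coinsPerStep n, c (t * coinsPerStep n + k) = false then
              (if selAgent I a c t = i then 1 else 0) else 0) := fun c => by
        simp only [selAgent, hz, if_false]
        by_cases hc : ∀ k < coinsPerStep n, c (t * coinsPerStep n + k) = false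
        · simp only [if_pos hc]; ring
        · simp only [if_neg hc]; ring
      simp only [h3, Finset.sum_sub_distrib, Finset.sum_add_distrib, h1, h2, ih]
      simp only [selectProb, hf, hz, if_false, hp, Pi.single_apply, eq_comm (a := i), rate]
      split_ifs <;> simp <;> ring

theorem card_selAgent {ℓ t : ℕ} (ht : t * coinsPerStep n ≤ ℓ) (i : Fin n) :
    selectProb I.toReal a t i =
      (Nat.card {c : Fin ℓ → Bool // selAgent I a (extendCoins c) t = i} : ℝ) / 2 ^ ℓ := by
  rw [eq_div_iff (by positivity), ← sum_selAgent I a ht i, Nat.card_eq_fintype_card,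
    Fintype.card_subtype, Finset.sum_boole]

end Selection

/-! ### The running time -/

theorem exists_polynomial_numSteps : ∃ P : Polynomial ℕ, ∀ s, P.eval s = numSteps s := by
  refine ⟨.X + 32 * .X * (4 * (.X + 1) ^ 2) ^ 2, fun s => ?_⟩
  simp [numSteps]

theorem exists_polynomial_countBound : ∃ P : Polynomial ℕ, ∀ s, P.eval s = countBound s := by
  obtain ⟨N, hN⟩ := exists_polynomial_numSteps
  refine ⟨N * (4 * (.X + 1) ^ 2) + N + .X + 4 * (.X + 1) ^ 2, fun s => ?_⟩
  simp [countBound, hN]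

theorem exists_polynomial_bitBound : ∃ P : Polynomial ℕ, ∀ s, P.eval s = bitBound s := by
  obtain ⟨N, hN⟩ := exists_polynomial_numSteps
  obtain ⟨C, hC⟩ := exists_polynomial_countBound
  obtain ⟨D, hD⟩ : ∃ P : Polynomial ℕ, ∀ s, P.eval s = denBound s :=
    ⟨(.X + 1) + (.X * (.X + 1) + 1) + (N * (4 * (.X + 1) ^ 2) + 1), fun s => by
      simp [denBound, hN]⟩
  refine ⟨2 * D + .X + (2 * .X + 1 + D) + 2 * (.X * (2 * .X + 1 + D) + 1) + C + 2, fun s => ?_⟩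
  simp [bitBound, hC, hD]

/-- One polynomial bounds both the cost and the number of coins; the summand `C` guarantees enough
coins for all steps. Surplus coins are never read and do not affect the probabilities. -/
theorem polyTimeSelection_fairRule :
    PolyTimeSelection fun _ _ (I : Market ℚ _ _) => fairRule I.toReal := by
  obtain ⟨C, hC⟩ := exists_polynomial_countBound
  obtain ⟨B, hB⟩ := exists_polynomial_bitBound
  refine ⟨fairProgram, fairProgram.stepPoly.comp C * B + C, fun n m I a =>
    ⟨fun c => selAgent I a (extendCoins c) (numSteps n), fun c => ?_, fun i => ?_⟩⟩
  · obtain ⟨M, ⟨-, t, hM, ht⟩, hout⟩ := fairProgram_run_of_size I a c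
    refine ⟨M, t, hM, ht.trans ?_, hout⟩
    rw [Polynomial.eval_add, Polynomial.eval_mul, Polynomial.eval_comp, hC, hB]
    exact Nat.le_add_right _ _
  · refine card_selAgent I a ?_ i
    rw [Polynomial.eval_add, hC]
    refine le_trans ?_ (Nat.le_add_left _ _)
    exact (numSteps_mul_le (agents_le_size I)).trans (by unfold countBound; omega)

end Persuasion

theorem theorem2 :
    (∃ W : ∀ (n m : ℕ) (I : Persuasion.Market ℚ n m), Persuasion.SelectionRule I.toReal,
      Persuasion.PolyTimeSelection W ∧
      ∀ (n m : ℕ) (I : Persuasion.Market ℚ n m),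
        Persuasion.IsMajorizedWithin 2 (Persuasion.fullRevelationPolicies I.toReal)
          (W n m I).policy) ∧
    (∀ (n m : ℕ) (I : Persuasion.Market ℝ n m), ∃ w : Persuasion.SelectionRule I,
      Persuasion.IsMajorizedWithin 2 (Persuasion.fullRevelationPolicies I) w.policy) :=
  ⟨⟨fun _ _ I => Persuasion.fairRule I.toReal, Persuasion.polyTimeSelection_fairRule,
    fun _ _ I => Persuasion.fairRule_isMajorizedWithin I.toReal⟩,
    fun _ _ I => ⟨Persuasion.fairRule I, Persuasion.fairRule_isMajorizedWithin I⟩⟩
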